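/- **Conventions.** A *poset* is a set with a reflexive transitive relation (partial orders being a special case); $p,q$ are *compatible* in $P$ if they have a common extension in $P$. If $P,Q$ are posets and $M$ is a class, $P\lessdot_M Q$ means that $P$ is a suborder of $Q$ and every maximal antichain of $P$ that belongs to $M$ is a maximal antichain of $Q$; $P\lessdot Q$ means the same for all maximal antichains of $P$. An element $p\in P$ is a *reduction* of $q\in Q$ with respect to $P,Q$ if every $p'\le p$ in $P$ is compatible with $q$ in $Q$. A system $\langle P_\wedge,P_0,P_1,P_\vee\rangle$ of posets is *correct with respect to $M$* if $P_\wedge,P_0\in M$, $P_\wedge\lessdot P_0$, $P_\wedge\lessdot_M P_1$, $P_0\lessdot_M P_\vee$, $P_1\lessdot P_\vee$, and whenever $p\in P_\wedge$ is a reduction of $q\in P_0$ (with respect to $P_\wedge,P_0$), $p$ is a reduction of $q$ with respect to $P_1,P_\vee$. A *directed system of posets* over a directed order $I$ is a sequence $\langle P_i\rangle_{i\in I}$ of posets with $P_i\lessdot P_j$ for $i\le j$; its *direct limit* is $\bigcup_{i\in I}P_i$, ordered by the union of the orders. **Setting.** Let $M\subseteq N$ be transitive models of $\mathrm{ZFC}$.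 Let $\langle\sqsubset_n\rangle_{n<\omega}$ be an increasing sequence of closed binary relations on $\omega^\omega$, coded by a set in $M$, such that $\{f\in\omega^\omega: f\sqsubset_n g\}$ is nowhere dense for all $n<\omega$ and $g\in\omega^\omega$; put $f\sqsubset g$ iff $f\sqsubset_n g$ for some $n$ (in forcing extensions, $\sqsubset$ is interpreted through the code). Fix a real $c\in\omega^\omega\cap N$ which is $\sqsubset$-unbounded over $M$, i.e. $c\not\sqsubset g$ for every $g\in\omega^\omega\cap M$. For posets $P\in M$ and $Q\in N$, let $(\star,P,Q,M,N,\sqsubset,c)$ be the statement: $P\lessdot_M Q$ and, for every $P$-name $\dot h\in M$ for a real (that is, $\Vdash_{P,M}\dot h\in\omega^\omega$), $\Vdash_{Q,N} c\not\sqsubset\dot h$. Here $\Vdash_{P,M}$ is the forcing relation of $P$ over the model $M$. **Theorem.** Let $I\in M$ be a directed order and let $\langle P_i\rangle_{i\in I}\in M$ and $\langle Q_i\rangle_{i\in I}\in N$ be directed systems of posets such that 1. for each $i\in I$, $(\star,P_i,Q_i,M,N,\sqsubset,c)$ holds, and 2. whenever $i\le j$ in $I$, the system $\langle P_i,P_j,Q_i,Q_j\rangle$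 is correct with respect to $M$. Let $P$ and $Q$ be the direct limits of $\langle P_i\rangle_{i\in I}$ and $\langle Q_i\rangle_{i\in I}$. Then $P\in M$, $Q\in N$ and $(\star,P,Q,M,N,\sqsubset,c)$ holds. Moreover, for every $i\in I$, the system $\langle P_i,P,Q_i,Q\rangle$ is correct with respect to $M$. -/

import Mathlib

universe u

open FirstOrder

noncomputable section

namespace ForcingLimit

/-! ## The first-order language of set theory and transitive models of ZFC -/

/-- The only non-logical symbol of the language of set theory: the binary relation symbol `∈`. -/
inductive SetRel : ℕ → Type
  | mem : SetRel 2

/-- The first-order language of set theory. -/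
def setLang : FirstOrder.Language := ⟨fun _ => Empty, SetRel⟩

/-- A class `M` of sets is a structure for the language of set theory, with the true `∈`. -/
instance memStructure (M : Set ZFSet.{u}) : setLang.Structure M where
  funMap := fun f _ => f.elim
  RelMap := fun {_} R => match R with
    | SetRel.mem => fun xs => (xs 0).1 ∈ (xs 1).1

/-- `M` is a transitive class (a set or a proper class) such that `(M, ∈)` satisfies every axiom of
ZFC.  Quantifiers of the axioms range over `M`; the schemata of separation and replacement are
indexed by the first-order formulas of the language of set theory, with parameters from `M`. -/
structure IsTransitiveModelZFC (M : Set ZFSet.{u}) : Prop where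
  transitive : ∀ x ∈ M, ∀ y ∈ x, y ∈ M
  extensionality : ∀ x y : M, (∀ z : M, z.1 ∈ x.1 ↔ z.1 ∈ y.1) → x = y
  foundation : ∀ x : M, (∃ y : M, y.1 ∈ x.1) →
    ∃ y : M, y.1 ∈ x.1 ∧ ∀ z : M, z.1 ∈ x.1 → z.1 ∉ y.1
  pairing : ∀ x y : M, ∃ z : M, ∀ w : M, w.1 ∈ z.1 ↔ (w = x ∨ w = y)
  union : ∀ x : M, ∃ z : M, ∀ w : M, w.1 ∈ z.1 ↔ ∃ y : M, y.1 ∈ x.1 ∧ w.1 ∈ y.1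
  powerset : ∀ x : M, ∃ z : M, ∀ w : M, w.1 ∈ z.1 ↔ ∀ v : M, v.1 ∈ w.1 → v.1 ∈ x.1
  infinity : ∃ w : M, (∃ e : M, (∀ z : M, z.1 ∉ e.1) ∧ e.1 ∈ w.1) ∧
    ∀ x : M, x.1 ∈ w.1 → ∃ y : M, y.1 ∈ w.1 ∧ ∀ z : M, z.1 ∈ y.1 ↔ (z.1 ∈ x.1 ∨ z = x)
  separation : ∀ (n : ℕ) (φ : setLang.BoundedFormula Empty (n + 1)) (v : Fin n → M) (a : M),
    ∃ b : M, ∀ x : M, x.1 ∈ b.1 ↔ (x.1 ∈ a.1 ∧ φ.Realize Empty.elim (Fin.cons x v))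
  replacement : ∀ (n : ℕ) (φ : setLang.BoundedFormula Empty (n + 2)) (v : Fin n → M) (a : M),
    (∀ x y y' : M, x.1 ∈ a.1 → φ.Realize Empty.elim (Fin.cons x (Fin.cons y v)) →
      φ.Realize Empty.elim (Fin.cons x (Fin.cons y' v)) → y = y') →
    ∃ b : M, ∀ y : M, y.1 ∈ b.1 ↔
      ∃ x : M, x.1 ∈ a.1 ∧ φ.Realize Empty.elim (Fin.cons x (Fin.cons y v))
  choice : ∀ a : M, (∀ x : M, x.1 ∈ a.1 → ∃ z : M, z.1 ∈ x.1) →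
    (∀ x y z : M, x.1 ∈ a.1 → y.1 ∈ a.1 → z.1 ∈ x.1 → z.1 ∈ y.1 → x = y) →
    ∃ s : M, ∀ x : M, x.1 ∈ a.1 → ∃! z : M, z.1 ∈ x.1 ∧ z.1 ∈ s.1

/-! ## Posets as sets -/

/-- A carrier set together with a set of ordered pairs, intended as its order. -/
structure PosetData where
  carrier : ZFSet.{u}
  rel : ZFSet.{u}

namespace PosetData

/-- `p ≤ q`. -/
def Le (P : PosetData.{u}) (p q : ZFSet.{u}) : Prop := ZFSet.pair p q ∈ P.rel

/-- The set `⟨carrier, order⟩`. -/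
def toSet (P : PosetData.{u}) : ZFSet.{u} := ZFSet.pair P.carrier P.rel

/-- Posets in the sense of forcing: the order is reflexive and transitive.  Antisymmetry is not
required (partial orders are a special case). -/
structure IsPoset (P : PosetData.{u}) : Prop where
  rel_subset : P.rel ⊆ ZFSet.prod P.carrier P.carrier
  refl : ∀ p ∈ P.carrier, P.Le p p
  trans : ∀ p q r, P.Le p q → P.Le q r → P.Le p r

/-- `p` and `q` have a common extension in `P`. -/
def Compat (P : PosetData.{u}) (p q : ZFSet.{u}) : Prop :=
  ∃ r ∈ P.carrier, P.Le r p ∧ P.Le r q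

/-- `A` is a maximal antichain of `P`. -/
def IsMaxAntichain (P : PosetData.{u}) (A : ZFSet.{u}) : Prop :=
  A ⊆ P.carrier ∧ (∀ a ∈ A, ∀ b ∈ A, a ≠ b → ¬ P.Compat a b) ∧
    ∀ p ∈ P.carrier, ∃ a ∈ A, P.Compat a p

/-- `P` is a suborder of `Q`. -/
def IsSuborder (P Q : PosetData.{u}) : Prop :=
  P.carrier ⊆ Q.carrier ∧ ∀ p ∈ P.carrier, ∀ q ∈ P.carrier, P.Le p q ↔ Q.Le p q

/-- `P ⋖_M Q`: `P` is a suborder of `Q`, and every maximal antichain of `P` which belongs to `M` is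
a maximal antichain of `Q`. -/
def CompleteSuborderOver (M : Set ZFSet.{u}) (P Q : PosetData.{u}) : Prop :=
  P.IsSuborder Q ∧ ∀ A ∈ M, P.IsMaxAntichain A → Q.IsMaxAntichain A

/-- `P ⋖ Q`: `P` is a complete suborder of `Q`. -/
def CompleteSuborder (P Q : PosetData.{u}) : Prop :=
  CompleteSuborderOver Set.univ P Q

/-- `p ∈ P` is a reduction of `q` with respect to `P`, `Q`: every extension of `p` in `P` is
compatible with `q` in `Q`. -/
def IsReduction (P Q : PosetData.{u}) (p q : ZFSet.{u}) : Prop :=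
  p ∈ P.carrier ∧ q ∈ Q.carrier ∧ ∀ r ∈ P.carrier, P.Le r p → Q.Compat r q

/-- The system `⟨P∧, P0, P1, P∨⟩` is correct with respect to `M`. -/
structure CorrectOver (M : Set ZFSet.{u}) (Pw P0 P1 Pv : PosetData.{u}) : Prop where
  poset_w : Pw.IsPoset
  poset_0 : P0.IsPoset
  poset_1 : P1.IsPoset
  poset_v : Pv.IsPoset
  mem_w : Pw.toSet ∈ M
  mem_0 : P0.toSet ∈ M
  w_0 : CompleteSuborder Pw P0
  w_1 : CompleteSuborderOver M Pw P1
  zero_v : CompleteSuborderOver M P0 Pv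
  one_v : CompleteSuborder P1 Pv
  reduction : ∀ p q, IsReduction Pw P0 p q → IsReduction P1 Pv p q

/-! ### Directed systems and direct limits -/

/-- Any two elements have an upper bound. -/
def IsDirectedPoset (I : PosetData.{u}) : Prop :=
  I.IsPoset ∧ ∀ i ∈ I.carrier, ∀ j ∈ I.carrier, ∃ k ∈ I.carrier, I.Le i k ∧ I.Le j k

/-- The sequence `⟨P_i : i ∈ I⟩` as a set, i.e. the function `i ↦ P_i`. -/
def seqSet (I : PosetData.{u}) (P : {i // i ∈ I.carrier} → PosetData.{u}) : ZFSet.{u} :=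
  ZFSet.range fun i => ZFSet.pair i.1 (P i).toSet

/-- `⟨P_i : i ∈ I⟩` is a directed system of posets. -/
structure IsDirectedSystem (I : PosetData.{u}) (P : {i // i ∈ I.carrier} → PosetData.{u}) :
    Prop where
  poset : ∀ i, (P i).IsPoset
  complete : ∀ i j, I.Le i.1 j.1 → CompleteSuborder (P i) (P j)

/-- The direct limit `⋃_i P_i`, ordered by the union of the orders. -/
def dirLim (I : PosetData.{u}) (P : {i // i ∈ I.carrier} → PosetData.{u}) : PosetData.{u} where
  carrier := ZFSet.iUnion fun i => (P i).carrier
  rel := ZFSet.iUnion fun i => (P i).rel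

end PosetData

/-! ## Names and the forcing relation -/

theorem rank_fst_lt {x σ p : ZFSet.{u}} (h : ZFSet.pair σ p ∈ x) : σ.rank < x.rank := by
  have h1 : σ.rank < ({σ} : ZFSet.{u}).rank := ZFSet.rank_lt_of_mem (ZFSet.mem_singleton.2 rfl)
  have h2 : ({σ} : ZFSet.{u}).rank < (ZFSet.pair σ p).rank :=
    ZFSet.rank_lt_of_mem (by simp [ZFSet.pair])
  exact h1.trans (h2.trans (ZFSet.rank_lt_of_mem h))

/-- `P`-names: sets whose elements are pairs `⟨σ, p⟩` with `σ` a `P`-name and `p ∈ P`. -/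
inductive IsName (P : PosetData.{u}) : ZFSet.{u} → Prop
  | mk (τ : ZFSet.{u})
      (pairs : ∀ x ∈ τ, ∃ σ p, x = ZFSet.pair σ p ∧ p ∈ P.carrier)
      (names : ∀ σ p, ZFSet.pair σ p ∈ τ → IsName P σ) : IsName P τ

/-- The canonical `P`-name `x̌ = {⟨y̌, p⟩ : y ∈ x, p ∈ P}` of the set `x`. -/
def check (P : PosetData.{u}) (x : ZFSet.{u}) : ZFSet.{u} :=
  ZFSet.range fun z : {y // y ∈ x} × {p // p ∈ P.carrier} => ZFSet.pair (check P z.1.1) z.2.1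
termination_by x.rank
decreasing_by exact ZFSet.rank_lt_of_mem z.1.2

/-- `p ⊩ σ = τ` for names `σ`, `τ`, by recursion on `σ`: below `p`, every `θ` which enters `σ`
is forced to be in `τ`, and every `ρ` which enters `τ` is forced to be in `σ`. -/
def ForcesEq (P : PosetData.{u}) (σ τ p : ZFSet.{u}) : Prop :=
  (∀ x : {x : ZFSet.{u} × ZFSet.{u} // ZFSet.pair x.1 x.2 ∈ σ},
    ∀ q, P.Le q p → P.Le q x.1.2 →
      ∃ r, P.Le r q ∧ ∃ ρ t, ZFSet.pair ρ t ∈ τ ∧ P.Le r t ∧ ForcesEq P x.1.1 ρ r) ∧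
  (∀ ρ t, ZFSet.pair ρ t ∈ τ → ∀ q, P.Le q p → P.Le q t →
      ∃ r, P.Le r q ∧ ∃ x : {x : ZFSet.{u} × ZFSet.{u} // ZFSet.pair x.1 x.2 ∈ σ},
        P.Le r x.1.2 ∧ ForcesEq P x.1.1 ρ r)
termination_by σ.rank
decreasing_by all_goals exact rank_fst_lt x.2

/-- `p ⊩ σ ∈ τ` for names `σ`, `τ`. -/
def ForcesMem (P : PosetData.{u}) (σ τ p : ZFSet.{u}) : Prop :=
  ∀ q, P.Le q p → ∃ r, P.Le r q ∧ ∃ ρ t, ZFSet.pair ρ t ∈ τ ∧ P.Le r t ∧ ForcesEq P σ ρ r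

/-- The value of a term (necessarily a variable) under an assignment. -/
def termVal {n : ℕ} (xs : Fin n → ZFSet.{u}) : setLang.Term (Empty ⊕ Fin n) → ZFSet.{u}
  | .var (.inl e) => e.elim
  | .var (.inr i) => xs i
  | .func f _ => Empty.elim f

/-- `Forces N P φ τ⃗ p`: the condition `p` forces `φ(τ⃗)` with respect to the poset `P` and the
model `N`.  Quantifiers range over the `P`-names in `N`. (Primitive connectives: `⊥`, `→`, `∀`.) -/
def Forces (N : Set ZFSet.{u}) (P : PosetData.{u}) :
    {n : ℕ} → setLang.BoundedFormula Empty n → (Fin n → ZFSet.{u}) → ZFSet.{u} → Prop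
  | _, .falsum, _, _ => False
  | _, .equal s t, xs, p => ForcesEq P (termVal xs s) (termVal xs t) p
  | _, .rel SetRel.mem ts, xs, p => ForcesMem P (termVal xs (ts 0)) (termVal xs (ts 1)) p
  | _, .imp φ ψ, xs, p => ∀ q, P.Le q p → Forces N P φ xs q → Forces N P ψ xs q
  | _, .all φ, xs, p => ∀ τ ∈ N, IsName P τ → Forces N P φ (Fin.snoc xs τ) p

/-- `⊩_{P,N} φ(τ⃗)`: every condition forces it. -/
def ForcedBy (N : Set ZFSet.{u}) (P : PosetData.{u}) {n : ℕ}
    (φ : setLang.BoundedFormula Empty n) (xs : Fin n → ZFSet.{u}) : Prop :=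
  ∀ p ∈ P.carrier, Forces N P φ xs p

/-! ### Some formulas of set theory

The variables of a formula `φ : BoundedFormula Empty n` are numbered by `Fin n`; a quantifier binds
the variable with the next number. -/

/-- `xᵢ ∈ xⱼ` -/
def memF {n : ℕ} (i j : Fin n) : setLang.BoundedFormula Empty n :=
  .rel (l := 2) SetRel.mem ![.var (.inr i), .var (.inr j)]

/-- `xᵢ = xⱼ` -/
def eqF {n : ℕ} (i j : Fin n) : setLang.BoundedFormula Empty n :=
  .equal (.var (.inr i)) (.var (.inr j))

/-- `∀ xₙ ∈ xᵢ, φ` -/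
def allIn {n : ℕ} (i : Fin n) (φ : setLang.BoundedFormula Empty (n + 1)) :
    setLang.BoundedFormula Empty n :=
  ((memF (Fin.last n) i.castSucc).imp φ).all

/-- `∃ xₙ ∈ xᵢ, φ` -/
def exIn {n : ℕ} (i : Fin n) (φ : setLang.BoundedFormula Empty (n + 1)) :
    setLang.BoundedFormula Empty n :=
  (memF (Fin.last n) i.castSucc ⊓ φ).ex

/-- `xᵢ ⊆ xⱼ` -/
def subsetF {n : ℕ} (i j : Fin n) : setLang.BoundedFormula Empty n :=
  allIn i (memF (Fin.last n) j.castSucc)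

/-- `xₖ = {xᵢ, xⱼ}` -/
def upairF {n : ℕ} (k i j : Fin n) : setLang.BoundedFormula Empty n :=
  ((memF (Fin.last n) k.castSucc).iff
    (eqF (Fin.last n) i.castSucc ⊔ eqF (Fin.last n) j.castSucc)).all

/-- `xₖ = ⟨xᵢ, xⱼ⟩` (Kuratowski pair) -/
def pairF {n : ℕ} (k i j : Fin n) : setLang.BoundedFormula Empty n :=
  ((memF (Fin.last n) k.castSucc).iff
    (upairF (Fin.last n) i.castSucc i.castSucc ⊔ upairF (Fin.last n) i.castSucc j.castSucc)).all

/-- "`x₀` is a function from `x₁` to `x₁`"; used with `x₁ = ω`. -/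
def isRealF : setLang.BoundedFormula Empty 2 :=
  -- every element of `x₀` is a pair of elements of `x₁`
  (allIn 0 (exIn 1 (exIn 1 (pairF 2 3 4)))) ⊓
  -- every element of `x₁` has a value
  ((allIn 1 (exIn 1 (exIn 0 (pairF 4 2 3)))) ⊓
  -- values are unique
  (allIn 1 (allIn 1 (allIn 1 (allIn 0 (allIn 0
    ((pairF 5 2 3).imp ((pairF 6 2 4).imp (eqF 3 4)))))))))

/-- "For all `n ∈ x₃` there are `⟨n, ⟨s, t⟩⟩ ∈ x₂` with `s ⊆ x₀` and `t ⊆ x₁`".  If `x₃ = ω` and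
`x₂` codes `⟨⊏ₙ⟩`, this says that `x₀ ⊏ₙ x₁` holds for no `n`, that is, `x₀ ⊏̸ x₁`. -/
def notDominatedF : setLang.BoundedFormula Empty 4 :=
  allIn 3 (exIn 2 (((pairF 5 4 6) ⊓ ((pairF 6 7 8) ⊓ ((subsetF 7 0) ⊓ (subsetF 8 1)))).ex.ex.ex))

/-! ## Reals and the relation `⊏` -/

/-- The finite von Neumann ordinal `n`. -/
def natSet : ℕ → ZFSet.{u}
  | 0 => ∅
  | n + 1 => insert (natSet n) (natSet n)

/-- The real `f ∈ ω^ω` as a set of ordered pairs. -/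
def realSet (f : ℕ → ℕ) : ZFSet.{u} :=
  ZFSet.range fun n : ℕ => ZFSet.pair (natSet n) (natSet (f n))

/-- The finite sequence `s ∈ ω^{<ω}` as a set of ordered pairs. -/
def finSeqSet (s : List ℕ) : ZFSet.{u} :=
  ZFSet.range fun i : Fin s.length => ZFSet.pair (natSet i) (natSet (s.get i))

/-- `⟨⊏ₙ⟩` is an increasing sequence of closed relations on `ω^ω` such that each
`{f : f ⊏ₙ g}` is nowhere dense.  Here `f ⊏ₙ g` is `(f, g) ∈ R n`, and `f ⊏ g` means
`∃ n, f ⊏ₙ g`. -/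
structure IsRelSequence (R : ℕ → Set ((ℕ → ℕ) × (ℕ → ℕ))) : Prop where
  closed : ∀ n, IsClosed (R n)
  increasing : Monotone R
  nowhereDense : ∀ n g, IsNowhereDense {f | (f, g) ∈ R n}

/-- `U ⊆ ω × (ω^{<ω} × ω^{<ω})` is a (Borel) code of the sequence `R` of closed relations: the
complement of `R n` is the union of the basic open boxes `[s] × [t]` with `⟨n, ⟨s, t⟩⟩ ∈ U`. -/
def IsCode (U : ZFSet.{u}) (R : ℕ → Set ((ℕ → ℕ) × (ℕ → ℕ))) : Prop :=
  (∀ x ∈ U, ∃ (n : ℕ) (s t : List ℕ),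
    x = ZFSet.pair (natSet n) (ZFSet.pair (finSeqSet s) (finSeqSet t))) ∧
  ∀ n f g, (f, g) ∉ R n ↔ ∃ s t : List ℕ,
    ZFSet.pair (natSet n) (ZFSet.pair (finSeqSet s) (finSeqSet t)) ∈ U ∧
      finSeqSet.{u} s ⊆ realSet f ∧ finSeqSet.{u} t ⊆ realSet g

/-- `c` is `⊏`-unbounded over `M`: no real `g ∈ M` satisfies `c ⊏ g`. -/
def UnboundedOver (M : Set ZFSet.{u}) (R : ℕ → Set ((ℕ → ℕ) × (ℕ → ℕ))) (c : ℕ → ℕ) : Prop :=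
  ∀ g : ℕ → ℕ, realSet.{u} g ∈ M → ¬ ∃ n, (c, g) ∈ R n

/-- `h ∈ M` is a `P`-name for a real, with respect to `M`. -/
def IsRealName (M : Set ZFSet.{u}) (P : PosetData.{u}) (h : ZFSet.{u}) : Prop :=
  h ∈ M ∧ IsName P h ∧ ForcedBy M P isRealF ![h, check P ZFSet.omega]

/-- The property `(⋆, P, Q, M, N, ⊏, c)`, where `U ∈ M` is a code of `⊏`: `P ∈ M` and `Q ∈ N` are
posets, `P ⋖_M Q`, and `⊩_{Q,N} c ⊏̸ h` for every `P`-name `h ∈ M` for a real. -/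
structure StarProperty (M N : Set ZFSet.{u}) (U : ZFSet.{u}) (c : ℕ → ℕ) (P Q : PosetData.{u}) :
    Prop where
  poset_left : P.IsPoset
  poset_right : Q.IsPoset
  mem_left : P.toSet ∈ M
  mem_right : Q.toSet ∈ N
  complete : PosetData.CompleteSuborderOver M P Q
  unbounded : ∀ h, IsRealName M P h →
    ForcedBy N Q notDominatedF ![check Q (realSet c), h, check Q U, check Q ZFSet.omega]

end ForcingLimit

end

open ForcingLimit

open FirstOrder FirstOrder.Language

noncomputable section

namespace ForcingLimit

open PosetData

/-! Write `P`, `Q` for the two limits. Since the complement of each `⊏ₙ` is a union of boxes listed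
in `U`, forcing `c ⊏̸ h` means: for each `n`, densely many conditions force a finite sequence `t` to
be contained in `h`, where `⟨n, ⟨s, t⟩⟩ ∈ U` and `s ⊆ c` (`forcedBy_notDominatedF_iff`). Only
finitely many values of `h` are involved each time.

Let `q ∈ Q_i`, and let `h ∈ M` be a `P`-name for a real. In the extension of `M` by `P_i`, consider
the tree of finite sequences which some condition of the quotient `P/G_i` forces to be contained in
`h`. Its leftmost branch has a `P_i`-name `g ∈ M` (`leastBranchName`), and the hypothesis at stage
`i`, applied to `g`, gives `r ≤ q` in `Q_i` and a box `⟨s, t⟩` such that `r` forces `t ⊆ g`. A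
condition `b ∈ P_i` compatible with `r` is a reduction of some `p ∈ P` which decides `h` along the
leftmost branch up to the length of `t`; hence `p` forces `t ⊆ h`. If reductions for `P_i, P` are
reductions for `Q_i, Q`, then `p` is compatible in `Q` with any common extension of `b` and `r`, and
below both `t ⊆ h` is forced (`exists_le_forces_initial_segment`).

Reductions do lift: a condition of `P` already lies in some `P_j` with `j ≥ i`, and correctness of
the square for `i, j` applies (`isReduction_dirLim`). The same fact yields `P ⋖_M Q`
(`completeSuborderOver_dirLim`): if `A ∈ M` is a maximal antichain of `P`, the reductions in `P_i`
of conditions below members of `A` are dense in `P_i`, so each `q ∈ Q_i` is compatible with one of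
them, and therefore with a member of `A`.

Since `⋖_M` concerns only antichains in `M`, every dense set above must be shown definable over `M`.
The classes `Df` and `Tm` reduce this to instance search; recursion in `M` (`Tm.recursion`) makes
atomic forcing definable, and Zermelo's argument in `M` (`exists_tower_model`) turns a definable
dense set into a maximal antichain in `M` (`predense_of_dense`). -/

/-! ## Predicates and functions definable over a transitive model -/

/-- `S` is definable with parameters over `(M, ∈)`. -/
class Df (M : Set ZFSet.{u}) {n : ℕ} (S : (Fin n → ZFSet.{u}) → Prop) : Prop where
  out : ∃ φ : setLang.Formula (Fin n ⊕ M), ∀ v : Fin n → M,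
    S (fun i => (v i).1) ↔ φ.Realize (Sum.elim v id)

/-- `t` maps tuples from `M` to `M`, and its graph is definable over `(M, ∈)`. -/
class Tm (M : Set ZFSet.{u}) {n : ℕ} (t : (Fin n → ZFSet.{u}) → ZFSet.{u}) : Prop where
  mem : ∀ v, (∀ i, v i ∈ M) → t v ∈ M
  graph : Df M fun w : Fin (n + 1) → ZFSet.{u} => w 0 = t fun i => w i.succ

section Basic

variable {M : Set ZFSet.{u}} {n : ℕ}

theorem Df.congr {S T : (Fin n → ZFSet.{u}) → Prop} (h : Df M S)
    (hST : ∀ v, (∀ i, v i ∈ M) → (S v ↔ T v)) : Df M T := by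
  obtain ⟨φ, hφ⟩ := h
  exact ⟨φ, fun v => (hST _ fun i => (v i).2).symm.trans (hφ v)⟩

instance Df.false : Df M fun _ : Fin n → ZFSet.{u} => False :=
  ⟨⊥, fun v => by simp⟩

instance Df.true : Df M fun _ : Fin n → ZFSet.{u} => True :=
  ⟨⊤, fun v => by simp⟩

instance Df.imp {S T : (Fin n → ZFSet.{u}) → Prop} [hS : Df M S] [hT : Df M T] :
    Df M fun v => S v → T v := by
  obtain ⟨φ, hφ⟩ := hS
  obtain ⟨ψ, hψ⟩ := hT
  exact ⟨φ.imp ψ, fun v => by simp [hφ, hψ]⟩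

instance Df.not {S : (Fin n → ZFSet.{u}) → Prop} [hS : Df M S] : Df M fun v => ¬ S v :=
  Df.imp (T := fun _ => False)

instance Df.and {S T : (Fin n → ZFSet.{u}) → Prop} [hS : Df M S] [hT : Df M T] :
    Df M fun v => S v ∧ T v := by
  obtain ⟨φ, hφ⟩ := hS
  obtain ⟨ψ, hψ⟩ := hT
  exact ⟨φ ⊓ ψ, fun v => by simp [hφ, hψ]⟩

instance Df.or {S T : (Fin n → ZFSet.{u}) → Prop} [hS : Df M S] [hT : Df M T] :
    Df M fun v => S v ∨ T v := by
  obtain ⟨φ, hφ⟩ := hS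
  obtain ⟨ψ, hψ⟩ := hT
  exact ⟨φ ⊔ ψ, fun v => by simp [hφ, hψ]⟩

instance Df.iff {S T : (Fin n → ZFSet.{u}) → Prop} [hS : Df M S] [hT : Df M T] :
    Df M fun v => S v ↔ T v := by
  obtain ⟨φ, hφ⟩ := hS
  obtain ⟨ψ, hψ⟩ := hT
  exact ⟨φ.iff ψ, fun v => by simp [hφ, hψ]⟩

theorem Df.mem_aux (a b : Fin n ⊕ M) : Df M fun v : Fin n → ZFSet.{u} =>
    Sum.elim v Subtype.val a ∈ Sum.elim v Subtype.val b := by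
  refine ⟨.rel (l := 2) (n := 0) SetRel.mem ![.var (.inl a), .var (.inl b)], fun v => ?_⟩
  have : ∀ c : Fin n ⊕ M, Sum.elim (fun i => (v i).1) Subtype.val c = (Sum.elim v id c).1 := by
    rintro (c | c) <;> rfl
  rw [this, this]
  rfl

theorem Df.eq_aux (a b : Fin n ⊕ M) : Df M fun v : Fin n → ZFSet.{u} =>
    Sum.elim v Subtype.val a = Sum.elim v Subtype.val b := by
  refine ⟨.equal (n := 0) (.var (.inl a)) (.var (.inl b)), fun v => ?_⟩
  have : ∀ c : Fin n ⊕ M, Sum.elim (fun i => (v i).1) Subtype.val c = (Sum.elim v id c).1 := by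
    rintro (c | c) <;> rfl
  rw [this, this, ← Subtype.ext_iff]
  rfl

instance Df.all {S : ZFSet.{u} → (Fin n → ZFSet.{u}) → Prop}
    [hS : Df M fun w : Fin (n + 1) → ZFSet.{u} => S (w 0) fun i => w i.succ] :
    Df M fun v => ∀ x, x ∈ M → S x v := by
  obtain ⟨φ, hφ⟩ := hS
  -- Variable `0` becomes the bound variable, the others shift down, and parameters remain
  -- parameters.
  let g : Fin (n + 1) ⊕ M → (Fin n ⊕ M) ⊕ Fin 1 :=
    Sum.elim (Fin.cases (.inr 0) fun i => .inl (.inl i)) fun m => .inl (.inr m)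
  refine ⟨.all (BoundedFormula.relabel (n := 1) (k := 0) g φ), fun v => ?_⟩
  unfold Language.Formula.Realize
  rw [BoundedFormula.realize_all, Subtype.forall]
  refine forall₂_congr fun x hx => ?_
  have := hφ (Fin.cons ⟨x, hx⟩ v)
  simp only [Fin.cons_zero, Fin.cons_succ] at this
  rw [this, BoundedFormula.realize_relabel, Language.Formula.Realize]
  have e : (Sum.elim (Fin.cons ⟨x, hx⟩ v) id : Fin (n + 1) ⊕ M → M) =
      Sum.elim (Sum.elim v id) (Fin.snoc default ⟨x, hx⟩ ∘ Fin.castAdd 0) ∘ g := by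
    ext i
    rcases i with i | i
    · refine Fin.cases ?_ (fun i => ?_) i
      · rfl
      · rfl
    · rfl
  rw [e]
  exact iff_of_eq (congrArg _ (Subsingleton.elim _ _))

instance Df.ex {S : ZFSet.{u} → (Fin n → ZFSet.{u}) → Prop}
    [hS : Df M fun w : Fin (n + 1) → ZFSet.{u} => S (w 0) fun i => w i.succ] :
    Df M fun v => ∃ x, x ∈ M ∧ S x v :=
  Df.congr (S := fun v => ¬ ∀ x, x ∈ M → ¬ S x v) inferInstance fun v _ => by simp

theorem Df.substVar {m : ℕ} {S : (Fin n → ZFSet.{u}) → Prop} (hS : Df M S) (e : Fin n → Fin m) :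
    Df M fun v : Fin m → ZFSet.{u} => S fun i => v (e i) := by
  obtain ⟨φ, hφ⟩ := hS
  refine ⟨Formula.relabel (Sum.map e id) φ, fun v => ?_⟩
  rw [hφ fun i => v (e i), Formula.realize_relabel]
  refine iff_of_eq (congrArg _ ?_)
  ext i
  rcases i with i | i <;> rfl

/-- Substituting a term costs one quantifier over its definable graph; closure of `M` under the term
provides the witness. -/
theorem Df.bind {t : (Fin n → ZFSet.{u}) → ZFSet.{u}} {S : ZFSet.{u} → (Fin n → ZFSet.{u}) → Prop}
    (ht : Tm M t) (hS : Df M fun w : Fin (n + 1) → ZFSet.{u} => S (w 0) fun i => w i.succ) :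
    Df M fun v => S (t v) v := by
  have := ht.graph
  refine Df.congr (S := fun v => ∃ x, x ∈ M ∧ (x = t v ∧ S x v)) inferInstance fun v hv => ?_
  constructor
  · rintro ⟨x, -, rfl, h⟩; exact h
  · exact fun h => ⟨_, ht.mem v hv, rfl, h⟩

instance Tm.var (i : Fin n) : Tm M fun v : Fin n → ZFSet.{u} => v i :=
  ⟨fun _ hv => hv i, Df.eq_aux (.inl 0) (.inl i.succ)⟩

instance Tm.const (a : ZFSet.{u}) [h : Fact (a ∈ M)] : Tm M fun _ : Fin n → ZFSet.{u} => a :=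
  ⟨fun _ _ => h.1, Df.eq_aux (.inl 0) (.inr ⟨a, h.1⟩)⟩

instance Df.mem {t s : (Fin n → ZFSet.{u}) → ZFSet.{u}} [ht : Tm M t] [hs : Tm M s] :
    Df M fun v => t v ∈ s v := by
  refine Df.bind (S := fun x v => x ∈ s v) ht (Df.bind (S := fun y w => w 0 ∈ y) ?_ ?_)
  · exact ⟨fun v hv => hs.mem _ fun i => hv _,
      Df.substVar hs.graph (Fin.cases 0 fun i => i.succ.succ)⟩
  · exact Df.mem_aux (.inl 1) (.inl 0)

theorem Tm.lift {t : (Fin n → ZFSet.{u}) → ZFSet.{u}} (ht : Tm M t) :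
    Tm M fun w : Fin (n + 1) → ZFSet.{u} => t fun i => w i.succ :=
  ⟨fun _ hv => ht.mem _ fun _ => hv _, Df.substVar ht.graph (Fin.cases 0 fun i => i.succ.succ)⟩

instance Df.eq {t s : (Fin n → ZFSet.{u}) → ZFSet.{u}} [ht : Tm M t] [hs : Tm M s] :
    Df M fun v => t v = s v :=
  Df.bind (S := fun x v => x = s v) ht hs.graph

theorem Tm.substVar {m : ℕ} {t : (Fin n → ZFSet.{u}) → ZFSet.{u}} (ht : Tm M t)
    (e : Fin n → Fin m) : Tm M fun v : Fin m → ZFSet.{u} => t fun i => v (e i) :=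
  ⟨fun _ hv => ht.mem _ fun _ => hv _,
    Df.substVar ht.graph (Fin.cases 0 fun i => (e i).succ)⟩

end Basic

section Model

variable {M : Set ZFSet.{u}} [hM : Fact (IsTransitiveModelZFC M)] {n : ℕ}

theorem mem_model {M : Set ZFSet.{u}} [hM : Fact (IsTransitiveModelZFC M)] {x y : ZFSet.{u}}
    (hy : y ∈ M) (hx : x ∈ y) : x ∈ M :=
  hM.out.transitive y hy x hx

/-- By transitivity of `M`, bounded quantifiers have the same range in `M` and in the universe. -/
instance Df.ball {t : (Fin n → ZFSet.{u}) → ZFSet.{u}} {S : ZFSet.{u} → (Fin n → ZFSet.{u}) → Prop}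
    [ht : Tm M t] [hS : Df M fun w : Fin (n + 1) → ZFSet.{u} => S (w 0) fun i => w i.succ] :
    Df M fun v => ∀ x, x ∈ t v → S x v := by
  have := ht.lift
  exact Df.congr (S := fun v => ∀ x, x ∈ M → x ∈ t v → S x v) inferInstance fun v hv =>
    ⟨fun h x hx => h x (mem_model (ht.mem v hv) hx) hx, fun h x _ => h x⟩

instance Df.bex {t : (Fin n → ZFSet.{u}) → ZFSet.{u}} {S : ZFSet.{u} → (Fin n → ZFSet.{u}) → Prop}
    [ht : Tm M t] [hS : Df M fun w : Fin (n + 1) → ZFSet.{u} => S (w 0) fun i => w i.succ] :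
    Df M fun v => ∃ x, x ∈ t v ∧ S x v :=
  Df.congr (S := fun v => ¬ ∀ x, x ∈ t v → ¬ S x v) inferInstance fun v _ => by simp

instance Df.nonempty {t : (Fin n → ZFSet.{u}) → ZFSet.{u}} [ht : Tm M t] :
    Df M fun v => ∃ x, x ∈ t v :=
  Df.congr (S := fun v => ∃ x, x ∈ t v ∧ True) Df.bex fun v _ => by simp

instance Df.subset {t s : (Fin n → ZFSet.{u}) → ZFSet.{u}} [ht : Tm M t] [hs : Tm M s] :
    Df M fun v => t v ⊆ s v := by
  have := hs.lift
  exact Df.congr (S := fun v => ∀ x, x ∈ t v → x ∈ s v) inferInstance fun v _ => Iff.rfl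

end Model

/-! ## Closure of transitive models under set operations -/

/-- A formula mentions only finitely many parameters; the schemata of separation and replacement
accept finite tuples only. -/
theorem exists_finite_params {M : Set ZFSet.{u}} {n : ℕ} (φ : setLang.Formula (Fin n ⊕ M)) :
    ∃ (k : ℕ) (w : Fin k → M) (ψ : setLang.Formula (Fin n ⊕ Fin k)),
      ∀ v : Fin n → M, φ.Realize (Sum.elim v id) ↔ ψ.Realize (Sum.elim v w) := by
  classical
  let s : Finset M := (φ.freeVarFinset.image Sum.getRight?).eraseNone
  refine ⟨s.card, fun i => (s.equivFin.symm i).1,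
    BoundedFormula.restrictFreeVar φ fun x => match x with
      | ⟨.inl i, _⟩ => .inl i
      | ⟨.inr m, h⟩ => .inr (s.equivFin ⟨m, by
          simp only [s, Finset.mem_eraseNone, Finset.mem_image]
          exact ⟨_, h, rfl⟩⟩), fun v => ?_⟩
  unfold Formula.Realize
  refine (BoundedFormula.realize_restrictFreeVar _ ?_).symm
  rintro ⟨i | i, h⟩
  · rfl
  · simp

/-- The image of the set `a` under `f`. -/
def img (f : ZFSet.{u} → ZFSet.{u}) (a : ZFSet.{u}) : ZFSet.{u} :=
  ZFSet.range fun x : {x // x ∈ a} => f x.1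

@[simp]
theorem mem_img {f : ZFSet.{u} → ZFSet.{u}} {a y : ZFSet.{u}} :
    y ∈ img f a ↔ ∃ x ∈ a, f x = y := by
  simp [img]

theorem Df.param {M : Set ZFSet.{u}} {n m : ℕ} {S : (Fin (n + m) → ZFSet.{u}) → Prop} (hS : Df M S)
    {v : Fin n → ZFSet.{u}} (hv : ∀ i, v i ∈ M) :
    Df M fun w : Fin m → ZFSet.{u} => S (Fin.append v w) := by
  obtain ⟨φ, hφ⟩ := hS
  refine ⟨φ.relabel (Sum.elim (Fin.addCases (fun i => .inr ⟨v i, hv i⟩) .inl) .inr), fun w => ?_⟩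
  rw [Formula.realize_relabel]
  have : Fin.append v (fun i => (w i).1) =
      fun i => ((Fin.append (fun i => ⟨v i, hv i⟩) w : Fin (n + m) → M) i).1 := by
    ext i : 1
    refine Fin.addCases (fun i => ?_) (fun i => ?_) i <;> simp
  rw [this, hφ]
  refine iff_of_eq (congrArg _ ?_)
  ext i : 1
  rcases i with i | i
  · refine Fin.addCases (fun i => ?_) (fun i => ?_) i <;> simp
  · rfl

theorem Tm.mem₀ {M : Set ZFSet.{u}} {a : ZFSet.{u}} (h : Tm M fun _ : Fin 0 → ZFSet.{u} => a) : a ∈ M :=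
  h.mem ![] fun i => i.elim0

section Model

variable {M : Set ZFSet.{u}} [hM : Fact (IsTransitiveModelZFC M)] {n : ℕ}

/-- The set provided by separation in `M` is the true one, because neither set has members outside
the transitive class `M`. -/
theorem sep_mem_model {S : (Fin 1 → ZFSet.{u}) → Prop} (hS : Df M S) {a : ZFSet.{u}} (ha : a ∈ M) :
    ZFSet.sep (fun x => S fun _ => x) a ∈ M := by
  obtain ⟨φ, hφ⟩ := hS
  obtain ⟨k, w, ψ, hψ⟩ := exists_finite_params φ
  obtain ⟨b, hb⟩ := hM.out.separation k
    (BoundedFormula.relabel (n := k + 1) (k := 0) (fun x : Fin 1 ⊕ Fin k =>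
      (Sum.inr (Sum.elim (fun _ => 0) Fin.succ x) : Empty ⊕ Fin (k + 1))) ψ) w ⟨a, ha⟩
  convert b.2
  ext x
  rw [ZFSet.mem_sep]
  by_cases hx : x ∈ M
  · rw [hb ⟨x, hx⟩, BoundedFormula.realize_relabel]
    refine and_congr_right fun _ => ?_
    rw [hφ fun _ => ⟨x, hx⟩, hψ, Formula.Realize]
    have e : (Sum.elim (fun _ => ⟨x, hx⟩) w : Fin 1 ⊕ Fin k → M) =
        Sum.elim Empty.elim ((Fin.cons ⟨x, hx⟩ w : Fin (k + 1) → M) ∘ Fin.castAdd 0) ∘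
          (fun x : Fin 1 ⊕ Fin k =>
            (Sum.inr (Sum.elim (fun _ => 0) Fin.succ x) : Empty ⊕ Fin (k + 1))) := by
      ext i
      rcases i with i | i <;> rfl
    rw [e]
    exact iff_of_eq (congrArg _ (Subsingleton.elim _ _))
  · exact iff_of_false (fun h => hx (mem_model ha h.1)) fun h => hx (mem_model b.2 h)

theorem replacement_model {S : (Fin 2 → ZFSet.{u}) → Prop} (hS : Df M S) {a : ZFSet.{u}}
    (ha : a ∈ M) (hfun : ∀ x ∈ a, ∀ y ∈ M, ∀ y' ∈ M, S ![x, y] → S ![x, y'] → y = y') :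
    ∃ b ∈ M, ∀ y, y ∈ b ↔ y ∈ M ∧ ∃ x ∈ a, S ![x, y] := by
  obtain ⟨φ, hφ⟩ := hS
  obtain ⟨k, w, ψ, hψ⟩ := exists_finite_params φ
  let θ := BoundedFormula.relabel (n := k + 2) (k := 0) (fun x : Fin 2 ⊕ Fin k =>
      (Sum.inr (Sum.elim ![0, 1] (fun i => i.succ.succ) x) : Empty ⊕ Fin (k + 2))) ψ
  have hθ : ∀ x y : M, θ.Realize Empty.elim (Fin.cons x (Fin.cons y w)) ↔ S ![x, y] := by
    intro x y
    have e0 : (![x.1, y.1] : Fin 2 → ZFSet.{u}) = fun i => ((![x, y] : Fin 2 → M) i).1 := by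
      ext i : 1
      refine Fin.cases rfl (fun i => ?_) i
      exact Fin.cases rfl (fun i => i.elim0) i
    have e : (Sum.elim ![x, y] w : Fin 2 ⊕ Fin k → M) =
        Sum.elim Empty.elim ((Fin.cons x (Fin.cons y w) : Fin (k + 2) → M) ∘ Fin.castAdd 0) ∘
          (fun x : Fin 2 ⊕ Fin k =>
            (Sum.inr (Sum.elim ![0, 1] (fun i => i.succ.succ) x) : Empty ⊕ Fin (k + 2))) := by
      ext i : 1
      rcases i with i | i
      · refine Fin.cases rfl (fun i => ?_) i
        exact Fin.cases rfl (fun i => i.elim0) i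
      · rfl
    rw [e0, hφ, hψ, Formula.Realize, BoundedFormula.realize_relabel, e]
    exact iff_of_eq (congrArg _ (Subsingleton.elim _ _))
  obtain ⟨b, hb⟩ := hM.out.replacement k θ w ⟨a, ha⟩ (by
    intro x y y' hx h h'
    rw [hθ] at h h'
    exact Subtype.ext (hfun x hx y y.2 y' y'.2 h h'))
  refine ⟨b, b.2, fun y => ?_⟩
  by_cases hy : y ∈ M
  · rw [hb ⟨y, hy⟩]
    simp only [hθ, Subtype.exists, hy, true_and]
    exact ⟨fun ⟨x, _, hx⟩ => ⟨x, hx⟩, fun ⟨x, hx⟩ => ⟨x, mem_model ha hx.1, hx⟩⟩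
  · exact iff_of_false (fun h => hy (mem_model b.2 h)) fun h => hy h.1

theorem replacement_model₂ (R : ZFSet.{u} → ZFSet.{u} → Prop)
    (hR : Df M fun v : Fin 2 → ZFSet.{u} => R (v 0) (v 1)) {a : ZFSet.{u}}
    (ha : a ∈ M) (hfun : ∀ x ∈ a, ∀ y ∈ M, ∀ y' ∈ M, R x y → R x y' → y = y') :
    ∃ b ∈ M, ∀ y, y ∈ b ↔ y ∈ M ∧ ∃ x ∈ a, R x y :=
  replacement_model hR ha hfun

theorem pair_mem_aux {x y : ZFSet.{u}} (hx : x ∈ M) (hy : y ∈ M) : ({x, y} : ZFSet.{u}) ∈ M := by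
  obtain ⟨z, hz⟩ := hM.out.pairing ⟨x, hx⟩ ⟨y, hy⟩
  convert z.2
  ext w
  rw [ZFSet.mem_pair]
  by_cases hw : w ∈ M
  · rw [hz ⟨w, hw⟩]; simp
  · exact iff_of_false (by rintro (rfl | rfl) <;> contradiction) fun h => hw (mem_model z.2 h)

theorem sUnion_mem_model {x : ZFSet.{u}} (hx : x ∈ M) : ZFSet.sUnion x ∈ M := by
  obtain ⟨z, hz⟩ := hM.out.union ⟨x, hx⟩
  convert z.2
  ext w
  rw [ZFSet.mem_sUnion]
  by_cases hw : w ∈ M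
  · rw [hz ⟨w, hw⟩]
    exact ⟨fun ⟨y, hy, h⟩ => ⟨⟨y, mem_model hx hy⟩, hy, h⟩, fun ⟨y, hy, h⟩ => ⟨y, hy, h⟩⟩
  · exact iff_of_false (fun ⟨y, hy, h⟩ => hw (mem_model (mem_model hx hy) h))
      fun h => hw (mem_model z.2 h)

/-- By extensionality, the graph of an operation is definable as soon as membership in its value is.
-/
theorem Tm.of_mem_iff {t : (Fin n → ZFSet.{u}) → ZFSet.{u}}
    {S : ZFSet.{u} → (Fin n → ZFSet.{u}) → Prop}
    (hS : Df M fun w : Fin (n + 1) → ZFSet.{u} => S (w 0) fun i => w i.succ)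
    (hmem : ∀ v, (∀ i, v i ∈ M) → t v ∈ M)
    (h : ∀ v, (∀ i, v i ∈ M) → ∀ x ∈ M, x ∈ t v ↔ S x v) : Tm M t := by
  refine ⟨hmem, ?_⟩
  have : Df M fun w : Fin (n + 1 + 1) → ZFSet.{u} => S (w 0) fun i => w i.succ.succ :=
    Df.substVar hS (Fin.cases 0 fun i => i.succ.succ)
  refine Df.congr (S := fun w : Fin (n + 1) → ZFSet.{u} =>
    ∀ x, x ∈ M → (x ∈ w 0 ↔ S x fun i => w i.succ)) inferInstance fun w hw => ?_
  have hw' := hmem (fun i => w i.succ) fun i => hw _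
  constructor
  · intro h'
    ext x
    by_cases hx : x ∈ M
    · rw [h' x hx, h _ (fun i => hw _) x hx]
    · exact iff_of_false (fun h => hx (mem_model (hw 0) h)) fun h => hx (mem_model hw' h)
  · intro e x hx
    rw [e, h _ (fun i => hw _) x hx]

instance Tm.upair {t s : (Fin n → ZFSet.{u}) → ZFSet.{u}} [ht : Tm M t] [hs : Tm M s] :
    Tm M fun v => ({t v, s v} : ZFSet.{u}) := by
  have := ht.lift
  have := hs.lift
  exact Tm.of_mem_iff (S := fun x v => x = t v ∨ x = s v) inferInstance
    (fun v hv => pair_mem_aux (ht.mem v hv) (hs.mem v hv)) fun v hv x _ => ZFSet.mem_pair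

instance Tm.singleton {t : (Fin n → ZFSet.{u}) → ZFSet.{u}} [ht : Tm M t] :
    Tm M fun v => ({t v} : ZFSet.{u}) := by
  simpa using (Tm.upair (t := t) (s := t) : Tm M _)

instance Tm.pair {t s : (Fin n → ZFSet.{u}) → ZFSet.{u}} [ht : Tm M t] [hs : Tm M s] :
    Tm M fun v => ZFSet.pair (t v) (s v) :=
  Tm.upair (t := fun v => {t v}) (s := fun v => {t v, s v})

instance Tm.sUnion {t : (Fin n → ZFSet.{u}) → ZFSet.{u}} [ht : Tm M t] :
    Tm M fun v => ZFSet.sUnion (t v) := by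
  have := ht.lift
  exact Tm.of_mem_iff (S := fun x v => ∃ y, y ∈ t v ∧ x ∈ y) inferInstance
    (fun v hv => sUnion_mem_model (ht.mem v hv)) fun v hv x _ => ZFSet.mem_sUnion

instance Tm.union {t s : (Fin n → ZFSet.{u}) → ZFSet.{u}} [ht : Tm M t] [hs : Tm M s] :
    Tm M fun v => t v ∪ s v :=
  Tm.sUnion (t := fun v => {t v, s v})

instance Tm.ins {t s : (Fin n → ZFSet.{u}) → ZFSet.{u}} [ht : Tm M t] [hs : Tm M s] :
    Tm M fun v => Insert.insert (t v) (s v) := by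
  have : Tm M fun v => {t v} ∪ s v := inferInstance
  simpa [ZFSet.insert_eq] using this

instance Tm.sep {t : (Fin n → ZFSet.{u}) → ZFSet.{u}} {S : ZFSet.{u} → (Fin n → ZFSet.{u}) → Prop}
    [ht : Tm M t] [hS : Df M fun w : Fin (n + 1) → ZFSet.{u} => S (w 0) fun i => w i.succ] :
    Tm M fun v => ZFSet.sep (fun x => S x v) (t v) := by
  have := ht.lift
  refine Tm.of_mem_iff (S := fun x v => x ∈ t v ∧ S x v) inferInstance (fun v hv => ?_)
    fun v hv x _ => ZFSet.mem_sep
  -- The separated variable is moved to the last place, so that `Df.param` can freeze all the others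
  -- as parameters.
  have h1 : Df M fun w : Fin (n + 1) → ZFSet.{u} => S (w (Fin.last n)) fun i => w i.castSucc :=
    Df.substVar hS (Fin.cases (Fin.last n) Fin.castSucc)
  have := sep_mem_model (Df.param h1 hv) (ht.mem v hv)
  convert this using 4 with x
  · exact (Fin.append_right v (fun _ => x) 0).symm
  · ext i : 1
    exact (Fin.append_left v _ i).symm

instance Tm.imgOn {t : (Fin n → ZFSet.{u}) → ZFSet.{u}} {s : ZFSet.{u} → (Fin n → ZFSet.{u}) → ZFSet.{u}}
    [ht : Tm M t] [hs : Tm M fun w : Fin (n + 1) → ZFSet.{u} => s (w 0) fun i => w i.succ] :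
    Tm M fun v => img (fun x => s x v) (t v) := by
  have h0 := ht.lift
  have h1 : Tm M fun w : Fin (n + 2) → ZFSet.{u} => s (w 0) fun i => w i.succ.succ :=
    Tm.substVar hs (Fin.cases 0 fun i => i.succ.succ)
  refine Tm.of_mem_iff (S := fun y v => ∃ x, x ∈ t v ∧ s x v = y) inferInstance (fun v hv => ?_)
    fun v hv x _ => mem_img
  have hsM : ∀ x ∈ M, s x v ∈ M := fun x hx => by
    have := hs.mem (Fin.cons x v) (Fin.cases hx hv)
    simpa using this
  have h2 : Df M fun w : Fin (n + 2) → ZFSet.{u} =>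
      s (w (Fin.last n).castSucc) (fun i => w i.castSucc.castSucc) = w (Fin.last (n + 1)) := by
    have : Tm M fun w : Fin (n + 2) → ZFSet.{u} =>
      s (w (Fin.last n).castSucc) (fun i => w i.castSucc.castSucc) :=
      Tm.substVar hs (Fin.cases (Fin.last n).castSucc fun i => i.castSucc.castSucc)
    infer_instance
  have e : ∀ x y, (s (Fin.append v ![x, y] (Fin.last n).castSucc)
      (fun i => Fin.append v ![x, y] i.castSucc.castSucc) = Fin.append v ![x, y] (Fin.last (n + 1)))
      ↔ s x v = y := by
    intro x y
    have e1 : Fin.append v ![x, y] (Fin.last n).castSucc = x := Fin.append_right v ![x, y] 0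
    have e2 : Fin.append v ![x, y] (Fin.last (n + 1)) = y := Fin.append_right v ![x, y] 1
    have e3 : (fun i => Fin.append v ![x, y] i.castSucc.castSucc) = v :=
      funext fun i => Fin.append_left v ![x, y] i
    rw [e1, e2, e3]
  obtain ⟨b, hbM, hb⟩ := replacement_model (Df.param (m := 2) h2 hv) (ht.mem v hv) (by
    intro x hx y _ y' _ h h'
    rw [e] at h h'
    exact h.symm.trans h')
  convert hbM
  ext y
  rw [mem_img, hb]
  simp only [e]
  refine ⟨fun ⟨x, hx, h⟩ => ⟨?_, x, hx, h⟩, fun h => h.2⟩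
  exact h ▸ hsM x (mem_model (ht.mem v hv) hx)

/-- This form is built from operations already known to be definable, with no appeal to power sets.
-/
theorem prod_eq_sUnion_img (a b : ZFSet.{u}) :
    ZFSet.prod a b = ZFSet.sUnion (img (fun x => img (fun y => ZFSet.pair x y) b) a) := by
  ext z
  simp only [ZFSet.mem_prod, ZFSet.mem_sUnion, mem_img]
  constructor
  · rintro ⟨x, hx, y, hy, rfl⟩
    exact ⟨_, ⟨x, hx, rfl⟩, by simpa using hy⟩
  · rintro ⟨_, ⟨x, hx, rfl⟩, h⟩
    obtain ⟨y, hy, rfl⟩ := mem_img.1 h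
    exact ⟨x, hx, y, hy, rfl⟩

instance Tm.prod {t s : (Fin n → ZFSet.{u}) → ZFSet.{u}} [ht : Tm M t] [hs : Tm M s] :
    Tm M fun v => ZFSet.prod (t v) (s v) := by
  have h1 : Tm M fun w : Fin (n + 2) → ZFSet.{u} => s fun i => w i.succ.succ := hs.lift.lift
  have h2 := hs.lift
  simp only [prod_eq_sUnion_img]
  infer_instance

instance Fact.sep {a : ZFSet.{u}} {S : ZFSet.{u} → Prop} [ha : Fact (a ∈ M)]
    [hS : Df M fun v : Fin 1 → ZFSet.{u} => S (v 0)] : Fact (ZFSet.sep S a ∈ M) :=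
  ⟨sep_mem_model hS ha.out⟩

end Model

/-! ## Transitive closures, `ω` and recursion inside a transitive model -/

/-- The transitive closure of `x`. -/
def tc (x : ZFSet.{u}) : ZFSet.{u} :=
  x ∪ ZFSet.sUnion (ZFSet.range fun y : {y // y ∈ x} => tc y.1)
termination_by x.rank
decreasing_by exact ZFSet.rank_lt_of_mem y.2

theorem mem_tc {x z : ZFSet.{u}} : z ∈ tc x ↔ z ∈ x ∨ ∃ y ∈ x, z ∈ tc y := by
  rw [tc]
  simp

theorem subset_tc (x : ZFSet.{u}) : x ⊆ tc x := fun _ h => mem_tc.2 (.inl h)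

theorem tc_transitive (x : ZFSet.{u}) : ∀ y ∈ tc x, ∀ z ∈ y, z ∈ tc x := by
  induction x using ZFSet.inductionOn with
  | h x ih =>
    intro y hy z hz
    rcases mem_tc.1 hy with h | ⟨w, hw, h⟩
    · exact mem_tc.2 (.inr ⟨y, h, subset_tc y hz⟩)
    · exact mem_tc.2 (.inr ⟨w, hw, ih w hw y h z hz⟩)

theorem tc_subset {x T : ZFSet.{u}} (hT : ∀ y ∈ T, ∀ z ∈ y, z ∈ T) (h : x ⊆ T) : tc x ⊆ T := by
  induction x using ZFSet.inductionOn with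
  | h x ih =>
    intro z hz
    rcases mem_tc.1 hz with h' | ⟨w, hw, h'⟩
    · exact h h'
    · exact ih w hw (fun y hy => hT w (h hw) y hy) h'

theorem tc_subset_of_mem {x y : ZFSet.{u}} (h : y ∈ tc x) : tc y ⊆ tc x :=
  tc_subset (tc_transitive x) (tc_transitive x y h)

/-- A condition-name pair buries its name two levels deep, so recursion on names needs a hypothesis
for the whole transitive closure and not only for members. -/
theorem tc_induction {p : ZFSet.{u} → Prop} (h : ∀ x, (∀ y ∈ tc x, p y) → p x) (x : ZFSet.{u}) :
    p x := by
  refine h x ?_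
  induction x using ZFSet.inductionOn with
  | h x ih =>
    intro y hy
    rcases mem_tc.1 hy with h' | ⟨w, hw, h'⟩
    · exact h y (ih y h')
    · exact ih w hw y h'

section Comp

variable {M : Set ZFSet.{u}} {n : ℕ}

theorem Tm.comp₁ {f : ZFSet.{u} → ZFSet.{u}} (hf : Tm M fun v : Fin 1 → ZFSet.{u} => f (v 0))
    {t : (Fin n → ZFSet.{u}) → ZFSet.{u}} (ht : Tm M t) : Tm M fun v => f (t v) := by
  refine ⟨fun v hv => hf.mem ![t v] fun i => ?_, ?_⟩
  · rw [Subsingleton.elim i 0]; exact ht.mem v hv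
  · refine Df.bind (S := fun x (w : Fin (n + 1) → ZFSet.{u}) => w 0 = f x) ht.lift ?_
    exact Df.substVar hf.graph ![1, 0]

theorem Tm.comp₂ {f : ZFSet.{u} → ZFSet.{u} → ZFSet.{u}}
    (hf : Tm M fun v : Fin 2 → ZFSet.{u} => f (v 0) (v 1))
    {t s : (Fin n → ZFSet.{u}) → ZFSet.{u}} (ht : Tm M t) (hs : Tm M s) :
    Tm M fun v => f (t v) (s v) := by
  refine ⟨fun v hv => hf.mem ![t v, s v] ?_, ?_⟩
  · exact Fin.cases (ht.mem v hv) fun i => Fin.cases (hs.mem v hv) (fun i => i.elim0) i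
  · refine Df.bind (S := fun x (w : Fin (n + 1) → ZFSet.{u}) => w 0 = f x (s fun i => w i.succ))
      ht.lift (Df.bind (S := fun x (w : Fin (n + 2) → ZFSet.{u}) => w 1 = f (w 0) x)
        hs.lift.lift ?_)
    exact Df.substVar hf.graph ![2, 1, 0]

theorem Df.comp₂ {S : ZFSet.{u} → ZFSet.{u} → Prop}
    (hS : Df M fun v : Fin 2 → ZFSet.{u} => S (v 0) (v 1))
    {t s : (Fin n → ZFSet.{u}) → ZFSet.{u}} (ht : Tm M t) (hs : Tm M s) :
    Df M fun v => S (t v) (s v) :=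
  Df.bind (S := fun x v => S x (s v)) ht
    (Df.bind (S := fun x (w : Fin (n + 1) → ZFSet.{u}) => S (w 0) x) hs.lift
      (Df.substVar hS ![1, 0]))

end Comp

section Model

variable {M : Set ZFSet.{u}} [hM : Fact (IsTransitiveModelZFC M)] {n : ℕ}

/-- Replacement collects the closures of the members of `x`. Each is identified inside `M` as the
least transitive superset; this is the true closure since, inductively, the true closure lies in
`M`. -/
theorem tc_mem_model {x : ZFSet.{u}} (hx : x ∈ M) : tc x ∈ M := by
  induction x using ZFSet.inductionOn with
  | h x ih =>
    have hS : Df M fun v : Fin 2 → ZFSet.{u} => (∀ y, y ∈ v 1 → ∀ z, z ∈ y → z ∈ v 1) ∧ v 0 ⊆ v 1 ∧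
        ∀ T, T ∈ M → (∀ y, y ∈ T → ∀ z, z ∈ y → z ∈ T) → v 0 ⊆ T → v 1 ⊆ T := inferInstance
    obtain ⟨b, hbM, hb⟩ := replacement_model hS hx (by
      rintro y hy t ht t' ht' ⟨h1, h2, h3⟩ ⟨h1', h2', h3'⟩
      ext z
      exact ⟨fun h => h3 t' ht' h1' h2' h, fun h => h3' t ht h1 h2 h⟩)
    have : tc x = x ∪ ZFSet.sUnion b := by
      ext z
      rw [mem_tc, ZFSet.mem_union, ZFSet.mem_sUnion]
      refine or_congr_right ⟨?_, ?_⟩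
      · rintro ⟨y, hy, hz⟩
        refine ⟨tc y, (hb _).2 ⟨ih y hy (mem_model hx hy), y, hy, ?_⟩, hz⟩
        exact ⟨tc_transitive y, subset_tc y, fun T _ hT h => tc_subset hT h⟩
      · rintro ⟨t, ht, hz⟩
        obtain ⟨-, y, hy, -, -, h3⟩ := (hb t).1 ht
        exact ⟨y, hy, h3 (tc y) (ih y hy (mem_model hx hy)) (tc_transitive y) (subset_tc y) hz⟩
    rw [this]
    have : Fact (x ∈ M) := ⟨hx⟩
    have : Fact (b ∈ M) := ⟨hbM⟩
    exact Tm.mem₀ inferInstance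

/-- Functions defined by `∈`-recursion from a definable operation are definable. -/
theorem Tm.recursion {G : ZFSet.{u} → ZFSet.{u} → ZFSet.{u}} {F : ZFSet.{u} → ZFSet.{u}}
    (hG : Tm M fun v : Fin 2 → ZFSet.{u} => G (v 0) (v 1))
    (hF : ∀ u f, (∀ a ∈ tc u, ∀ b, ZFSet.pair a b ∈ f ↔ b = F a) → G u f = F u) :
    Tm M fun v : Fin 1 → ZFSet.{u} => F (v 0) := by
  -- An attempt: `f` obeys the recursion on the transitive set `T`, and is unrestricted elsewhere.
  let Good : ZFSet.{u} → ZFSet.{u} → Prop := fun T f => (∀ y, y ∈ T → ∀ z, z ∈ y → z ∈ T) ∧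
    ∀ a, a ∈ T → ∀ b, b ∈ M → (ZFSet.pair a b ∈ f ↔ b = G a f)
  have hGM : ∀ a ∈ M, ∀ f ∈ M, G a f ∈ M := fun a ha f hf =>
    hG.mem ![a, f] (Fin.cases ha fun i => Fin.cases hf (fun i => i.elim0) i)
  have hGi : ∀ {m : ℕ} {t s : (Fin m → ZFSet.{u}) → ZFSet.{u}} [Tm M t] [Tm M s],
    Tm M fun v => G (t v) (s v) := fun {m t s} ht hs => Tm.comp₂ hG ht hs
  have hGood : Df M fun v : Fin 2 → ZFSet.{u} => Good (v 0) (v 1) := by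
    dsimp only [Good]
    infer_instance
  have pairM : ∀ {a b f : ZFSet.{u}}, f ∈ M → ZFSet.pair a b ∈ f → b ∈ M := by
    intro a b f hf h
    have h2 : ({a, b} : ZFSet.{u}) ∈ M := mem_model (mem_model hf h) (by simp [ZFSet.pair])
    exact mem_model h2 (by simp)
  have correct : ∀ T f, f ∈ M → T ∈ M → Good T f → ∀ a ∈ T, ∀ b, ZFSet.pair a b ∈ f ↔ b = F a := by
    intro T f hf hT h a
    induction a using tc_induction with
    | h a ih =>
      intro ha b
      have hsub : tc a ⊆ T := tc_subset h.1 fun z hz => h.1 a ha z hz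
      have e := hF a f fun c hc => ih c hc (hsub hc)
      have haM := mem_model hT ha
      constructor
      · intro hb
        rw [← e]
        exact (h.2 a ha b (pairM hf hb)).1 hb
      · intro hb
        rw [← e] at hb
        exact (h.2 a ha b (hb ▸ hGM a haM f hf)).2 hb
  have exists_good : ∀ u ∈ M, F u ∈ M ∧ ∃ T ∈ M, ∃ f ∈ M, Good T f ∧ u ∈ T := by
    intro u
    induction u using tc_induction with
    | h u ih =>
      intro hu
      have htc := tc_mem_model hu
      -- Attempts agree wherever both apply, so replacement can glue their values on `tc u` into one
      -- function in `M`.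
      obtain ⟨f, hfM, hf⟩ := replacement_model₂ (fun a y => ∃ T, T ∈ M ∧ ∃ f, f ∈ M ∧ Good T f ∧ a ∈ T ∧
          ∃ c, c ∈ M ∧ ZFSet.pair a c ∈ f ∧ y = ZFSet.pair a c)
        (by dsimp only [Good]; infer_instance) htc (by
        rintro a ha y hy y' hy' ⟨T, hT, f, hf, hg, haT, c, hc, h, rfl⟩
          ⟨T', hT', f', hf', hg', haT', c', hc', h', rfl⟩
        have e1 := (correct T f hf hT hg a haT c).1 h
        have e2 := (correct T' f' hf' hT' hg' a haT' c').1 h'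
        simp [e1, e2])
      have hf' : ∀ y, y ∈ f ↔ ∃ a ∈ tc u, y = ZFSet.pair a (F a) := by
        intro y
        rw [hf]
        constructor
        · rintro ⟨-, a, ha, T, hT, f, hf, hg, haT, c, hc, h, e⟩
          exact ⟨a, ha, e.trans (congrArg _ ((correct T f hf hT hg a haT c).1 h))⟩
        · rintro ⟨a, ha, rfl⟩
          have haM := mem_model htc ha
          obtain ⟨hFa, T, hT, g, hg, hgood, haT⟩ := ih a ha haM
          refine ⟨(Tm.mem₀ (M := M) ?_ : ZFSet.pair a (F a) ∈ M), a, ha, T, hT, g, hg, hgood, haT, F a,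
            hFa, (correct T g hg hT hgood a haT _).2 rfl, rfl⟩
          have : Fact (a ∈ M) := ⟨haM⟩
          have : Fact (F a ∈ M) := ⟨hFa⟩
          infer_instance
      have hpair : ∀ a ∈ tc u, ∀ b, ZFSet.pair a b ∈ f ↔ b = F a := by
        intro a ha b
        rw [hf']
        constructor
        · rintro ⟨a', -, e⟩
          obtain ⟨rfl, rfl⟩ := ZFSet.pair_inj.1 e
          rfl
        · rintro rfl; exact ⟨a, ha, rfl⟩
      have hFu : F u ∈ M := hF u f hpair ▸ hGM u hu f hfM
      -- Adding the single value at `u` extends the glued function to an attempt defined at `u`.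
      refine ⟨hFu, insert u (tc u), ?_, insert (ZFSet.pair u (F u)) f, ?_, ⟨?_, ?_⟩,
        ZFSet.mem_insert _ _⟩
      · have : Fact (u ∈ M) := ⟨hu⟩
        have : Fact (tc u ∈ M) := ⟨htc⟩
        exact Tm.mem₀ inferInstance
      · have : Fact (u ∈ M) := ⟨hu⟩
        have : Fact (F u ∈ M) := ⟨hFu⟩
        have : Fact (f ∈ M) := ⟨hfM⟩
        exact Tm.mem₀ inferInstance
      · intro y hy z hz
        rcases ZFSet.mem_insert_iff.1 hy with rfl | hy
        · exact ZFSet.mem_insert_of_mem _ (subset_tc _ hz)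
        · exact ZFSet.mem_insert_of_mem _ (tc_transitive u y hy z hz)
      · intro a ha b _
        have hins : ∀ a ∈ insert u (tc u), ∀ b, ZFSet.pair a b ∈ insert (ZFSet.pair u (F u)) f ↔
            b = F a := by
          intro a ha b
          rw [ZFSet.mem_insert_iff, ZFSet.pair_inj]
          rcases ZFSet.mem_insert_iff.1 ha with rfl | ha
          · refine ⟨?_, fun h => .inl ⟨rfl, h⟩⟩
            rintro (h | h)
            · exact h.2
            · obtain ⟨a', _, e⟩ := (hf' _).1 h
              obtain ⟨rfl, rfl⟩ := ZFSet.pair_inj.1 e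
              rfl
          · rw [hpair a ha]
            refine ⟨?_, .inr⟩
            rintro (⟨rfl, h⟩ | h) <;> exact h
        rw [hins a ha b, hF a _ fun c hc => hins c ?_]
        refine ZFSet.mem_insert_of_mem _ ?_
        rcases ZFSet.mem_insert_iff.1 ha with rfl | ha
        · exact hc
        · exact tc_subset_of_mem ha hc
  refine ⟨fun v hv => (exists_good (v 0) (hv 0)).1, ?_⟩
  have hS : Df M fun v : Fin 2 → ZFSet.{u} => ∃ T, T ∈ M ∧ ∃ f, f ∈ M ∧ Good T f ∧ v 1 ∈ T ∧
      ZFSet.pair (v 1) (v 0) ∈ f := by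
    dsimp only [Good]
    infer_instance
  refine hS.congr fun v hv => ⟨?_, ?_⟩
  · rintro ⟨T, hT, f, hf, hg, h1, h⟩
    exact (correct T f hf hT hg _ h1 _).1 h
  · intro e
    obtain ⟨_, T, hT, f, hf, hg, h1⟩ := exists_good (v 1) (hv 1)
    exact ⟨T, hT, f, hf, hg, h1, (correct T f hf hT hg _ h1 _).2 e⟩

theorem exists_powerset_model {X : ZFSet.{u}} (hX : X ∈ M) :
    ∃ Y ∈ M, ∀ y, y ∈ Y ↔ y ∈ M ∧ y ⊆ X := by
  obtain ⟨Y, hY⟩ := hM.out.powerset ⟨X, hX⟩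
  refine ⟨Y, Y.2, fun y => ?_⟩
  by_cases hy : y ∈ M
  · rw [hY ⟨y, hy⟩]
    simp only [hy, true_and]
    exact ⟨fun h z hz => h ⟨z, mem_model hy hz⟩ hz, fun h z hz => h hz⟩
  · exact iff_of_false (fun h => hy (mem_model Y.2 h)) fun h => hy h.1

theorem mem_omega_iff {x : ZFSet.{u}} : x ∈ ZFSet.omega ↔ ∃ n, x = natSet n := by
  have h : ∀ n, ZFSet.mk (PSet.ofNat n) = natSet n := by
    intro n
    induction n with
    | zero => rfl
    | succ n ih => rw [natSet, ← ih]; rfl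
  constructor
  · refine Quotient.inductionOn x ?_
    rintro x ⟨⟨n⟩, hn⟩
    exact ⟨n, (ZFSet.sound hn).trans (h n)⟩
  · rintro ⟨n, rfl⟩
    induction n with
    | zero => exact ZFSet.omega_zero
    | succ n ih => exact ZFSet.omega_succ ih

theorem omega_mem_model : ZFSet.omega.{u} ∈ M := by
  obtain ⟨w, ⟨e, he, hew⟩, hw⟩ := hM.out.infinity
  have he0 : e.1 = ∅ := by
    rw [ZFSet.eq_empty]
    exact fun y hy => he ⟨y, mem_model e.2 hy⟩ hy
  have hsucc : ∀ x ∈ w.1, insert x x ∈ w.1 := by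
    intro x hx
    have hxM := mem_model w.2 hx
    obtain ⟨y, hy, hy'⟩ := hw ⟨x, hxM⟩ hx
    convert hy
    ext z
    by_cases hz : z ∈ M
    · rw [hy' ⟨z, hz⟩, ZFSet.mem_insert_iff, or_comm]
      simp
    · refine iff_of_false (fun h => hz ?_) fun h => hz (mem_model y.2 h)
      rcases ZFSet.mem_insert_iff.1 h with rfl | h
      exacts [hxM, mem_model hxM h]
  have : Fact (w.1 ∈ M) := ⟨w.2⟩
  have : Fact (∅ ∈ M) := ⟨he0 ▸ e.2⟩
  -- The intersection of all inductive sets of `M`, taken inside the one given by the axiom of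
  -- infinity.
  let o := ZFSet.sep (fun n => ∀ J, J ∈ M → ∅ ∈ J → (∀ x, x ∈ J → insert x x ∈ J) → n ∈ J) w.1
  have ho : o ∈ M := Fact.sep.out
  have hoω : ∀ n, natSet n ∈ o := by
    intro n
    rw [ZFSet.mem_sep]
    induction n with
    | zero => exact ⟨by rw [natSet, ← he0]; exact hew, fun J _ h _ => h⟩
    | succ n ih => exact ⟨hsucc _ ih.1, fun J hJ h h' => h' _ (ih.2 J hJ h h')⟩
  have : o = ZFSet.omega := by
    ext x
    refine ⟨?_, fun h => ?_⟩
    · induction x using ZFSet.inductionOn with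
      | h x ih =>
        intro hx
        by_contra hxω
        have : Fact (x ∈ M) := ⟨mem_model ho hx⟩
        have : Fact (o ∈ M) := ⟨ho⟩
        -- An element `x ∉ ω` could be removed without destroying inductivity: it is not `∅`, and if
        -- it were the successor of some `y ∈ o`, then `y ∈ ω` by induction and `x ∈ ω`.
        have hJ : ZFSet.sep (fun y => y ≠ x) o ∈ M := Fact.sep.out
        have := (ZFSet.mem_sep.1 hx).2 _ hJ (by
          rw [ZFSet.mem_sep]
          exact ⟨hoω 0, fun e => hxω (e ▸ ZFSet.omega_zero)⟩) (by
          intro y hy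
          rw [ZFSet.mem_sep] at hy ⊢
          have hy' := ZFSet.mem_sep.1 hy.1
          refine ⟨ZFSet.mem_sep.2 ⟨hsucc _ hy'.1, fun J hJ h h' => h' _ (hy'.2 J hJ h h')⟩, ?_⟩
          rintro rfl
          exact hxω (ZFSet.omega_succ (ih y (ZFSet.mem_insert _ _) hy.1)))
        exact (ZFSet.mem_sep.1 this).2 rfl
    · obtain ⟨n, rfl⟩ := mem_omega_iff.1 h
      exact hoω n
  exact this ▸ ho

end Model

/-! ## Maximal antichains inside a transitive model -/

section Model

variable {M : Set ZFSet.{u}} [hM : Fact (IsTransitiveModelZFC M)]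

/-- The axiom of choice in `M` is stated for disjoint families; the sets `{Y} × Y` are disjoint
because of the tag `Y`, and a transversal of them is a choice function. -/
theorem exists_choice_model {X : ZFSet.{u}} (hX : X ∈ M) :
    ∃ c ∈ M, ∀ Y ∈ M, Y ⊆ X → Y ≠ ∅ → ∃! x, x ∈ Y ∧ ZFSet.pair Y x ∈ c := by
  obtain ⟨PX, hPX, hmem⟩ := exists_powerset_model hX
  have : Fact (PX ∈ M) := ⟨hPX⟩
  let a := img (fun Y => img (fun x => ZFSet.pair Y x) Y) (ZFSet.sep (fun Y => ∃ x, x ∈ Y) PX)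
  have ha : a ∈ M := by
    dsimp only [a]
    exact Tm.mem₀ inferInstance
  have hmem_a : ∀ z, z ∈ a ↔ ∃ Y ∈ M, Y ⊆ X ∧ (∃ x, x ∈ Y) ∧ img (fun x => ZFSet.pair Y x) Y = z := by
    intro z
    simp only [a, mem_img, ZFSet.mem_sep, hmem, and_assoc]
  obtain ⟨c, hc⟩ := hM.out.choice ⟨a, ha⟩ (by
    rintro ⟨z, hz⟩ hza
    obtain ⟨Y, -, -, ⟨x, hx⟩, rfl⟩ := (hmem_a z).1 hza
    have h : ZFSet.pair Y x ∈ img (fun x => ZFSet.pair Y x) Y := mem_img.2 ⟨x, hx, rfl⟩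
    exact ⟨⟨_, mem_model hz h⟩, h⟩) (by
    rintro ⟨y, hy⟩ ⟨y', hy'⟩ ⟨z, hz⟩ hya hya' hzy hzy'
    obtain ⟨Y, -, -, -, rfl⟩ := (hmem_a y).1 hya
    obtain ⟨Y', -, -, -, rfl⟩ := (hmem_a y').1 hya'
    obtain ⟨x, -, rfl⟩ := mem_img.1 hzy
    obtain ⟨x', -, e⟩ := mem_img.1 hzy'
    obtain ⟨rfl, -⟩ := ZFSet.pair_inj.1 e
    rfl)
  refine ⟨c, c.2, fun Y hY hYX hne => ?_⟩
  have hza : img (fun x => ZFSet.pair Y x) Y ∈ a :=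
    (hmem_a _).2 ⟨Y, hY, hYX, by by_contra h; exact hne ((ZFSet.eq_empty _).2 (by simpa using h)), rfl⟩
  obtain ⟨⟨z, hzM⟩, ⟨hz, hzc⟩, huniq⟩ := hc ⟨_, mem_model ha hza⟩ hza
  obtain ⟨x, hx, rfl⟩ := mem_img.1 hz
  refine ⟨x, ⟨hx, hzc⟩, fun x' ⟨hx', hc'⟩ => ?_⟩
  have := huniq ⟨_, mem_model c.2 hc'⟩ ⟨mem_img.2 ⟨x', hx', rfl⟩, hc'⟩
  exact (ZFSet.pair_inj.1 (congrArg Subtype.val this)).2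

/-- The least family containing `⋃ S` with every `S ⊆ T` in `M` and closed under an inflationary
operation adding at most one point is a chain with a fixed point as its union. -/
theorem exists_tower_model {X : ZFSet.{u}} (hX : X ∈ M) {step : ZFSet.{u} → ZFSet.{u}}
    (hstep : Tm M fun v : Fin 1 → ZFSet.{u} => step (v 0))
    (hsub : ∀ A ∈ M, A ⊆ X → step A ⊆ X) (hinfl : ∀ A, A ⊆ step A)
    (hone : ∀ A ∈ M, A ⊆ X → ∀ x ∈ step A, ∀ y ∈ step A, x ∉ A → y ∉ A → x = y) :
    ∃ T ∈ M, (∀ A ∈ T, A ⊆ X) ∧ (∀ A ∈ T, ∀ B ∈ T, A ⊆ B ∨ B ⊆ A) ∧ ZFSet.sUnion T ∈ T ∧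
      step (ZFSet.sUnion T) = ZFSet.sUnion T ∧
      ∀ φ : ZFSet.{u} → Prop, (Df M fun v : Fin 1 → ZFSet.{u} => φ (v 0)) →
        (∀ A ∈ T, φ A → φ (step A)) →
        (∀ S ∈ M, S ⊆ T → (∀ A ∈ S, φ A) → φ (ZFSet.sUnion S)) → ∀ A ∈ T, φ A := by
  obtain ⟨PX, hPX, hmem⟩ := exists_powerset_model hX
  have hPXi : Fact (PX ∈ M) := ⟨hPX⟩
  have hi : ∀ {m : ℕ} {t : (Fin m → ZFSet.{u}) → ZFSet.{u}} [Tm M t], Tm M fun v => step (t v) :=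
    fun {m t} ht => Tm.comp₁ hstep ht
  have stepM : ∀ A ∈ M, step A ∈ M := fun A hA => hstep.mem (fun _ => A) fun _ => hA
  let tower : ZFSet.{u} → Prop := fun F => (∀ A, A ∈ F → step A ∈ F) ∧
    ∀ S, S ∈ M → S ⊆ F → ZFSet.sUnion S ∈ F
  let T := ZFSet.sep (fun A => ∀ F, F ∈ M → F ⊆ PX → tower F → A ∈ F) PX
  have hT : T ∈ M := by
    have : Df M fun v : Fin 1 → ZFSet.{u} => ∀ F, F ∈ M → F ⊆ PX → tower F → v 0 ∈ F := by
      dsimp only [tower]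
      infer_instance
    exact Fact.sep.out
  have hTi : Fact (T ∈ M) := ⟨hT⟩
  have hTX : ∀ A ∈ T, A ⊆ X := fun A hA => ((hmem A).1 (ZFSet.mem_sep.1 hA).1).2
  have hT_step : ∀ A ∈ T, step A ∈ T := by
    intro A hA
    have hAM := mem_model hT hA
    refine ZFSet.mem_sep.2 ⟨(hmem _).2 ⟨stepM A hAM, hsub A hAM (hTX A hA)⟩, fun F hF hF' h => ?_⟩
    exact h.1 A ((ZFSet.mem_sep.1 hA).2 F hF hF' h)
  have hT_union : ∀ S ∈ M, S ⊆ T → ZFSet.sUnion S ∈ T := by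
    intro S hS hST
    refine ZFSet.mem_sep.2 ⟨(hmem _).2 ⟨sUnion_mem_model hS, ?_⟩, fun F hF hF' h => ?_⟩
    · intro x hx
      obtain ⟨A, hA, hx⟩ := ZFSet.mem_sUnion.1 hx
      exact hTX A (hST hA) hx
    · exact h.2 S hS fun A hA => (ZFSet.mem_sep.1 (hST hA)).2 F hF hF' h
  have hind : ∀ φ : ZFSet.{u} → Prop, (Df M fun v : Fin 1 → ZFSet.{u} => φ (v 0)) →
        (∀ A ∈ T, φ A → φ (step A)) →
        (∀ S ∈ M, S ⊆ T → (∀ A ∈ S, φ A) → φ (ZFSet.sUnion S)) → ∀ A ∈ T, φ A := by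
    intro φ hφ h1 h2 A hA
    -- Minimality of `T` is only against towers in `M`, which is why induction along `T` is
    -- restricted to definable properties.
    have hF : ZFSet.sep φ T ∈ M := Fact.sep.out
    refine (ZFSet.mem_sep.1 ((ZFSet.mem_sep.1 hA).2 _ hF ?_ ⟨?_, ?_⟩)).2
    · exact fun B hB => (ZFSet.mem_sep.1 (ZFSet.mem_sep.1 hB).1).1
    · intro B hB
      rw [ZFSet.mem_sep] at hB ⊢
      exact ⟨hT_step B hB.1, h1 B hB.1 hB.2⟩
    · intro S hS hSF
      have hST : S ⊆ T := fun B hB => (ZFSet.mem_sep.1 (hSF hB)).1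
      exact ZFSet.mem_sep.2 ⟨hT_union S hS hST, h2 S hS hST fun B hB => (ZFSet.mem_sep.1 (hSF hB)).2⟩
  -- If `C` is comparable with every member of `T`, then no member lies strictly between `C` and
  -- `step C`.
  have hcomp : ∀ C ∈ T, (∀ B ∈ T, B ⊆ C ∨ C ⊆ B) → ∀ B ∈ T, B ⊆ C ∨ step C ⊆ B := by
    intro C hC hcmp
    have : Fact (C ∈ M) := ⟨mem_model hT hC⟩
    refine hind (fun B => B ⊆ C ∨ step C ⊆ B) inferInstance ?_ ?_
    · rintro B hB (h | h)
      · rcases hcmp _ (hT_step B hB) with h' | h'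
        · exact .inl h'
        · by_cases hBC : C ⊆ B
          · obtain rfl : B = C := by ext z; exact ⟨fun hz => h hz, fun hz => hBC hz⟩
            exact .inr fun _ h => h
          · left
            rw [ZFSet.subset_def] at hBC
            push Not at hBC
            obtain ⟨z, hzC, hzB⟩ := hBC
            intro x hx
            by_cases hxB : x ∈ B
            · exact h hxB
            -- Here `B ⊊ C ⊆ step B`, and `step B` has only one new point, which must be the `z ∈ C`
            -- found above.
            · rw [hone B (mem_model hT hB) (hTX B hB) x hx z (h' hzC) hxB hzB]
              exact hzC
      · exact .inr fun x hx => hinfl B (h hx)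
    · intro S hS hST h
      by_cases h' : ∃ B ∈ S, step C ⊆ B
      · obtain ⟨B, hB, h'⟩ := h'
        exact .inr fun x hx => ZFSet.mem_sUnion.2 ⟨B, hB, h' hx⟩
      · left
        intro x hx
        obtain ⟨B, hB, hx⟩ := ZFSet.mem_sUnion.1 hx
        exact ((h B hB).resolve_right fun h'' => h' ⟨B, hB, h''⟩) hx
  have hchain : ∀ C ∈ T, ∀ B ∈ T, B ⊆ C ∨ C ⊆ B := by
    refine hind (fun C => ∀ B, B ∈ T → B ⊆ C ∨ C ⊆ B) inferInstance ?_ ?_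
    · intro C hC h B hB
      rcases hcomp C hC h B hB with h | h
      · exact .inl fun x hx => hinfl C (h hx)
      · exact .inr h
    · intro S hS hST h B hB
      by_cases h' : ∃ C ∈ S, B ⊆ C
      · obtain ⟨C, hC, h'⟩ := h'
        exact .inl fun x hx => ZFSet.mem_sUnion.2 ⟨C, hC, h' hx⟩
      · right
        intro x hx
        obtain ⟨C, hC, hx⟩ := ZFSet.mem_sUnion.1 hx
        exact ((h C hC B hB).resolve_left fun h'' => h' ⟨C, hC, h''⟩) hx
  have hU : ZFSet.sUnion T ∈ T := hT_union T hT fun _ h => h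
  refine ⟨T, hT, hTX, fun A hA B hB => hchain B hB A hA, hU, ?_, hind⟩
  ext x
  exact ⟨fun h => ZFSet.mem_sUnion.2 ⟨_, hT_step _ hU, h⟩, fun h => hinfl _ h⟩

/-! ### Antichains of posets that belong to the model -/

instance Df.le {n : ℕ} {P : PosetData.{u}} [Fact (P.rel ∈ M)] {t s : (Fin n → ZFSet.{u}) → ZFSet.{u}}
    [Tm M t] [Tm M s] : Df M fun v => P.Le (t v) (s v) := by
  unfold PosetData.Le
  infer_instance

instance Df.compat {n : ℕ} {P : PosetData.{u}} [Fact (P.carrier ∈ M)] [Fact (P.rel ∈ M)]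
    {t s : (Fin n → ZFSet.{u}) → ZFSet.{u}} [ht : Tm M t] [hs : Tm M s] :
    Df M fun v => P.Compat (t v) (s v) := by
  unfold PosetData.Compat
  have := ht.lift
  have := hs.lift
  infer_instance

theorem PosetData.Compat.symm {P : PosetData.{u}} {p q : ZFSet.{u}}
    (h : P.Compat p q) : P.Compat q p :=
  let ⟨r, hr, h1, h2⟩ := h
  ⟨r, hr, h2, h1⟩

/-- Iterate the step that adds a chosen element of `X` incompatible with everything so far. A fixed
point admits no such element, as it would contain it and the element is compatible with itself. -/
theorem exists_max_antichain_model {P : PosetData.{u}} (hP : P.IsPoset) [Fact (P.carrier ∈ M)]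
    [Fact (P.rel ∈ M)] {X : ZFSet.{u}} (hX : X ∈ M) (hXP : X ⊆ P.carrier) :
    ∃ A ∈ M, A ⊆ X ∧ (∀ a ∈ A, ∀ b ∈ A, a ≠ b → ¬ P.Compat a b) ∧ ∀ x ∈ X, ∃ a ∈ A, P.Compat a x := by
  obtain ⟨c, hc, hcX⟩ := exists_choice_model hX
  have : Fact (X ∈ M) := ⟨hX⟩
  have : Fact (c ∈ M) := ⟨hc⟩
  let rest : ZFSet.{u} → ZFSet.{u} := fun A => ZFSet.sep (fun x => ∀ a, a ∈ A → ¬ P.Compat a x) X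
  let step : ZFSet.{u} → ZFSet.{u} := fun A =>
    A ∪ ZFSet.sep (fun x => ZFSet.pair (rest A) x ∈ c) (rest A)
  have hstep : Tm M fun v : Fin 1 → ZFSet.{u} => step (v 0) := by
    dsimp only [step, rest]
    infer_instance
  have hrest : Tm M fun v : Fin 1 → ZFSet.{u} => rest (v 0) := by
    dsimp only [rest]
    infer_instance
  have hrestM : ∀ A ∈ M, rest A ∈ M := fun A hA => hrest.mem (fun _ => A) fun _ => hA
  have hrestX : ∀ A, rest A ⊆ X := fun A => ZFSet.sep_subset
  have hstep_new : ∀ A x, x ∈ step A → x ∉ A → x ∈ rest A ∧ ZFSet.pair (rest A) x ∈ c := by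
    intro A x hx hxA
    rcases ZFSet.mem_union.1 hx with h | h
    · exact absurd h hxA
    · exact ZFSet.mem_sep.1 h
  obtain ⟨T, hT, hTX, hchain, hU, hfix, hind⟩ := exists_tower_model hX hstep
    (fun A _ hA x hx => by
      by_cases hxA : x ∈ A
      · exact hA hxA
      · exact hrestX A (hstep_new A x hx hxA).1)
    (fun A x hx => ZFSet.mem_union.2 (.inl hx))
    (fun A hA hAX x hx y hy hxA hyA => by
      have h1 := hstep_new A x hx hxA
      have h2 := hstep_new A y hy hyA
      refine (hcX _ (hrestM A hA) (hrestX A) ?_).unique h1 h2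
      rintro e
      rw [e] at h1
      exact ZFSet.notMem_empty _ h1.1)
  have hanti := hind (fun A => ∀ a, a ∈ A → ∀ b, b ∈ A → a ≠ b → ¬ P.Compat a b) inferInstance
    (by
      intro A hA h a ha b hb hab
      by_cases haA : a ∈ A <;> by_cases hbA : b ∈ A
      · exact h a haA b hbA hab
      · exact (ZFSet.mem_sep.1 (hstep_new A b hb hbA).1).2 a haA
      · exact fun hab => (ZFSet.mem_sep.1 (hstep_new A a ha haA).1).2 b hbA hab.symm
      · have h1 := hstep_new A a ha haA
        have h2 := hstep_new A b hb hbA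
        exact absurd ((hcX _ (hrestM A (mem_model hT hA)) (hrestX A) (by
          rintro e
          rw [e] at h1
          exact ZFSet.notMem_empty _ h1.1)).unique h1 h2) hab)
    (by
      intro S _ hST h a ha b hb
      obtain ⟨A, hA, haA⟩ := ZFSet.mem_sUnion.1 ha
      obtain ⟨B, hB, hbB⟩ := ZFSet.mem_sUnion.1 hb
      rcases hchain A (hST hA) B (hST hB) with h' | h'
      · exact h B hB a (h' haA) b hbB
      · exact h A hA a haA b (h' hbB))
  refine ⟨ZFSet.sUnion T, mem_model hT hU, hTX _ hU, hanti _ hU, fun x hx => ?_⟩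
  by_contra hno
  push Not at hno
  have hx' : x ∈ rest (ZFSet.sUnion T) := ZFSet.mem_sep.2 ⟨hx, hno⟩
  obtain ⟨y, ⟨hy, hyc⟩, -⟩ := hcX _ (hrestM _ (mem_model hT hU)) (hrestX _) (by
    rintro e
    rw [e] at hx'
    exact ZFSet.notMem_empty _ hx')
  have hyU : y ∈ ZFSet.sUnion T := by
    rw [← hfix]
    exact ZFSet.mem_union.2 (.inr (ZFSet.mem_sep.2 ⟨hy, hyc⟩))
  have hyP := hXP (hrestX _ hy)
  exact (ZFSet.mem_sep.1 hy).2 y hyU ⟨y, hyP, hP.refl y hyP, hP.refl y hyP⟩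

/-- An antichain maximal among the conditions in `S` is maximal in `P` by density, and it lies in
`M`, so it stays maximal in `Q`. This is the form in which `⋖_M` is used throughout. -/
theorem predense_of_dense {P Q : PosetData.{u}} (hP : P.IsPoset)
    [Fact (P.carrier ∈ M)] [Fact (P.rel ∈ M)] (hPQ : CompleteSuborderOver M P Q)
    (S : ZFSet.{u} → Prop) [hS : Df M fun v : Fin 1 → ZFSet.{u} => S (v 0)]
    (hdense : ∀ p ∈ P.carrier, ∃ r ∈ P.carrier, P.Le r p ∧ S r) {q : ZFSet.{u}}
    (hq : q ∈ Q.carrier) : ∃ r ∈ P.carrier, S r ∧ Q.Compat r q := by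
  obtain ⟨A, hA, hAX, hanti, hmax⟩ := exists_max_antichain_model hP
    (X := ZFSet.sep S P.carrier) (Fact.sep (M := M)).out ZFSet.sep_subset
  have hAP : ∀ a ∈ A, a ∈ P.carrier ∧ S a := fun a ha => ZFSet.mem_sep.1 (hAX ha)
  obtain ⟨-, -, h⟩ := hPQ.2 A hA ⟨fun a ha => (hAP a ha).1, hanti, fun p hp => by
    obtain ⟨r, hr, hrp, hSr⟩ := hdense p hp
    obtain ⟨a, ha, t, ht, hta, htr⟩ := hmax r (ZFSet.mem_sep.2 ⟨hr, hSr⟩)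
    exact ⟨a, ha, t, ht, hta, hP.trans _ _ _ htr hrp⟩⟩
  obtain ⟨a, ha, h⟩ := h q hq
  exact ⟨a, (hAP a ha).1, (hAP a ha).2, h⟩

/-- Two incompatible conditions of `P` belong to a common maximal antichain in `M`, which is still
an antichain in `Q`. -/
theorem compat_of_compat {P Q : PosetData.{u}} (hP : P.IsPoset)
    [Fact (P.carrier ∈ M)] [Fact (P.rel ∈ M)] (hPQ : CompleteSuborderOver M P Q) {p q : ZFSet.{u}}
    (hp : p ∈ P.carrier) (hq : q ∈ P.carrier) (h : Q.Compat p q) : P.Compat p q := by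
  by_contra hpq
  have : Fact (p ∈ M) := ⟨mem_model (M := M) Fact.out hp⟩
  have : Fact (q ∈ M) := ⟨mem_model (M := M) Fact.out hq⟩
  -- Within this set only `p` is compatible with `p` and only `q` with `q`, so a maximal antichain
  -- of it must contain both.
  let S : ZFSet.{u} → Prop := fun r => r = p ∨ r = q ∨ ¬ P.Compat p r ∧ ¬ P.Compat q r
  have hX : ZFSet.sep S P.carrier ∈ M := by
    have : Df M fun v : Fin 1 → ZFSet.{u} => S (v 0) := by dsimp only [S]; infer_instance
    exact Fact.sep.out
  have hpp : P.Compat p p := ⟨p, hp, hP.refl p hp, hP.refl p hp⟩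
  have hqq : P.Compat q q := ⟨q, hq, hP.refl q hq, hP.refl q hq⟩
  obtain ⟨A, hA, hAX, hanti, hmax⟩ := exists_max_antichain_model hP hX ZFSet.sep_subset
  have hpA : p ∈ A := by
    obtain ⟨a, ha, hap⟩ := hmax p (ZFSet.mem_sep.2 ⟨hp, .inl rfl⟩)
    rcases (ZFSet.mem_sep.1 (hAX ha)).2 with rfl | rfl | h'
    exacts [ha, absurd hap.symm hpq, absurd hap.symm h'.1]
  have hqA : q ∈ A := by
    obtain ⟨a, ha, haq⟩ := hmax q (ZFSet.mem_sep.2 ⟨hq, .inr (.inl rfl)⟩)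
    rcases (ZFSet.mem_sep.1 (hAX ha)).2 with rfl | rfl | h'
    exacts [absurd haq hpq, ha, absurd haq.symm h'.2]
  obtain ⟨-, hantiQ, -⟩ := hPQ.2 A hA ⟨fun a ha => (ZFSet.mem_sep.1 (hAX ha)).1, hanti, fun r hr => by
    by_cases h1 : P.Compat p r
    · exact ⟨p, hpA, h1⟩
    by_cases h2 : P.Compat q r
    · exact ⟨q, hqA, h2⟩
    exact hmax r (ZFSet.mem_sep.2 ⟨hr, .inr (.inr ⟨h1, h2⟩)⟩)⟩
  refine hantiQ p hpA q hqA ?_ h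
  rintro rfl
  exact hpq hpp

end Model

/-! ## Definability of check names and of forced equality -/

theorem mem_check {P : PosetData.{u}} {x z : ZFSet.{u}} :
    z ∈ check P x ↔ ∃ y ∈ x, ∃ p ∈ P.carrier, z = ZFSet.pair (check P y) p := by
  rw [check]
  simp only [ZFSet.mem_range, Prod.exists, Subtype.exists]
  constructor
  · rintro ⟨y, hy, p, hp, rfl⟩
    exact ⟨y, hy, p, hp, rfl⟩
  · rintro ⟨y, hy, p, hp, rfl⟩
    exact ⟨y, hy, p, hp, rfl⟩

theorem forcesEq_iff {P : PosetData.{u}} {σ τ p : ZFSet.{u}} : ForcesEq P σ τ p ↔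
    (∀ x s, ZFSet.pair x s ∈ σ → ∀ q, P.Le q p → P.Le q s →
      ∃ r, P.Le r q ∧ ∃ ρ t, ZFSet.pair ρ t ∈ τ ∧ P.Le r t ∧ ForcesEq P x ρ r) ∧
    (∀ ρ t, ZFSet.pair ρ t ∈ τ → ∀ q, P.Le q p → P.Le q t →
      ∃ r, P.Le r q ∧ ∃ x s, ZFSet.pair x s ∈ σ ∧ P.Le r s ∧ ForcesEq P x ρ r) := by
  rw [ForcesEq]
  constructor
  · rintro ⟨h1, h2⟩
    refine ⟨fun x s hx => h1 ⟨(x, s), hx⟩, fun ρ t hρ q hqp hqt => ?_⟩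
    obtain ⟨r, hr, x, h⟩ := h2 ρ t hρ q hqp hqt
    exact ⟨r, hr, x.1.1, x.1.2, x.2, h⟩
  · rintro ⟨h1, h2⟩
    refine ⟨fun x => h1 x.1.1 x.1.2 x.2, fun ρ t hρ q hqp hqt => ?_⟩
    obtain ⟨r, hr, x, s, hx, h⟩ := h2 ρ t hρ q hqp hqt
    exact ⟨r, hr, ⟨(x, s), hx⟩, h⟩

theorem PosetData.IsPoset.mem_left {P : PosetData.{u}} (hP : P.IsPoset) {p q : ZFSet.{u}}
    (h : P.Le p q) : p ∈ P.carrier :=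
  (ZFSet.pair_mem_prod.1 (hP.rel_subset h)).1

theorem PosetData.IsPoset.mem_right {P : PosetData.{u}} (hP : P.IsPoset) {p q : ZFSet.{u}}
    (h : P.Le p q) : q ∈ P.carrier :=
  (ZFSet.pair_mem_prod.1 (hP.rel_subset h)).2

theorem left_mem_sUnion_sUnion {x y f : ZFSet.{u}} (h : ZFSet.pair x y ∈ f) :
    x ∈ ZFSet.sUnion (ZFSet.sUnion f) :=
  ZFSet.mem_sUnion.2 ⟨{x, y}, ZFSet.mem_sUnion.2 ⟨_, h, by simp [ZFSet.pair]⟩, by simp⟩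

theorem right_mem_sUnion_sUnion {x y f : ZFSet.{u}} (h : ZFSet.pair x y ∈ f) :
    y ∈ ZFSet.sUnion (ZFSet.sUnion f) :=
  ZFSet.mem_sUnion.2 ⟨{x, y}, ZFSet.mem_sUnion.2 ⟨_, h, by simp [ZFSet.pair]⟩, by simp⟩

theorem left_mem_tc {x y f : ZFSet.{u}} (h : ZFSet.pair x y ∈ f) : x ∈ tc f :=
  tc_transitive f {x} (tc_transitive f _ (subset_tc f h) {x} (by simp [ZFSet.pair])) x (by simp)

/-- The pairs `⟨ρ, p⟩ ∈ B × P` such that `p ⊩ σ = ρ`. -/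
def forcedEqSet (P : PosetData.{u}) (B σ : ZFSet.{u}) : ZFSet.{u} :=
  ZFSet.sep (fun z => ∃ ρ ∈ B, ∃ p ∈ P.carrier, z = ZFSet.pair ρ p ∧ ForcesEq P σ ρ p)
    (ZFSet.prod B P.carrier)

theorem pair_mem_forcedEqSet {P : PosetData.{u}} {B σ ρ p : ZFSet.{u}} :
    ZFSet.pair ρ p ∈ forcedEqSet P B σ ↔ ρ ∈ B ∧ p ∈ P.carrier ∧ ForcesEq P σ ρ p := by
  rw [forcedEqSet, ZFSet.mem_sep, ZFSet.pair_mem_prod]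
  constructor
  · rintro ⟨-, ρ', hρ, p', hp, e, h⟩
    obtain ⟨rfl, rfl⟩ := ZFSet.pair_inj.1 e
    exact ⟨hρ, hp, h⟩
  · rintro ⟨hρ, hp, h⟩
    exact ⟨⟨hρ, hp⟩, ρ, hρ, p, hp, rfl, h⟩

section Model

variable {M : Set ZFSet.{u}} [hM : Fact (IsTransitiveModelZFC M)]

instance Tm.checkName {n : ℕ} {P : PosetData.{u}} [Fact (P.carrier ∈ M)]
    {t : (Fin n → ZFSet.{u}) → ZFSet.{u}} [ht : Tm M t] : Tm M fun v => check P (t v) := by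
  refine Tm.comp₁ (Tm.recursion (G := fun u f => ZFSet.sep (fun z => ∃ y, y ∈ u ∧
    ∃ w, w ∈ ZFSet.sUnion (ZFSet.sUnion f) ∧ ∃ p, p ∈ P.carrier ∧ ZFSet.pair y w ∈ f ∧
      z = ZFSet.pair w p) (ZFSet.prod (ZFSet.sUnion (ZFSet.sUnion f)) P.carrier))
    inferInstance fun u f hf => ?_) ht
  ext z
  rw [ZFSet.mem_sep, mem_check]
  constructor
  · rintro ⟨-, y, hy, w, -, p, hp, hyw, rfl⟩
    rw [(hf y (subset_tc u hy) w).1 hyw]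
    exact ⟨y, hy, p, hp, rfl⟩
  · rintro ⟨y, hy, p, hp, rfl⟩
    have h := (hf y (subset_tc u hy) _).2 rfl
    have hw := right_mem_sUnion_sUnion h
    exact ⟨ZFSet.pair_mem_prod.2 ⟨hw, hp⟩, y, hy, _, hw, p, hp, h, rfl⟩

-- Forced equality recurses on both names at once. Confining the second name to a transitive set `B`
-- turns it into a recursion on `σ` alone with sets as values; transitivity keeps the names
-- occurring in `ρ ∈ B` inside `B`.
set_option synthInstance.maxHeartbeats 400000 in
set_option synthInstance.maxSize 2000 in
theorem Tm.forcedEqSet {n : ℕ} {P : PosetData.{u}} (hP : P.IsPoset) [Fact (P.carrier ∈ M)]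
    [Fact (P.rel ∈ M)] {B : ZFSet.{u}} [hBM : Fact (B ∈ M)] (hB : ∀ y ∈ B, ∀ z ∈ y, z ∈ B)
    {t : (Fin n → ZFSet.{u}) → ZFSet.{u}} (ht : Tm M t) :
    Tm M fun v => ForcingLimit.forcedEqSet P B (t v) := by
  have hBp : ∀ ρ ∈ B, ∀ ρ' t, ZFSet.pair ρ' t ∈ ρ → ρ' ∈ B := fun ρ hρ ρ' t h =>
    hB {ρ'} (hB (ZFSet.pair ρ' t) (hB ρ hρ _ h) _ (by simp [ZFSet.pair])) _ (by simp)
  refine Tm.comp₁ (Tm.recursion (G := fun σ f => ZFSet.sep (fun z => ∃ ρ, ρ ∈ B ∧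
    ∃ p, p ∈ P.carrier ∧ z = ZFSet.pair ρ p ∧
    (∀ x, x ∈ ZFSet.sUnion (ZFSet.sUnion σ) → ∀ s, s ∈ P.carrier → ZFSet.pair x s ∈ σ →
      ∀ q, q ∈ P.carrier → P.Le q p → P.Le q s → ∃ r, r ∈ P.carrier ∧ P.Le r q ∧
      ∃ ρ', ρ' ∈ B ∧ ∃ t, t ∈ P.carrier ∧ ZFSet.pair ρ' t ∈ ρ ∧ P.Le r t ∧
      ∃ w, w ∈ ZFSet.sUnion (ZFSet.sUnion f) ∧ ZFSet.pair x w ∈ f ∧ ZFSet.pair ρ' r ∈ w) ∧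
    (∀ ρ', ρ' ∈ B → ∀ t, t ∈ P.carrier → ZFSet.pair ρ' t ∈ ρ →
      ∀ q, q ∈ P.carrier → P.Le q p → P.Le q t → ∃ r, r ∈ P.carrier ∧ P.Le r q ∧
      ∃ x, x ∈ ZFSet.sUnion (ZFSet.sUnion σ) ∧ ∃ s, s ∈ P.carrier ∧ ZFSet.pair x s ∈ σ ∧ P.Le r s ∧
      ∃ w, w ∈ ZFSet.sUnion (ZFSet.sUnion f) ∧ ZFSet.pair x w ∈ f ∧ ZFSet.pair ρ' r ∈ w))
    (ZFSet.prod B P.carrier)) inferInstance fun σ f hf => ?_) ht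
  -- The only `w` paired with `x` in `f` is the earlier value `forcedEqSet P B x`.
  have key : ∀ x s ρ' r, ZFSet.pair x s ∈ σ → ρ' ∈ B → r ∈ P.carrier →
      ((∃ w, w ∈ ZFSet.sUnion (ZFSet.sUnion f) ∧ ZFSet.pair x w ∈ f ∧ ZFSet.pair ρ' r ∈ w) ↔
        ForcesEq P x ρ' r) := by
    intro x s ρ' r hx hρ' hr
    constructor
    · rintro ⟨w, -, hw, h⟩
      rw [(hf x (left_mem_tc hx) w).1 hw, pair_mem_forcedEqSet] at h
      exact h.2.2
    · intro h
      have h' := (hf x (left_mem_tc hx) _).2 rfl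
      exact ⟨_, right_mem_sUnion_sUnion h', h', pair_mem_forcedEqSet.2 ⟨hρ', hr, h⟩⟩
  ext z
  rw [ZFSet.mem_sep, ForcingLimit.forcedEqSet, ZFSet.mem_sep]
  refine and_congr_right fun _ => exists_congr fun ρ => and_congr_right fun hρ =>
    exists_congr fun p => and_congr_right fun hp => and_congr_right fun _ => ?_
  rw [forcesEq_iff]
  constructor
  · rintro ⟨h1, h2⟩
    refine ⟨fun x s hx q hqp hqs => ?_, fun ρ' t hρ' q hqp hqt => ?_⟩
    · obtain ⟨r, hr, hrq, ρ', hρ', t, ht, h, hrt, hw⟩ := h1 x (left_mem_sUnion_sUnion hx) s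
        (hP.mem_right hqs) hx q (hP.mem_left hqp) hqp hqs
      exact ⟨r, hrq, ρ', t, h, hrt, (key x s ρ' r hx hρ' hr).1 hw⟩
    · obtain ⟨r, hr, hrq, x, -, s, hs, hx, hrs, hw⟩ := h2 ρ' (hBp ρ hρ _ _ hρ') t
        (hP.mem_right hqt) hρ' q (hP.mem_left hqp) hqp hqt
      exact ⟨r, hrq, x, s, hx, hrs, (key x s ρ' r hx (hBp ρ hρ _ _ hρ') hr).1 hw⟩
  · rintro ⟨h1, h2⟩
    refine ⟨fun x _ s _ hx q _ hqp hqs => ?_, fun ρ' hB' t _ hρ' q _ hqp hqt => ?_⟩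
    · obtain ⟨r, hrq, ρ', t, h, hrt, hw⟩ := h1 x s hx q hqp hqs
      exact ⟨r, hP.mem_left hrq, hrq, ρ', hBp ρ hρ _ _ h, t, hP.mem_right hrt, h, hrt,
        (key x s ρ' r hx (hBp ρ hρ _ _ h) (hP.mem_left hrq)).2 hw⟩
    · obtain ⟨r, hrq, x, s, hx, hrs, hw⟩ := h2 ρ' t hρ' q hqp hqt
      exact ⟨r, hP.mem_left hrq, hrq, x, left_mem_sUnion_sUnion hx, s, hP.mem_right hrs, hx, hrs,
        (key x s ρ' r hx hB' (hP.mem_left hrq)).2 hw⟩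

theorem Df.exists_forcesEq {n : ℕ} {P : PosetData.{u}} (hP : P.IsPoset) [Fact (P.carrier ∈ M)]
    [Fact (P.rel ∈ M)] {τ : ZFSet.{u}} (hτ : τ ∈ M)
    {t s : (Fin n → ZFSet.{u}) → ZFSet.{u}} (ht : Tm M t) (hs : Tm M s) :
    Df M fun v => ∃ ρ w, ZFSet.pair ρ w ∈ τ ∧ P.Le (s v) w ∧ ForcesEq P (t v) ρ (s v) := by
  have : Fact (tc τ ∈ M) := ⟨tc_mem_model hτ⟩
  have : Fact (τ ∈ M) := ⟨hτ⟩
  have hi : ∀ {m : ℕ} {t : (Fin m → ZFSet.{u}) → ZFSet.{u}} [Tm M t],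
      Tm M fun v => ForcingLimit.forcedEqSet P (tc τ) (t v) :=
    fun {m t} ht => Tm.forcedEqSet hP (tc_transitive τ) ht
  refine Df.comp₂ (S := fun σ p => ∃ ρ w, ZFSet.pair ρ w ∈ τ ∧ P.Le p w ∧ ForcesEq P σ ρ p) ?_ ht hs
  refine Df.congr (S := fun v : Fin 2 → ZFSet.{u} => ∃ ρ, ρ ∈ tc τ ∧ ∃ t, t ∈ P.carrier ∧
    ZFSet.pair ρ t ∈ τ ∧ P.Le (v 1) t ∧ ZFSet.pair ρ (v 1) ∈ ForcingLimit.forcedEqSet P (tc τ) (v 0))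
    inferInstance fun v _ => ?_
  constructor
  · rintro ⟨ρ, hρ, t, ht, h, hrt, he⟩
    exact ⟨ρ, t, h, hrt, (pair_mem_forcedEqSet.1 he).2.2⟩
  · rintro ⟨ρ, t, h, hrt, he⟩
    exact ⟨ρ, left_mem_tc h, t, hP.mem_right hrt, h, hrt,
      pair_mem_forcedEqSet.2 ⟨left_mem_tc h, hP.mem_left hrt, he⟩⟩

theorem Df.forcesMem {n : ℕ} {P : PosetData.{u}} (hP : P.IsPoset) [Fact (P.carrier ∈ M)]
    [Fact (P.rel ∈ M)] {τ : ZFSet.{u}} (hτ : τ ∈ M)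
    {t s : (Fin n → ZFSet.{u}) → ZFSet.{u}} (ht : Tm M t) (hs : Tm M s) :
    Df M fun v => ForcesMem P (t v) τ (s v) := by
  refine Df.comp₂ (S := fun σ p => ForcesMem P σ τ p) ?_ ht hs
  have hi : ∀ {m : ℕ} {t s : (Fin m → ZFSet.{u}) → ZFSet.{u}} [Tm M t] [Tm M s],
      Df M fun v => ∃ ρ w, ZFSet.pair ρ w ∈ τ ∧ P.Le (s v) w ∧ ForcesEq P (t v) ρ (s v) :=
    fun {m t s} ht hs => Df.exists_forcesEq hP hτ ht hs
  refine Df.congr (S := fun v : Fin 2 → ZFSet.{u} => ∀ q, q ∈ P.carrier → P.Le q (v 1) →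
    ∃ r, r ∈ P.carrier ∧ (P.Le r q ∧ ∃ ρ t, ZFSet.pair ρ t ∈ τ ∧ P.Le r t ∧ ForcesEq P (v 0) ρ r))
    inferInstance fun v _ => ?_
  constructor
  · intro h q hq
    obtain ⟨r, -, h⟩ := h q (hP.mem_left hq) hq
    exact ⟨r, h⟩
  · intro h q _ hq
    obtain ⟨r, h⟩ := h q hq
    exact ⟨r, hP.mem_left h.1, h⟩

end Model

/-! ## Atomic forcing -/

section Atomic

variable {P : PosetData.{u}}

theorem forcesEq_mono (hP : P.IsPoset) {σ τ p q : ZFSet.{u}} (hqp : P.Le q p)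
    (h : ForcesEq P σ τ p) : ForcesEq P σ τ q := by
  rw [forcesEq_iff] at h ⊢
  exact ⟨fun x s hx r hrq => h.1 x s hx r (hP.trans _ _ _ hrq hqp),
    fun ρ t hρ r hrq => h.2 ρ t hρ r (hP.trans _ _ _ hrq hqp)⟩

theorem forcesEq_refl (hP : P.IsPoset) (σ p : ZFSet.{u}) : ForcesEq P σ σ p := by
  induction σ using tc_induction generalizing p with
  | h σ ih =>
    rw [forcesEq_iff]
    exact ⟨fun x s hx q _ hqs => ⟨q, hP.refl q (hP.mem_left hqs), x, s, hx, hqs,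
        ih x (left_mem_tc hx) q⟩,
      fun x s hx q _ hqs => ⟨q, hP.refl q (hP.mem_left hqs), x, s, hx, hqs,
        ih x (left_mem_tc hx) q⟩⟩

theorem forcesEq_symm {σ τ p : ZFSet.{u}} (h : ForcesEq P σ τ p) :
    ForcesEq P τ σ p := by
  induction σ using tc_induction generalizing τ p with
  | h σ ih =>
    rw [forcesEq_iff] at h ⊢
    refine ⟨fun ρ t hρ q hqp hqt => ?_, fun x s hx q hqp hqs => ?_⟩
    · obtain ⟨r, hrq, x, s, hx, hrs, h⟩ := h.2 ρ t hρ q hqp hqt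
      exact ⟨r, hrq, x, s, hx, hrs, ih x (left_mem_tc hx) h⟩
    · obtain ⟨r, hrq, ρ, t, hρ, hrt, h⟩ := h.1 x s hx q hqp hqs
      exact ⟨r, hrq, ρ, t, hρ, hrt, ih x (left_mem_tc hx) h⟩

theorem forcesEq_trans (hP : P.IsPoset) {σ τ υ p : ZFSet.{u}} (h : ForcesEq P σ τ p)
    (h' : ForcesEq P τ υ p) : ForcesEq P σ υ p := by
  induction σ using tc_induction generalizing τ υ p with
  | h σ ih =>
    rw [forcesEq_iff] at h h' ⊢
    refine ⟨fun x s hx q hqp hqs => ?_, fun κ w hκ q hqp hqw => ?_⟩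
    · obtain ⟨r, hrq, ρ, t, hρ, hrt, e⟩ := h.1 x s hx q hqp hqs
      obtain ⟨r', hr', κ, w, hκ, hrw, e'⟩ := h'.1 ρ t hρ r (hP.trans _ _ _ hrq hqp) hrt
      exact ⟨r', hP.trans _ _ _ hr' hrq, κ, w, hκ, hrw,
        ih x (left_mem_tc hx) (forcesEq_mono hP hr' e) e'⟩
    · obtain ⟨r, hrq, ρ, t, hρ, hrt, e'⟩ := h'.2 κ w hκ q hqp hqw
      obtain ⟨r', hr', x, s, hx, hrs, e⟩ := h.2 ρ t hρ r (hP.trans _ _ _ hrq hqp) hrt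
      exact ⟨r', hP.trans _ _ _ hr' hrq, x, s, hx, hrs,
        ih x (left_mem_tc hx) e (forcesEq_mono hP hr' e')⟩

theorem forcesEq_of_dense (hP : P.IsPoset) {σ τ p : ZFSet.{u}}
    (h : ∀ q, P.Le q p → ∃ r, P.Le r q ∧ ForcesEq P σ τ r) : ForcesEq P σ τ p := by
  rw [forcesEq_iff]
  refine ⟨fun x s hx q hqp hqs => ?_, fun ρ t hρ q hqp hqt => ?_⟩
  · obtain ⟨r, hrq, e⟩ := h q hqp
    obtain ⟨r', hr', h⟩ := (forcesEq_iff.1 e).1 x s hx r (hP.refl r (hP.mem_left hrq))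
      (hP.trans _ _ _ hrq hqs)
    exact ⟨r', hP.trans _ _ _ hr' hrq, h⟩
  · obtain ⟨r, hrq, e⟩ := h q hqp
    obtain ⟨r', hr', h⟩ := (forcesEq_iff.1 e).2 ρ t hρ r (hP.refl r (hP.mem_left hrq))
      (hP.trans _ _ _ hrq hqt)
    exact ⟨r', hP.trans _ _ _ hr' hrq, h⟩

theorem forcesMem_mono (hP : P.IsPoset) {σ τ p q : ZFSet.{u}} (hqp : P.Le q p)
    (h : ForcesMem P σ τ p) : ForcesMem P σ τ q :=
  fun r hr => h r (hP.trans _ _ _ hr hqp)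

theorem forcesMem_of_dense (hP : P.IsPoset) {σ τ p : ZFSet.{u}}
    (h : ∀ q, P.Le q p → ∃ r, P.Le r q ∧ ForcesMem P σ τ r) : ForcesMem P σ τ p := by
  intro q hq
  obtain ⟨r, hrq, h⟩ := h q hq
  obtain ⟨r', hr', h⟩ := h r (hP.refl r (hP.mem_left hrq))
  exact ⟨r', hP.trans _ _ _ hr' hrq, h⟩

theorem forcesMem_congr_left (hP : P.IsPoset) {σ σ' τ p : ZFSet.{u}} (e : ForcesEq P σ σ' p)
    (h : ForcesMem P σ τ p) : ForcesMem P σ' τ p := by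
  intro q hq
  obtain ⟨r, hrq, ρ, t, hρ, hrt, h⟩ := h q hq
  exact ⟨r, hrq, ρ, t, hρ, hrt, forcesEq_trans hP
    (forcesEq_symm (forcesEq_mono hP (hP.trans _ _ _ hrq hq) e)) h⟩

theorem forcesMem_congr_right (hP : P.IsPoset) {σ τ τ' p : ZFSet.{u}} (e : ForcesEq P τ τ' p)
    (h : ForcesMem P σ τ p) : ForcesMem P σ τ' p := by
  intro q hq
  obtain ⟨r, hrq, ρ, t, hρ, hrt, h⟩ := h q hq
  obtain ⟨r', hr', κ, w, hκ, hrw, e'⟩ :=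
    (forcesEq_iff.1 e).1 ρ t hρ r (hP.trans _ _ _ hrq hq) hrt
  exact ⟨r', hP.trans _ _ _ hr' hrq, κ, w, hκ, hrw, forcesEq_trans hP (forcesEq_mono hP hr' h) e'⟩

theorem forcesMem_of_pair_mem (hP : P.IsPoset) {ρ τ t p : ZFSet.{u}} (h : ZFSet.pair ρ t ∈ τ)
    (hp : P.Le p t) : ForcesMem P ρ τ p := fun q hq =>
  ⟨q, hP.refl q (hP.mem_left hq), ρ, t, h, hP.trans _ _ _ hq hp, forcesEq_refl hP _ _⟩

theorem forcesMem_check (hP : P.IsPoset) {σ x p : ZFSet.{u}} : ForcesMem P σ (check P x) p ↔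
    ∀ q, P.Le q p → ∃ r, P.Le r q ∧ ∃ y ∈ x, ForcesEq P σ (check P y) r := by
  refine forall₂_congr fun q _ => exists_congr fun r => and_congr_right fun hrq => ?_
  constructor
  · rintro ⟨ρ, t, h, _, e⟩
    obtain ⟨y, hy, p, _, h⟩ := mem_check.1 h
    obtain ⟨rfl, rfl⟩ := ZFSet.pair_inj.1 h
    exact ⟨y, hy, e⟩
  · rintro ⟨y, hy, e⟩
    have hr := hP.mem_left hrq
    exact ⟨_, r, mem_check.2 ⟨y, hy, r, hr, rfl⟩, hP.refl r hr, e⟩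

theorem forcesMem_check_of_mem (hP : P.IsPoset) {x y : ZFSet.{u}} (h : y ∈ x) (p : ZFSet.{u}) :
    ForcesMem P (check P y) (check P x) p :=
  (forcesMem_check hP).2 fun q hq => ⟨q, hP.refl q (hP.mem_left hq), y, h, forcesEq_refl hP _ _⟩

/-- Any member of `x` is forced into the check name of `y`, where some extension decides which
member of `y` it equals; induction then makes the two members literally equal. -/
theorem eq_of_forcesEq_check (hP : P.IsPoset) {x y p : ZFSet.{u}} (hp : p ∈ P.carrier)
    (h : ForcesEq P (check P x) (check P y) p) : x = y := by
  induction x using ZFSet.inductionOn generalizing y p with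
  | h x ih =>
    ext z
    constructor
    · intro hz
      obtain ⟨r, hr, w, hw, e⟩ := (forcesMem_check hP).1 (forcesMem_congr_right hP h
        (forcesMem_check_of_mem hP hz p)) p (hP.refl p hp)
      rwa [ih z hz (hP.mem_left hr) e]
    · intro hz
      obtain ⟨r, hr, w, hw, e⟩ := (forcesMem_check hP).1 (forcesMem_congr_right hP (forcesEq_symm h)
        (forcesMem_check_of_mem hP hz p)) p (hP.refl p hp)
      rwa [← ih w hw (hP.mem_left hr) (forcesEq_symm e)]

theorem isName_check (x : ZFSet.{u}) : IsName P (check P x) := by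
  induction x using ZFSet.inductionOn with
  | h x ih =>
    refine ⟨_, fun z hz => ?_, fun σ p h => ?_⟩
    · obtain ⟨y, _, p, hp, rfl⟩ := mem_check.1 hz
      exact ⟨_, p, rfl, hp⟩
    · obtain ⟨y, hy, q, hq, h⟩ := mem_check.1 h
      rw [(ZFSet.pair_inj.1 h).1]
      exact ih y hy

theorem IsName.of_pair_mem {σ τ p : ZFSet.{u}} (h : IsName P τ) (hσ : ZFSet.pair σ p ∈ τ) :
    IsName P σ := by
  cases h with
  | mk _ _ names => exact names σ p hσ

theorem IsName.mono {Q : PosetData.{u}} (hPQ : P.carrier ⊆ Q.carrier) {τ : ZFSet.{u}}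
    (h : IsName P τ) : IsName Q τ := by
  induction h with
  | mk τ pairs names ih =>
    refine ⟨_, fun x hx => ?_, ih⟩
    obtain ⟨σ, p, rfl, hp⟩ := pairs x hx
    exact ⟨σ, p, rfl, hPQ hp⟩

/-! ### Names for pairs -/

/-- The canonical name of the unordered pair `{σ, τ}`. -/
def upName (P : PosetData.{u}) (σ τ : ZFSet.{u}) : ZFSet.{u} := ZFSet.prod {σ, τ} P.carrier

/-- The canonical name of the ordered pair `⟨σ, τ⟩`. -/
def opName (P : PosetData.{u}) (σ τ : ZFSet.{u}) : ZFSet.{u} :=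
  upName P (upName P σ σ) (upName P σ τ)

theorem check_pair (x y : ZFSet.{u}) :
    check P (ZFSet.pair x y) = opName P (check P x) (check P y) := by
  have h : ∀ x y, check P {x, y} = upName P (check P x) (check P y) := by
    intro x y
    ext z
    simp only [mem_check, upName, ZFSet.mem_prod, ZFSet.mem_pair]
    constructor
    · rintro ⟨w, rfl | rfl, p, hp, rfl⟩
      exacts [⟨_, .inl rfl, p, hp, rfl⟩, ⟨_, .inr rfl, p, hp, rfl⟩]
    · rintro ⟨w, rfl | rfl, p, hp, rfl⟩
      exacts [⟨_, .inl rfl, p, hp, rfl⟩, ⟨_, .inr rfl, p, hp, rfl⟩]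
  rw [ZFSet.pair, h, ← ZFSet.pair_eq_singleton x, h, h, opName]

theorem forcesMem_upName (hP : P.IsPoset) {ρ σ τ p : ZFSet.{u}} : ForcesMem P ρ (upName P σ τ) p ↔
    ∀ q, P.Le q p → ∃ r, P.Le r q ∧ (ForcesEq P ρ σ r ∨ ForcesEq P ρ τ r) := by
  refine forall₂_congr fun q _ => exists_congr fun r => and_congr_right fun hrq => ?_
  simp only [upName, ZFSet.pair_mem_prod, ZFSet.mem_pair]
  have hr := hP.mem_left hrq
  constructor
  · rintro ⟨ρ, t, ⟨rfl | rfl, _⟩, _, e⟩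
    exacts [.inl e, .inr e]
  · rintro (e | e)
    exacts [⟨σ, r, ⟨.inl rfl, hr⟩, hP.refl r hr, e⟩, ⟨τ, r, ⟨.inr rfl, hr⟩, hP.refl r hr, e⟩]

theorem isName_upName {σ τ : ZFSet.{u}} (hσ : IsName P σ) (hτ : IsName P τ) :
    IsName P (upName P σ τ) := by
  refine ⟨_, fun z hz => ?_, fun ρ p h => ?_⟩
  · obtain ⟨a, _, p, hp, rfl⟩ := ZFSet.mem_prod.1 hz
    exact ⟨a, p, rfl, hp⟩
  · rcases ZFSet.mem_pair.1 (ZFSet.pair_mem_prod.1 h).1 with rfl | rfl <;> assumption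

theorem upName_congr (hP : P.IsPoset) {σ τ σ' τ' p : ZFSet.{u}} (h : ForcesEq P σ σ' p)
    (h' : ForcesEq P τ τ' p) : ForcesEq P (upName P σ τ) (upName P σ' τ') p := by
  have key : ∀ {σ τ σ' τ'}, ForcesEq P σ σ' p → ForcesEq P τ τ' p → ∀ x s q,
      ZFSet.pair x s ∈ upName P σ τ → P.Le q p → ∃ ρ, ZFSet.pair ρ q ∈ upName P σ' τ' ∧
        ForcesEq P x ρ q := by
    intro σ τ σ' τ' h h' x s q hx hq
    simp only [upName, ZFSet.pair_mem_prod, ZFSet.mem_pair] at hx ⊢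
    rcases hx.1 with rfl | rfl
    exacts [⟨σ', ⟨.inl rfl, hP.mem_left hq⟩, forcesEq_mono hP hq h⟩,
      ⟨τ', ⟨.inr rfl, hP.mem_left hq⟩, forcesEq_mono hP hq h'⟩]
  rw [forcesEq_iff]
  refine ⟨fun x s hx q hqp _ => ?_, fun x s hx q hqp _ => ?_⟩
  · obtain ⟨ρ, hρ, e⟩ := key h h' x s q hx hqp
    have hq := hP.refl q (hP.mem_left hqp)
    exact ⟨q, hq, ρ, q, hρ, hq, e⟩
  · obtain ⟨ρ, hρ, e⟩ := key (forcesEq_symm h) (forcesEq_symm h') x s q hx hqp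
    have hq := hP.refl q (hP.mem_left hqp)
    exact ⟨q, hq, ρ, q, hρ, hq, forcesEq_symm e⟩

theorem opName_congr (hP : P.IsPoset) {σ τ σ' τ' p : ZFSet.{u}} (h : ForcesEq P σ σ' p)
    (h' : ForcesEq P τ τ' p) : ForcesEq P (opName P σ τ) (opName P σ' τ') p :=
  upName_congr hP (upName_congr hP h h) (upName_congr hP h h')

/-- Only names in `N` need testing, since the names that enter `σ` or `τ` are themselves in `N`. -/
theorem forcesEq_ext (hP : P.IsPoset) {N : Set ZFSet.{u}} [Fact (IsTransitiveModelZFC N)]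
    {σ τ p : ZFSet.{u}} (hσ : σ ∈ N) (hσ' : IsName P σ) (hτ : τ ∈ N) (hτ' : IsName P τ)
    (h : ∀ ρ ∈ N, IsName P ρ → ∀ q, P.Le q p → (ForcesMem P ρ σ q ↔ ForcesMem P ρ τ q)) :
    ForcesEq P σ τ p := by
  have inN : ∀ {x s υ}, υ ∈ N → ZFSet.pair x s ∈ υ → x ∈ N := fun hυ hx =>
    mem_model (tc_mem_model hυ) (left_mem_tc hx)
  rw [forcesEq_iff]
  refine ⟨fun x s hx q hqp hqs => ?_, fun x s hx q hqp hqs => ?_⟩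
  · exact (h x (inN hσ hx) (hσ'.of_pair_mem hx) q hqp).1 (forcesMem_of_pair_mem hP hx hqs) q
      (hP.refl q (hP.mem_left hqp))
  · obtain ⟨r, hrq, ρ, t, hρ, hrt, e⟩ := (h x (inN hτ hx) (hτ'.of_pair_mem hx) q hqp).2
      (forcesMem_of_pair_mem hP hx hqs) q (hP.refl q (hP.mem_left hqp))
    exact ⟨r, hrq, ρ, t, hρ, hrt, forcesEq_symm e⟩

end Atomic

/-! ## The forcing relation for formulas -/

section Formulas

variable {P : PosetData.{u}} {N : Set ZFSet.{u}} {n : ℕ}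

theorem forces_mono (hP : P.IsPoset) {φ : setLang.BoundedFormula Empty n}
    {xs : Fin n → ZFSet.{u}} {p q : ZFSet.{u}} (hqp : P.Le q p) (h : Forces N P φ xs p) :
    Forces N P φ xs q := by
  induction φ generalizing p q with
  | falsum => exact h
  | equal s t => exact forcesEq_mono hP hqp h
  | rel R ts =>
    cases R
    exact forcesMem_mono hP hqp h
  | imp φ ψ _ _ => exact fun r hr => h r (hP.trans _ _ _ hr hqp)
  | all φ ih => exact fun τ hτ hτ' => ih hqp (h τ hτ hτ')

/-- Atomic formulas have this property by their density clauses, and `⊥`, `→`, `∀` preserve it; it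
is what recovers the usual clauses for `∧`, `∨`, `↔` from their codings. -/
theorem forces_of_dense (hP : P.IsPoset) {φ : setLang.BoundedFormula Empty n}
    {xs : Fin n → ZFSet.{u}} {p : ZFSet.{u}} (hp : p ∈ P.carrier)
    (h : ∀ q, P.Le q p → ∃ r, P.Le r q ∧ Forces N P φ xs r) : Forces N P φ xs p := by
  induction φ generalizing p with
  | falsum =>
    obtain ⟨r, -, hr⟩ := h p (hP.refl p hp)
    exact hr
  | equal s t => exact forcesEq_of_dense hP h
  | rel R ts =>
    cases R
    exact forcesMem_of_dense hP h
  | imp φ ψ _ ih =>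
    intro q hq hφ
    refine ih (hP.mem_left hq) fun q' hq' => ?_
    obtain ⟨r, hr, h⟩ := h q' (hP.trans _ _ _ hq' hq)
    exact ⟨r, hr, h r (hP.refl r (hP.mem_left hr))
      (forces_mono hP (hP.trans _ _ _ hr hq') hφ)⟩
  | all φ ih =>
    intro τ hτ hτ'
    refine ih hp fun q hq => ?_
    obtain ⟨r, hr, h⟩ := h q hq
    exact ⟨r, hr, h τ hτ hτ'⟩

variable {φ ψ : setLang.BoundedFormula Empty n} {xs : Fin n → ZFSet.{u}} {p : ZFSet.{u}}

theorem forces_imp : Forces N P (φ.imp ψ) xs p ↔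
    ∀ q, P.Le q p → Forces N P φ xs q → Forces N P ψ xs q := Iff.rfl

/-! ### Forcing clauses for defined connectives and for the set-theoretic abbreviations -/

theorem forces_inf (hP : P.IsPoset) (hp : p ∈ P.carrier) :
    Forces N P (φ ⊓ ψ) xs p ↔ Forces N P φ xs p ∧ Forces N P ψ xs p := by
  change (∀ q, P.Le q p → ¬ ∀ r, P.Le r q → Forces N P φ xs r → ∀ s, P.Le s r →
    ¬ Forces N P ψ xs s) ↔ _
  constructor
  · intro h
    constructor
    · refine forces_of_dense hP hp fun q hq => ?_
      have := h q hq
      push Not at this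
      obtain ⟨r, hr, h, -⟩ := this
      exact ⟨r, hr, h⟩
    · refine forces_of_dense hP hp fun q hq => ?_
      have := h q hq
      push Not at this
      obtain ⟨r, hr, h, s, hs, h'⟩ := this
      exact ⟨s, hP.trans _ _ _ hs hr, h'⟩
  · rintro ⟨h1, h2⟩ q hq h
    have hqq := hP.refl q (hP.mem_left hq)
    exact h q hqq (forces_mono hP hq h1) q hqq (forces_mono hP hq h2)

theorem forces_sup (hP : P.IsPoset) : Forces N P (φ ⊔ ψ) xs p ↔
    ∀ q, P.Le q p → ∃ r, P.Le r q ∧ (Forces N P φ xs r ∨ Forces N P ψ xs r) := by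
  change (∀ q, P.Le q p → (∀ r, P.Le r q → ¬ Forces N P φ xs r) → Forces N P ψ xs q) ↔ _
  constructor
  · intro h q hq
    by_cases h' : ∃ r, P.Le r q ∧ Forces N P φ xs r
    · obtain ⟨r, hr, h'⟩ := h'
      exact ⟨r, hr, .inl h'⟩
    · exact ⟨q, hP.refl q (hP.mem_left hq), .inr (h q hq fun r hr hφ => h' ⟨r, hr, hφ⟩)⟩
  · intro h q hq hno
    refine forces_of_dense hP (hP.mem_left hq) fun q' hq' => ?_
    obtain ⟨r, hr, h | h⟩ := h q' (hP.trans _ _ _ hq' hq)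
    · exact absurd h (hno r (hP.trans _ _ _ hr hq'))
    · exact ⟨r, hr, h⟩

theorem forces_iff (hP : P.IsPoset) (hp : p ∈ P.carrier) : Forces N P (φ.iff ψ) xs p ↔
    ∀ q, P.Le q p → (Forces N P φ xs q ↔ Forces N P ψ xs q) := by
  rw [BoundedFormula.iff, forces_inf hP hp, forces_imp, forces_imp]
  exact ⟨fun h q hq => ⟨h.1 q hq, h.2 q hq⟩, fun h => ⟨fun q hq => (h q hq).1, fun q hq => (h q hq).2⟩⟩

theorem forces_ex {φ : setLang.BoundedFormula Empty (n + 1)} :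
    Forces N P φ.ex xs p ↔ ∀ q, P.Le q p → ∃ r, P.Le r q ∧
      ∃ τ ∈ N, IsName P τ ∧ Forces N P φ (Fin.snoc xs τ : Fin (n + 1) → ZFSet.{u}) r := by
  change (∀ q, P.Le q p → ¬ ∀ τ ∈ N, IsName P τ → ∀ r, P.Le r q →
    ¬ Forces N P φ (Fin.snoc xs τ : Fin (n + 1) → ZFSet.{u}) r) ↔ _
  refine forall₂_congr fun q _ => ?_
  push Not
  constructor
  · rintro ⟨τ, hτ, hτ', r, hr, h⟩
    exact ⟨r, hr, τ, hτ, hτ', h⟩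
  · rintro ⟨r, hr, τ, hτ, hτ', h⟩
    exact ⟨τ, hτ, hτ', r, hr, h⟩

theorem forces_memF {i j : Fin n} :
    Forces N P (memF i j) xs p ↔ ForcesMem P (xs i) (xs j) p := Iff.rfl

theorem forces_eqF {i j : Fin n} :
    Forces N P (eqF i j) xs p ↔ ForcesEq P (xs i) (xs j) p := Iff.rfl

theorem forces_allIn {i : Fin n} {φ : setLang.BoundedFormula Empty (n + 1)} :
    Forces N P (allIn i φ) xs p ↔ ∀ τ ∈ N, IsName P τ → ∀ q, P.Le q p → ForcesMem P τ (xs i) q →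
      Forces N P φ (Fin.snoc xs τ : Fin (n + 1) → ZFSet.{u}) q := by
  refine forall₃_congr fun τ _ _ => forall₂_congr fun q _ => ?_
  rw [forces_memF, Fin.snoc_last, Fin.snoc_castSucc]

theorem forces_exIn (hP : P.IsPoset) {i : Fin n} {φ : setLang.BoundedFormula Empty (n + 1)} :
    Forces N P (exIn i φ) xs p ↔ ∀ q, P.Le q p → ∃ r, P.Le r q ∧ ∃ τ ∈ N, IsName P τ ∧
      ForcesMem P τ (xs i) r ∧ Forces N P φ (Fin.snoc xs τ : Fin (n + 1) → ZFSet.{u}) r := by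
  rw [exIn, forces_ex]
  refine forall₂_congr fun q _ => exists_congr fun r => and_congr_right fun hr =>
    exists_congr fun τ => and_congr_right fun _ => and_congr_right fun _ => ?_
  rw [forces_inf hP (hP.mem_left hr), forces_memF, Fin.snoc_last, Fin.snoc_castSucc]

theorem forces_subsetF {i j : Fin n} : Forces N P (subsetF i j) xs p ↔
    ∀ τ ∈ N, IsName P τ → ∀ q, P.Le q p → ForcesMem P τ (xs i) q → ForcesMem P τ (xs j) q := by
  rw [subsetF, forces_allIn]
  simp only [forces_memF, Fin.snoc_last, Fin.snoc_castSucc]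

theorem upName_mem_model [Fact (IsTransitiveModelZFC N)] [Fact (P.carrier ∈ N)] {σ τ : ZFSet.{u}}
    (hσ : σ ∈ N) (hτ : τ ∈ N) : upName P σ τ ∈ N := by
  have : Fact (σ ∈ N) := ⟨hσ⟩
  have : Fact (τ ∈ N) := ⟨hτ⟩
  unfold upName
  exact Tm.mem₀ inferInstance

theorem forces_upairF [Fact (IsTransitiveModelZFC N)] [Fact (P.carrier ∈ N)] (hP : P.IsPoset)
    (hp : p ∈ P.carrier) (hxs : ∀ i, xs i ∈ N ∧ IsName P (xs i)) {k i j : Fin n} :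
    Forces N P (upairF k i j) xs p ↔ ForcesEq P (xs k) (upName P (xs i) (xs j)) p := by
  have h1 : Forces N P (upairF k i j) xs p ↔ ∀ τ ∈ N, IsName P τ → ∀ q, P.Le q p →
      (ForcesMem P τ (xs k) q ↔ ForcesMem P τ (upName P (xs i) (xs j)) q) := by
    refine forall₃_congr fun τ _ _ => ?_
    rw [forces_iff hP hp]
    refine forall₂_congr fun q _ => ?_
    rw [forces_sup hP, forcesMem_upName hP]
    simp only [forces_memF, forces_eqF, Fin.snoc_last, Fin.snoc_castSucc]
  rw [h1]
  constructor
  · exact forcesEq_ext hP (hxs k).1 (hxs k).2 (upName_mem_model (hxs i).1 (hxs j).1)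
      (isName_upName (hxs i).2 (hxs j).2)
  · intro e τ _ _ q hq
    have e := forcesEq_mono hP hq e
    exact ⟨forcesMem_congr_right hP e, forcesMem_congr_right hP (forcesEq_symm e)⟩

theorem forces_pairF [Fact (IsTransitiveModelZFC N)] [Fact (P.carrier ∈ N)] (hP : P.IsPoset)
    (hp : p ∈ P.carrier) (hxs : ∀ i, xs i ∈ N ∧ IsName P (xs i)) {k i j : Fin n} :
    Forces N P (pairF k i j) xs p ↔ ForcesEq P (xs k) (opName P (xs i) (xs j)) p := by
  have h1 : Forces N P (pairF k i j) xs p ↔ ∀ τ ∈ N, IsName P τ → ∀ q, P.Le q p →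
      (ForcesMem P τ (xs k) q ↔ ForcesMem P τ (opName P (xs i) (xs j)) q) := by
    refine forall₃_congr fun τ hτ hτ' => ?_
    rw [forces_iff hP hp]
    refine forall₂_congr fun q hq => ?_
    rw [forces_sup hP, opName, forcesMem_upName hP]
    have hxs' : ∀ i, (Fin.snoc xs τ : Fin (n + 1) → ZFSet.{u}) i ∈ N ∧
        IsName P ((Fin.snoc xs τ : Fin (n + 1) → ZFSet.{u}) i) := by
      refine Fin.lastCases ?_ fun i => ?_
      · rw [Fin.snoc_last]; exact ⟨hτ, hτ'⟩
      · rw [Fin.snoc_castSucc]; exact hxs i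
    refine iff_congr ?_ (forall₂_congr fun q' _ => exists_congr fun r => and_congr_right fun hr => ?_)
    · simp only [forces_memF, Fin.snoc_last, Fin.snoc_castSucc]
    · rw [forces_upairF hP (hP.mem_left hr) hxs', forces_upairF hP (hP.mem_left hr) hxs']
      simp only [Fin.snoc_last, Fin.snoc_castSucc]
  rw [h1]
  constructor
  · exact forcesEq_ext hP (hxs k).1 (hxs k).2 (upName_mem_model
      (upName_mem_model (hxs i).1 (hxs i).1) (upName_mem_model (hxs i).1 (hxs j).1))
      (isName_upName (isName_upName (hxs i).2 (hxs i).2) (isName_upName (hxs i).2 (hxs j).2))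
  · intro e τ _ _ q hq
    have e := forcesEq_mono hP hq e
    exact ⟨forcesMem_congr_right hP e, forcesMem_congr_right hP (forcesEq_symm e)⟩

end Formulas

/-! ## Names for reals and the forced statement `c ⊏̸ h` -/

theorem snoc_vecCons {α : Type*} {n : ℕ} (a c : α) (v : Fin n → α) :
    (Fin.snoc (Matrix.vecCons a v) c : Fin (n + 2) → α) = Matrix.vecCons a (Fin.snoc v c) :=
  (Fin.cons_snoc_eq_snoc_cons (β := α) a v c).symm

theorem snoc_vecEmpty {α : Type*} (c : α) : (Fin.snoc ![] c : Fin 1 → α) = ![c] := by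
  ext i
  obtain rfl : i = Fin.last 0 := Fin.fin_one_eq_zero i
  rw [Fin.snoc_last]
  rfl

theorem names_vecCons {P : PosetData.{u}} {N : Set ZFSet.{u}} {n : ℕ} {a : ZFSet.{u}}
    {v : Fin n → ZFSet.{u}} (ha : a ∈ N ∧ IsName P a) (hv : ∀ i, v i ∈ N ∧ IsName P (v i)) :
    ∀ i, (Matrix.vecCons a v : Fin (n + 1) → ZFSet.{u}) i ∈ N ∧
      IsName P ((Matrix.vecCons a v : Fin (n + 1) → ZFSet.{u}) i) :=
  Fin.cases ha hv

theorem names_vecEmpty {P : PosetData.{u}} {N : Set ZFSet.{u}} :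
    ∀ i, (![] : Fin 0 → ZFSet.{u}) i ∈ N ∧ IsName P ((![] : Fin 0 → ZFSet.{u}) i) :=
  fun i => i.elim0

theorem forces_ex_intro {P : PosetData.{u}} {N : Set ZFSet.{u}} {n : ℕ}
    {φ : setLang.BoundedFormula Empty (n + 1)} {xs : Fin n → ZFSet.{u}}
    {p τ : ZFSet.{u}} (hP : P.IsPoset) (hτ : τ ∈ N ∧ IsName P τ)
    (h : Forces N P φ (Fin.snoc xs τ : Fin (n + 1) → ZFSet.{u}) p) : Forces N P φ.ex xs p :=
  forces_ex.2 fun q hq => ⟨q, hP.refl q (hP.mem_left hq), τ, hτ.1, hτ.2, forces_mono hP hq h⟩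

section Names

variable {P : PosetData.{u}} {N : Set ZFSet.{u}} [hN : Fact (IsTransitiveModelZFC N)]
  [hPN : Fact (P.carrier ∈ N)]

theorem check_mem_model {x : ZFSet.{u}} (hx : x ∈ N) : check P x ∈ N := by
  have : Fact (x ∈ N) := ⟨hx⟩
  exact Tm.mem₀ inferInstance

theorem mem_model_of_mem_omega {x : ZFSet.{u}} (hx : x ∈ ZFSet.omega) : x ∈ N :=
  mem_model omega_mem_model hx

theorem check_name {x : ZFSet.{u}} (hx : x ∈ N) : check P x ∈ N ∧ IsName P (check P x) :=
  ⟨check_mem_model hx, isName_check x⟩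

/-- Successive extensions decide the inner pair and then its two components as members of check
names; injectivity of pairing identifies the decided values with `a` and `b`. -/
theorem exists_forcesEq_of_opName (hP : P.IsPoset) {a b σ τ p : ZFSet.{u}} (hp : p ∈ P.carrier)
    (h : ForcesEq P (check P (ZFSet.pair a b)) (opName P σ τ) p) :
    ∃ r, P.Le r p ∧ ForcesEq P σ (check P a) r ∧ ForcesEq P τ (check P b) r := by
  have hup : ForcesMem P (upName P σ τ) (opName P σ τ) p := (forcesMem_upName hP).2 fun q hq =>
    ⟨q, hP.refl q (hP.mem_left hq), .inr (forcesEq_refl hP _ _)⟩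
  obtain ⟨r₁, hr₁, u, hu, e₁⟩ := (forcesMem_check hP).1
    (forcesMem_congr_right hP (forcesEq_symm h) hup) p (hP.refl p hp)
  obtain ⟨r₂, hr₂, a', ha', e₂⟩ := (forcesMem_check hP).1 (forcesMem_congr_right hP e₁
    ((forcesMem_upName hP).2 fun q hq =>
      ⟨q, hP.refl q (hP.mem_left hq), .inl (forcesEq_refl hP σ _)⟩)) r₁ (hP.refl _ (hP.mem_left hr₁))
  obtain ⟨r₃, hr₃, b', hb', e₃⟩ := (forcesMem_check hP).1 (forcesMem_congr_right hP
    (forcesEq_mono hP hr₂ e₁) ((forcesMem_upName hP).2 fun q hq =>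
      ⟨q, hP.refl q (hP.mem_left hq), .inr (forcesEq_refl hP τ _)⟩)) r₂ (hP.refl _ (hP.mem_left hr₂))
  have hr₃p : P.Le r₃ p := hP.trans _ _ _ hr₃ (hP.trans _ _ _ hr₂ hr₁)
  have e₂' := forcesEq_mono hP hr₃ e₂
  have e : ForcesEq P (check P (ZFSet.pair a b)) (check P (ZFSet.pair a' b')) r₃ := by
    rw [check_pair a' b']
    exact forcesEq_trans hP (forcesEq_mono hP hr₃p h) (opName_congr hP e₂' e₃)
  obtain ⟨rfl, rfl⟩ := ZFSet.pair_inj.1 (eq_of_forcesEq_check hP (hP.mem_left hr₃) e)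
  exact ⟨r₃, hr₃p, e₂', e₃⟩

theorem real_name_total (hP : P.IsPoset) {h : ZFSet.{u}} (hh : IsRealName N P h) {p k : ZFSet.{u}}
    (hp : p ∈ P.carrier) (hk : k ∈ ZFSet.omega) :
    ∃ q, P.Le q p ∧ ∃ m ∈ ZFSet.omega, ForcesMem P (check P (ZFSet.pair k m)) h q := by
  obtain ⟨hhN, hhP, hreal⟩ := hh
  have hω : check P ZFSet.omega ∈ N ∧ IsName P (check P ZFSet.omega) := check_name omega_mem_model
  have hkN : check P k ∈ N ∧ IsName P (check P k) := check_name (mem_model_of_mem_omega hk)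
  have h1 := hreal p hp
  rw [isRealF, forces_inf hP hp, forces_inf hP hp] at h1
  have h2 := (forces_exIn hP).1 (forces_allIn.1 h1.2.1 (check P k) hkN.1 hkN.2 p (hP.refl p hp)
    (forcesMem_check_of_mem hP hk p)) p (hP.refl p hp)
  obtain ⟨q, hq, τ, hτ, hτ', hτω, h3⟩ := h2
  obtain ⟨r, hr, υ, hυ, hυ', hυh, h4⟩ := (forces_exIn hP).1 h3 q (hP.refl q (hP.mem_left hq))
  simp only [snoc_vecCons, snoc_vecEmpty] at h4 hυh hτω
  rw [forces_pairF hP (hP.mem_left hr) (names_vecCons ⟨hhN, hhP⟩ (names_vecCons hω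
    (names_vecCons hkN (names_vecCons ⟨hτ, hτ'⟩ (names_vecCons ⟨hυ, hυ'⟩ names_vecEmpty)))))]
    at h4
  have h4 : ForcesEq P υ (opName P (check P k) τ) r := h4
  have hυh : ForcesMem P υ h r := hυh
  obtain ⟨s, hs, m, hm, e⟩ := (forcesMem_check hP).1 (show ForcesMem P τ (check P ZFSet.omega) q
    from hτω) r hr
  refine ⟨s, hP.trans _ _ _ hs (hP.trans _ _ _ hr hq), m, hm, ?_⟩
  refine forcesMem_congr_left hP ?_ (forcesMem_mono hP hs hυh)
  rw [check_pair]
  exact forcesEq_trans hP (forcesEq_mono hP hs h4) (opName_congr hP (forcesEq_refl hP _ _) e)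

theorem real_name_unique (hP : P.IsPoset) {h : ZFSet.{u}} (hh : IsRealName N P h)
    {p k m m' : ZFSet.{u}} (hp : p ∈ P.carrier) (hk : k ∈ ZFSet.omega) (hm : m ∈ ZFSet.omega)
    (hm' : m' ∈ ZFSet.omega) (h1 : ForcesMem P (check P (ZFSet.pair k m)) h p)
    (h2 : ForcesMem P (check P (ZFSet.pair k m')) h p) : m = m' := by
  obtain ⟨hhN, hhP, hreal⟩ := hh
  have hω : check P ZFSet.omega ∈ N ∧ IsName P (check P ZFSet.omega) := check_name omega_mem_model
  have nm : ∀ {x}, x ∈ ZFSet.omega → check P x ∈ N ∧ IsName P (check P x) :=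
    fun hx => check_name (mem_model_of_mem_omega hx)
  have nmp : ∀ {x y}, x ∈ ZFSet.omega → y ∈ ZFSet.omega →
      check P (ZFSet.pair x y) ∈ N ∧ IsName P (check P (ZFSet.pair x y)) := by
    intro x y hx hy
    have : Fact (x ∈ N) := ⟨mem_model_of_mem_omega hx⟩
    have : Fact (y ∈ N) := ⟨mem_model_of_mem_omega hy⟩
    exact check_name (Tm.mem₀ inferInstance)
  have h0 := hreal p hp
  rw [isRealF, forces_inf hP hp, forces_inf hP hp] at h0
  have hpp := hP.refl p hp
  have h3 := forces_allIn.1 (forces_allIn.1 (forces_allIn.1 (forces_allIn.1 (forces_allIn.1 h0.2.2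
    _ (nm hk).1 (nm hk).2 p hpp (forcesMem_check_of_mem hP hk p))
    _ (nm hm).1 (nm hm).2 p hpp (forcesMem_check_of_mem hP hm p))
    _ (nm hm').1 (nm hm').2 p hpp (forcesMem_check_of_mem hP hm' p))
    _ (nmp hk hm).1 (nmp hk hm).2 p hpp h1)
    _ (nmp hk hm').1 (nmp hk hm').2 p hpp h2
  simp only [snoc_vecCons, snoc_vecEmpty] at h3
  have hxs := names_vecCons ⟨hhN, hhP⟩ (names_vecCons hω (names_vecCons (nm hk)
    (names_vecCons (nm hm) (names_vecCons (nm hm') (names_vecCons (nmp hk hm)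
    (names_vecCons (nmp hk hm') names_vecEmpty))))))
  have h4 := h3 p hpp ((forces_pairF hP hp hxs).2 ?_) p hpp ((forces_pairF hP hp hxs).2 ?_)
  · exact eq_of_forcesEq_check hP hp h4
  · change ForcesEq P (check P (ZFSet.pair k m)) (opName P (check P k) (check P m)) p
    rw [check_pair]
    exact forcesEq_refl hP _ _
  · change ForcesEq P (check P (ZFSet.pair k m')) (opName P (check P k) (check P m')) p
    rw [check_pair]
    exact forcesEq_refl hP _ _

/-- A name for a member of `ω` densely equals a check name, so each clause of `isRealF` need only be
verified for check names of numbers and of pairs of numbers. -/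
theorem isRealName_intro (hP : P.IsPoset) {g : ZFSet.{u}} (hg : g ∈ N) (hg' : IsName P g)
    (hrel : ∀ τ p, ForcesMem P τ g p → ∀ q, P.Le q p → ∃ r, P.Le r q ∧ ∃ k ∈ ZFSet.omega,
      ∃ m ∈ ZFSet.omega, ForcesEq P τ (check P (ZFSet.pair k m)) r)
    (htot : ∀ p ∈ P.carrier, ∀ k ∈ ZFSet.omega, ∃ q, P.Le q p ∧ ∃ m ∈ ZFSet.omega,
      ForcesMem P (check P (ZFSet.pair k m)) g q)
    (huniq : ∀ p ∈ P.carrier, ∀ k ∈ ZFSet.omega, ∀ m ∈ ZFSet.omega, ∀ m' ∈ ZFSet.omega,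
      ForcesMem P (check P (ZFSet.pair k m)) g p → ForcesMem P (check P (ZFSet.pair k m')) g p →
        m = m') : IsRealName N P g := by
  have hω : check P ZFSet.omega ∈ N ∧ IsName P (check P ZFSet.omega) := check_name omega_mem_model
  have nm : ∀ {x}, x ∈ ZFSet.omega → check P x ∈ N ∧ IsName P (check P x) :=
    fun hx => check_name (mem_model_of_mem_omega hx)
  have nmp : ∀ {x y}, x ∈ ZFSet.omega → y ∈ ZFSet.omega →
      check P (ZFSet.pair x y) ∈ N ∧ IsName P (check P (ZFSet.pair x y)) := by
    intro x y hx hy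
    have : Fact (x ∈ N) := ⟨mem_model_of_mem_omega hx⟩
    have : Fact (y ∈ N) := ⟨mem_model_of_mem_omega hy⟩
    exact check_name (Tm.mem₀ inferInstance)
  refine ⟨hg, hg', fun p hp => ?_⟩
  rw [isRealF, forces_inf hP hp, forces_inf hP hp]
  refine ⟨?_, ?_, ?_⟩
  · rw [forces_allIn]
    intro τ hτ hτ' q hq hmem
    rw [forces_exIn hP]
    intro q' hq'
    obtain ⟨r, hr, k, hk, m, hm, e⟩ := hrel τ q hmem q' hq'
    have hrr := hP.refl r (hP.mem_left hr)
    refine ⟨r, hr, _, (nm hk).1, (nm hk).2, forcesMem_check_of_mem hP hk r, ?_⟩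
    rw [forces_exIn hP]
    intro r' hr'
    refine ⟨r', hP.refl r' (hP.mem_left hr'), _, (nm hm).1, (nm hm).2,
      forcesMem_check_of_mem hP hm r', ?_⟩
    simp only [snoc_vecCons, snoc_vecEmpty]
    rw [forces_pairF hP (hP.mem_left hr') (names_vecCons ⟨hg, hg'⟩ (names_vecCons hω
      (names_vecCons ⟨hτ, hτ'⟩ (names_vecCons (nm hk) (names_vecCons (nm hm)
        names_vecEmpty)))))]
    change ForcesEq P τ (opName P (check P k) (check P m)) r'
    rw [← check_pair]
    exact forcesEq_mono hP hr' e
  · rw [forces_allIn]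
    intro τ hτ hτ' q hq hmem
    rw [forces_exIn hP]
    intro q' hq'
    obtain ⟨r, hr, k, hk, e⟩ := (forcesMem_check hP).1 hmem q' hq'
    obtain ⟨r', hr', m, hm, h⟩ := htot r (hP.mem_left hr) k hk
    refine ⟨r', hP.trans _ _ _ hr' hr, _, (nm hm).1, (nm hm).2, forcesMem_check_of_mem hP hm r', ?_⟩
    rw [forces_exIn hP]
    intro s hs
    refine ⟨s, hP.refl s (hP.mem_left hs), _, (nmp hk hm).1, (nmp hk hm).2, forcesMem_mono hP hs h, ?_⟩
    simp only [snoc_vecCons, snoc_vecEmpty]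
    rw [forces_pairF hP (hP.mem_left hs) (names_vecCons ⟨hg, hg'⟩ (names_vecCons hω
      (names_vecCons ⟨hτ, hτ'⟩ (names_vecCons (nm hm) (names_vecCons (nmp hk hm)
        names_vecEmpty)))))]
    change ForcesEq P (check P (ZFSet.pair k m)) (opName P τ (check P m)) s
    rw [check_pair]
    exact opName_congr hP (forcesEq_symm (forcesEq_mono hP (hP.trans _ _ _ hs hr') e))
      (forcesEq_refl hP _ _)
  · rw [forces_allIn]
    intro τ₂ hτ₂ hτ₂' p₂ hp₂ h₂
    rw [forces_allIn]
    intro τ₃ hτ₃ hτ₃' p₃ hp₃ h₃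
    rw [forces_allIn]
    intro τ₄ hτ₄ hτ₄' p₄ hp₄ h₄
    rw [forces_allIn]
    intro τ₅ hτ₅ hτ₅' p₅ hp₅ h₅
    rw [forces_allIn]
    intro τ₆ hτ₆ hτ₆' p₆ hp₆ h₆
    simp only [snoc_vecCons, snoc_vecEmpty] at h₂ h₃ h₄ h₅ h₆ ⊢
    have hxs := names_vecCons ⟨hg, hg'⟩ (names_vecCons hω (names_vecCons ⟨hτ₂, hτ₂'⟩
      (names_vecCons ⟨hτ₃, hτ₃'⟩ (names_vecCons ⟨hτ₄, hτ₄'⟩ (names_vecCons ⟨hτ₅, hτ₅'⟩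
      (names_vecCons ⟨hτ₆, hτ₆'⟩ names_vecEmpty))))))
    have h₂ : ForcesMem P τ₂ (check P ZFSet.omega) p₂ := h₂
    have h₃ : ForcesMem P τ₃ (check P ZFSet.omega) p₃ := h₃
    have h₄ : ForcesMem P τ₄ (check P ZFSet.omega) p₄ := h₄
    have h₅ : ForcesMem P τ₅ g p₅ := h₅
    have h₆ : ForcesMem P τ₆ g p₆ := h₆
    intro p₇ hp₇ h₇ p₈ hp₈ h₈
    rw [forces_pairF hP (hP.mem_left hp₇) hxs] at h₇
    rw [forces_pairF hP (hP.mem_left hp₈) hxs] at h₈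
    have h₇ : ForcesEq P τ₅ (opName P τ₂ τ₃) p₇ := h₇
    have h₈ : ForcesEq P τ₆ (opName P τ₂ τ₄) p₈ := h₈
    change ForcesEq P τ₃ τ₄ p₈
    refine forcesEq_of_dense hP fun q hq => ?_
    have T : ∀ {a b c}, P.Le a b → P.Le b c → P.Le a c := fun h h' => hP.trans _ _ _ h h'
    have hq7 := T hq hp₈
    have hq6 := T hq7 hp₇
    have hq5 := T hq6 hp₆
    have hq4 := T hq5 hp₅
    have hq3 := T hq4 hp₄
    have hq2 := T hq3 hp₃
    obtain ⟨r₁, hr₁, k, hk, e₂⟩ := (forcesMem_check hP).1 h₂ q hq2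
    obtain ⟨r₂, hr₂, m, hm, e₃⟩ := (forcesMem_check hP).1 h₃ r₁ (T hr₁ hq3)
    obtain ⟨r₃, hr₃, m', hm', e₄⟩ := (forcesMem_check hP).1 h₄ r₂ (T hr₂ (T hr₁ hq4))
    have e₂ := forcesEq_mono hP (T hr₃ hr₂) e₂
    have e₃ := forcesEq_mono hP hr₃ e₃
    have hrq : P.Le r₃ q := T hr₃ (T hr₂ hr₁)
    have e₅ : ForcesEq P τ₅ (check P (ZFSet.pair k m)) r₃ := by
      rw [check_pair]
      exact forcesEq_trans hP (forcesEq_mono hP (T hrq hq7) h₇) (opName_congr hP e₂ e₃)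
    have e₆ : ForcesEq P τ₆ (check P (ZFSet.pair k m')) r₃ := by
      rw [check_pair]
      exact forcesEq_trans hP (forcesEq_mono hP (T hrq hq) h₈) (opName_congr hP e₂ e₄)
    have := huniq r₃ (hP.mem_left hr₃) k hk m hm m' hm'
      (forcesMem_congr_left hP e₅ (forcesMem_mono hP (T hrq hq5) h₅))
      (forcesMem_congr_left hP e₆ (forcesMem_mono hP (T hrq hq6) h₆))
    subst this
    exact ⟨r₃, hrq, forcesEq_trans hP e₃ (forcesEq_symm e₄)⟩

/-- All parameters but `h` are check names, so a condition can be extended to decide the witnessing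
triple of `U`. Then `s ⊆ C` is a fact about actual sets, and only `t ⊆ h` remains to be forced. -/
theorem forcedBy_notDominatedF_iff (hP : P.IsPoset) {C h U : ZFSet.{u}} (hC : C ∈ N)
    (hh : h ∈ N ∧ IsName P h) (hU : U ∈ N)
    (hUpair : ∀ x ∈ U, ∃ n s t, x = ZFSet.pair n (ZFSet.pair s t)) :
    ForcedBy N P notDominatedF ![check P C, h, check P U, check P ZFSet.omega] ↔
      ∀ n ∈ ZFSet.omega, ∀ q ∈ P.carrier, ∃ r, P.Le r q ∧ ∃ s t,
        ZFSet.pair n (ZFSet.pair s t) ∈ U ∧ s ⊆ C ∧ ∀ x ∈ t, ForcesMem P (check P x) h r := by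
  have hω : check P ZFSet.omega ∈ N ∧ IsName P (check P ZFSet.omega) := check_name omega_mem_model
  have hC' : check P C ∈ N ∧ IsName P (check P C) := check_name hC
  have hU' : check P U ∈ N ∧ IsName P (check P U) := check_name hU
  have T : ∀ {a b c}, P.Le a b → P.Le b c → P.Le a c := fun h h' => hP.trans _ _ _ h h'
  constructor
  · intro H n hn q hq
    have hn' : check P n ∈ N ∧ IsName P (check P n) := check_name (mem_model_of_mem_omega hn)
    have H1 := forces_allIn.1 (H q hq) _ hn'.1 hn'.2 q (hP.refl q hq)
      (forcesMem_check_of_mem hP hn q)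
    obtain ⟨r₁, hr₁, τ₅, hτ₅, hτ₅', h₅, H2⟩ := (forces_exIn hP).1 H1 q (hP.refl q hq)
    obtain ⟨r₂, hr₂, τ₆, hτ₆, hτ₆', H3⟩ := forces_ex.1 H2 r₁ (hP.refl _ (hP.mem_left hr₁))
    obtain ⟨r₃, hr₃, τ₇, hτ₇, hτ₇', H4⟩ := forces_ex.1 H3 r₂ (hP.refl _ (hP.mem_left hr₂))
    obtain ⟨r₄, hr₄, τ₈, hτ₈, hτ₈', H5⟩ := forces_ex.1 H4 r₃ (hP.refl _ (hP.mem_left hr₃))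
    simp only [snoc_vecCons, snoc_vecEmpty] at h₅ H5
    have hxs := names_vecCons hC' (names_vecCons hh (names_vecCons hU' (names_vecCons hω
      (names_vecCons hn' (names_vecCons ⟨hτ₅, hτ₅'⟩ (names_vecCons ⟨hτ₆, hτ₆'⟩
      (names_vecCons ⟨hτ₇, hτ₇'⟩ (names_vecCons ⟨hτ₈, hτ₈'⟩ names_vecEmpty))))))))
    have hr₄P := hP.mem_left hr₄
    rw [forces_inf hP hr₄P, forces_inf hP hr₄P, forces_inf hP hr₄P, forces_pairF hP hr₄P hxs,
      forces_pairF hP hr₄P hxs, forces_subsetF, forces_subsetF] at H5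
    obtain ⟨a₁, a₂, a₃, a₄⟩ := H5
    have a₁ : ForcesEq P τ₅ (opName P (check P n) τ₆) r₄ := a₁
    have a₂ : ForcesEq P τ₆ (opName P τ₇ τ₈) r₄ := a₂
    have h₅ : ForcesMem P τ₅ (check P U) r₁ := h₅
    obtain ⟨r₅, hr₅, x, hx, e₅⟩ := (forcesMem_check hP).1 h₅ r₄ (T hr₄ (T hr₃ hr₂))
    obtain ⟨n', s, t, rfl⟩ := hUpair x hx
    obtain ⟨r₆, hr₆, e₆, e₆'⟩ := exists_forcesEq_of_opName hP (hP.mem_left hr₅)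
      (forcesEq_trans hP (forcesEq_symm e₅) (forcesEq_mono hP hr₅ a₁))
    obtain rfl := eq_of_forcesEq_check hP (hP.mem_left hr₆) e₆
    obtain ⟨r₇, hr₇, e₇, e₈⟩ := exists_forcesEq_of_opName hP (hP.mem_left hr₆)
      (forcesEq_trans hP (forcesEq_symm e₆') (forcesEq_mono hP (T hr₆ hr₅) a₂))
    have hr₇₄ : P.Le r₇ r₄ := T hr₇ (T hr₆ hr₅)
    have hr₇P := hP.mem_left hr₇
    have hstN : ∀ {y}, y ∈ s ∨ y ∈ t → y ∈ N := by
      intro y hy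
      have h1 : ZFSet.pair s t ∈ N := mem_model (tc_mem_model hU) (tc_transitive U _
        (tc_transitive U _ (subset_tc U hx) {n, ZFSet.pair s t} (by simp [ZFSet.pair])) _ (by simp))
      have h2 : ({s, t} : ZFSet.{u}) ∈ N := mem_model h1 (by simp [ZFSet.pair])
      rcases hy with hy | hy
      · exact mem_model (mem_model h2 (by simp)) hy
      · exact mem_model (mem_model h2 (by simp)) hy
    refine ⟨r₇, T hr₇₄ (T hr₄ (T hr₃ (T hr₂ hr₁))), s, t, hx, fun y hy => ?_, fun y hy => ?_⟩
    · have hyN : check P y ∈ N ∧ IsName P (check P y) := check_name (hstN (.inl hy))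
      have b : ForcesMem P (check P y) (check P C) r₇ := a₃ _ hyN.1 hyN.2 r₇ hr₇₄
        (forcesMem_congr_right hP (forcesEq_symm e₇) (forcesMem_check_of_mem hP hy r₇))
      obtain ⟨r₈, hr₈, z, hz, e⟩ := (forcesMem_check hP).1 b r₇ (hP.refl _ hr₇P)
      rwa [eq_of_forcesEq_check hP (hP.mem_left hr₈) e]
    · have hyN : check P y ∈ N ∧ IsName P (check P y) := check_name (hstN (.inr hy))
      exact a₄ _ hyN.1 hyN.2 r₇ hr₇₄
        (forcesMem_congr_right hP (forcesEq_symm e₈) (forcesMem_check_of_mem hP hy r₇))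
  · intro H p hp
    refine forces_allIn.2 fun τ hτ hτ' q hq hmem => (forces_exIn hP).2 fun q' hq' => ?_
    obtain ⟨r₁, hr₁, n, hn, e⟩ := (forcesMem_check hP).1
      (show ForcesMem P τ (check P ZFSet.omega) q from hmem) q' hq'
    obtain ⟨r, hr, s, t, hx, hsC, ht⟩ := H n hn r₁ (hP.mem_left hr₁)
    have hrP := hP.mem_left hr
    have hpairN : ∀ {a b}, ZFSet.pair a b ∈ N → a ∈ N ∧ b ∈ N := by
      intro a b h
      have h2 : ({a, b} : ZFSet.{u}) ∈ N := mem_model h (by simp [ZFSet.pair])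
      exact ⟨mem_model h2 (by simp), mem_model h2 (by simp)⟩
    have hxN := mem_model hU hx
    have hstN := (hpairN hxN).2
    have hx' : check P (ZFSet.pair n (ZFSet.pair s t)) ∈ N ∧ IsName P _ := check_name hxN
    have hst' : check P (ZFSet.pair s t) ∈ N ∧ IsName P _ := check_name hstN
    have hs' : check P s ∈ N ∧ IsName P _ := check_name (hpairN hstN).1
    have ht' : check P t ∈ N ∧ IsName P _ := check_name (hpairN hstN).2
    refine ⟨r, T hr hr₁, _, hx'.1, hx'.2, forcesMem_check_of_mem hP hx r, ?_⟩
    refine forces_ex_intro hP hst' (forces_ex_intro hP hs' (forces_ex_intro hP ht' ?_))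
    simp only [snoc_vecCons, snoc_vecEmpty]
    have hxs := names_vecCons hC' (names_vecCons hh (names_vecCons hU' (names_vecCons hω
      (names_vecCons ⟨hτ, hτ'⟩ (names_vecCons hx' (names_vecCons hst'
      (names_vecCons hs' (names_vecCons ht' names_vecEmpty))))))))
    rw [forces_inf hP hrP, forces_inf hP hrP, forces_inf hP hrP, forces_pairF hP hrP hxs,
      forces_pairF hP hrP hxs, forces_subsetF, forces_subsetF]
    refine ⟨?_, ?_, fun υ _ _ q₂ hq₂ hυ => ?_, fun υ _ _ q₂ hq₂ hυ => ?_⟩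
    · change ForcesEq P (check P (ZFSet.pair n (ZFSet.pair s t))) (opName P τ (check P _)) r
      rw [check_pair]
      exact opName_congr hP (forcesEq_symm (forcesEq_mono hP hr e)) (forcesEq_refl hP _ _)
    · change ForcesEq P (check P (ZFSet.pair s t)) (opName P (check P s) (check P t)) r
      rw [check_pair]
      exact forcesEq_refl hP _ _
    · change ForcesMem P υ (check P C) q₂
      have hυ : ForcesMem P υ (check P s) q₂ := hυ
      rw [forcesMem_check hP] at hυ ⊢
      intro q₃ hq₃
      obtain ⟨r', hr', y, hy, e⟩ := hυ q₃ hq₃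
      exact ⟨r', hr', y, hsC hy, e⟩
    · change ForcesMem P υ h q₂
      have hυ : ForcesMem P υ (check P t) q₂ := hυ
      refine forcesMem_of_dense hP fun q₃ hq₃ => ?_
      obtain ⟨r', hr', y, hy, e⟩ := (forcesMem_check hP).1 hυ q₃ hq₃
      exact ⟨r', hr', forcesMem_congr_left hP (forcesEq_symm e)
        (forcesMem_mono hP (T hr' (T hq₃ hq₂)) (ht y hy))⟩

end Names

/-! ## Transfer of forcing along complete suborders -/

theorem PosetData.CompleteSuborderOver.le {M : Set ZFSet.{u}} {P Q : PosetData.{u}}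
    (hP : P.IsPoset) (h : CompleteSuborderOver M P Q) {a b : ZFSet.{u}} (hab : P.Le a b) :
    Q.Le a b :=
  (h.1.2 a (hP.mem_left hab) b (hP.mem_right hab)).1 hab

theorem IsName.mem_carrier {P : PosetData.{u}} {τ x s : ZFSet.{u}} (h : IsName P τ)
    (hx : ZFSet.pair x s ∈ τ) : s ∈ P.carrier := by
  cases h with
  | mk _ pairs _ =>
    obtain ⟨σ, p, e, hp⟩ := pairs _ hx
    rwa [(ZFSet.pair_inj.1 e).2]

section Transfer

variable {M : Set ZFSet.{u}} [hM : Fact (IsTransitiveModelZFC M)] {P Q : PosetData.{u}}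
  [hPc : Fact (P.carrier ∈ M)] [hPr : Fact (P.rel ∈ M)]

theorem exists_compat_carrier (hP : P.IsPoset) (hPQ : CompleteSuborderOver M P Q) {q : ZFSet.{u}}
    (hq : q ∈ Q.carrier) : ∃ p ∈ P.carrier, Q.Compat p q := by
  obtain ⟨p, hp, -, h⟩ := predense_of_dense hP hPQ (fun _ => True)
    (fun p hp => ⟨p, hp, hP.refl p hp, trivial⟩) hq
  exact ⟨p, hp, h⟩

/-- The inductive step shared by both clauses of forced equality and by forced membership.
Conditions of `P` that carry a witness below `p` and `s`, or are incompatible with `p` or with `s`,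
form a dense set definable over `M`. One of them is compatible with `q`, and it cannot be of the
incompatible kind because `q ≤ p, s`. -/
theorem exists_forcesEq_transfer (hP : P.IsPoset) (hQ : Q.IsPoset)
    (hPQ : CompleteSuborderOver M P Q) {τ x p s q : ZFSet.{u}} (hτ : τ ∈ M) (hx : x ∈ M)
    (hp : p ∈ P.carrier) (hs : s ∈ P.carrier)
    (h : ∀ q, P.Le q p → P.Le q s →
      ∃ r, P.Le r q ∧ ∃ ρ t, ZFSet.pair ρ t ∈ τ ∧ P.Le r t ∧ ForcesEq P x ρ r)
    (ih : ∀ ρ t r, ZFSet.pair ρ t ∈ τ → r ∈ P.carrier → ForcesEq P x ρ r → ForcesEq Q x ρ r)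
    (hqp : Q.Le q p) (hqs : Q.Le q s) :
    ∃ r, Q.Le r q ∧ ∃ ρ t, ZFSet.pair ρ t ∈ τ ∧ Q.Le r t ∧ ForcesEq Q x ρ r := by
  have : Fact (p ∈ M) := ⟨mem_model hPc.out hp⟩
  have : Fact (s ∈ M) := ⟨mem_model hPc.out hs⟩
  have : Fact (x ∈ M) := ⟨hx⟩
  have : Df M fun v : Fin 1 → ZFSet.{u} => ∃ ρ t, ZFSet.pair ρ t ∈ τ ∧ P.Le (v 0) t ∧
      ForcesEq P x ρ (v 0) :=
    Df.exists_forcesEq (t := fun _ => x) (s := fun v => v 0) hP hτ inferInstance inferInstance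
  obtain ⟨r, hr, hS, u, hu, hur, huq⟩ := predense_of_dense hP hPQ
    (fun r => (P.Le r p ∧ P.Le r s ∧
      ∃ ρ t, ZFSet.pair ρ t ∈ τ ∧ P.Le r t ∧ ForcesEq P x ρ r) ∨
      ¬ P.Compat r p ∨ ¬ P.Compat r s) (by
      intro a ha
      by_cases h1 : P.Compat a p
      · obtain ⟨b, hb, hba, hbp⟩ := h1
        by_cases h2 : P.Compat b s
        · obtain ⟨c, hc, hcb, hcs⟩ := h2
          obtain ⟨r, hrc, hr⟩ := h c (hP.trans _ _ _ hcb hbp) hcs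
          exact ⟨r, hP.mem_left hrc, hP.trans _ _ _ hrc (hP.trans _ _ _ hcb hba), .inl
            ⟨hP.trans _ _ _ hrc (hP.trans _ _ _ hcb hbp), hP.trans _ _ _ hrc hcs, hr⟩⟩
        · exact ⟨b, hb, hba, .inr (.inr h2)⟩
      · exact ⟨a, ha, hP.refl a ha, .inr (.inl h1)⟩) (hQ.mem_left hqp)
  rcases hS with ⟨-, -, ρ, t, hρ, hrt, e⟩ | h1 | h1
  · exact ⟨u, huq, ρ, t, hρ, hQ.trans _ _ _ hur (hPQ.le hP hrt),
      forcesEq_mono hQ hur (ih ρ t r hρ hr e)⟩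
  · exact absurd (compat_of_compat hP hPQ hr hp ⟨u, hu, hur, hQ.trans _ _ _ huq hqp⟩) h1
  · exact absurd (compat_of_compat hP hPQ hr hs ⟨u, hu, hur, hQ.trans _ _ _ huq hqs⟩) h1

theorem forcesEq_transfer (hP : P.IsPoset) (hQ : Q.IsPoset) (hPQ : CompleteSuborderOver M P Q)
    {σ τ p : ZFSet.{u}} (hσ : σ ∈ M) (hτ : τ ∈ M) (hσ' : IsName P σ) (hτ' : IsName P τ)
    (hp : p ∈ P.carrier) (h : ForcesEq P σ τ p) : ForcesEq Q σ τ p := by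
  have inM : ∀ {x s υ}, υ ∈ M → ZFSet.pair x s ∈ υ → x ∈ M := fun hυ hx =>
    mem_model (tc_mem_model hυ) (left_mem_tc hx)
  induction σ using tc_induction generalizing τ p with
  | h σ ih =>
    rw [forcesEq_iff] at h ⊢
    refine ⟨fun x s hx q hqp hqs => ?_, fun ρ t hρ q hqp hqt => ?_⟩
    · refine exists_forcesEq_transfer hP hQ hPQ hτ (inM hσ hx) hp (hσ'.mem_carrier hx) (h.1 x s hx)
        (fun ρ t r hρ hr e => ?_) hqp hqs
      exact ih x (left_mem_tc hx) (inM hσ hx) (inM hτ hρ) (hσ'.of_pair_mem hx) (hτ'.of_pair_mem hρ)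
        hr e
    · obtain ⟨r, hrq, x, s, hx, hrs, e⟩ := exists_forcesEq_transfer hP hQ hPQ hσ (inM hτ hρ) hp
        (hτ'.mem_carrier hρ) (fun q hqp hqt => by
          obtain ⟨r, hrq, x, s, hx, hrs, e⟩ := h.2 ρ t hρ q hqp hqt
          exact ⟨r, hrq, x, s, hx, hrs, forcesEq_symm e⟩)
        (fun x s r hx hr e => forcesEq_symm (ih x (left_mem_tc hx) (inM hσ hx) (inM hτ hρ)
          (hσ'.of_pair_mem hx) (hτ'.of_pair_mem hρ) hr (forcesEq_symm e))) hqp hqt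
      exact ⟨r, hrq, x, s, hx, hrs, forcesEq_symm e⟩

theorem forcesMem_transfer (hP : P.IsPoset) (hQ : Q.IsPoset) (hPQ : CompleteSuborderOver M P Q)
    {σ τ p : ZFSet.{u}} (hσ : σ ∈ M) (hτ : τ ∈ M) (hσ' : IsName P σ) (hτ' : IsName P τ)
    (hp : p ∈ P.carrier) (h : ForcesMem P σ τ p) : ForcesMem Q σ τ p := fun _ hq =>
  exists_forcesEq_transfer hP hQ hPQ hτ hσ hp hp (fun q hqp _ => h q hqp)
    (fun _ _ _ hρ hr e => forcesEq_transfer hP hQ hPQ hσ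
      (mem_model (tc_mem_model hτ) (left_mem_tc hρ)) hσ' (hτ'.of_pair_mem hρ) hr e) hq hq

/-- The two names differ only in the conditions attached to their members; every condition of `Q` is
compatible with one of `P`, so this makes no difference. -/
theorem forcesEq_check_check (hP : P.IsPoset) (hQ : Q.IsPoset) (hPQ : CompleteSuborderOver M P Q)
    (x q : ZFSet.{u}) : ForcesEq Q (check P x) (check Q x) q := by
  induction x using ZFSet.inductionOn generalizing q with
  | h x ih =>
    rw [forcesEq_iff]
    refine ⟨fun y s hy q' hq' _ => ?_, fun y t hy q' hq' _ => ?_⟩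
    · obtain ⟨z, hz, p, hp, e⟩ := mem_check.1 hy
      obtain ⟨rfl, rfl⟩ := ZFSet.pair_inj.1 e
      have hq'Q := hQ.mem_left hq'
      exact ⟨q', hQ.refl _ hq'Q, check Q z, q', mem_check.2 ⟨z, hz, q', hq'Q, rfl⟩,
        hQ.refl _ hq'Q, ih z hz q'⟩
    · obtain ⟨z, hz, p, hp, e⟩ := mem_check.1 hy
      obtain ⟨rfl, rfl⟩ := ZFSet.pair_inj.1 e
      obtain ⟨a, ha, r, hr, hra, hrq⟩ := exists_compat_carrier hP hPQ (hQ.mem_left hq')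
      exact ⟨r, hrq, check P z, a, mem_check.2 ⟨z, hz, a, ha, rfl⟩, hra, ih z hz r⟩

/-- Let `q'` extend `b` and `q`. Without a reduction of `q'`, the conditions of `P` incompatible
with `q'` would be dense, hence one of them would be compatible with `q'`. A reduction of `q'` is
compatible with `b`, since `q' ≤ b`, and can be strengthened below `b`. -/
theorem exists_reduction_le (hP : P.IsPoset) (hQ : Q.IsPoset) [Fact (Q.carrier ∈ M)]
    [Fact (Q.rel ∈ M)] (hPQ : CompleteSuborderOver M P Q) {b q : ZFSet.{u}} (hb : b ∈ P.carrier)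
    (h : Q.Compat b q) : ∃ a ∈ P.carrier, P.Le a b ∧ IsReduction P Q a q := by
  obtain ⟨q', hq', hq'b, hq'q⟩ := h
  have : Fact (q' ∈ M) := ⟨mem_model (M := M) (x := q') (y := Q.carrier) Fact.out hq'⟩
  have hred : ∃ a ∈ P.carrier, IsReduction P Q a q' := by
    by_contra hno
    push Not at hno
    obtain ⟨r, hr, hS, hc⟩ := predense_of_dense hP hPQ (fun r => ¬ Q.Compat r q') (by
      intro p hp
      have := hno p hp
      simp only [IsReduction, hp, hq', true_and] at this
      push Not at this
      exact this) hq'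
    exact hS hc
  obtain ⟨a₀, ha₀, -, -, hred⟩ := hred
  obtain ⟨u, hu, hua, huq⟩ := hred a₀ ha₀ (hP.refl a₀ ha₀)
  obtain ⟨a, ha, haa, hab⟩ := compat_of_compat hP hPQ ha₀ hb ⟨u, hu, hua, hQ.trans _ _ _ huq hq'b⟩
  refine ⟨a, ha, hab, ha, hQ.mem_right hq'q, fun r hr hra => ?_⟩
  obtain ⟨w, hw, hwr, hwq⟩ := hred r hr (hP.trans _ _ _ hra haa)
  exact ⟨w, hw, hwr, hQ.trans _ _ _ hwq hq'q⟩

end Transfer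

theorem PosetData.IsReduction.mono {P Q : PosetData.{u}} (hP : P.IsPoset) {a b q : ZFSet.{u}}
    (h : IsReduction P Q a q) (hba : P.Le b a) : IsReduction P Q b q :=
  ⟨hP.mem_left hba, h.2.1, fun r hr hrb => h.2.2 r hr (hP.trans _ _ _ hrb hba)⟩

instance Df.isReduction {M : Set ZFSet.{u}} [Fact (IsTransitiveModelZFC M)] {n : ℕ}
    {P Q : PosetData.{u}} [Fact (P.carrier ∈ M)] [Fact (P.rel ∈ M)] [Fact (Q.carrier ∈ M)]
    [Fact (Q.rel ∈ M)] {t s : (Fin n → ZFSet.{u}) → ZFSet.{u}} [ht : Tm M t] [hs : Tm M s] :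
    Df M fun v => IsReduction P Q (t v) (s v) := by
  unfold IsReduction
  have := ht.lift
  have := hs.lift
  infer_instance

/-! ### The order of the natural numbers as membership -/

theorem mem_natSet {x : ZFSet.{u}} {n : ℕ} : x ∈ natSet n ↔ ∃ k < n, x = natSet k := by
  induction n with
  | zero => simp [natSet]
  | succ n ih =>
    rw [natSet, ZFSet.mem_insert_iff, ih]
    constructor
    · rintro (rfl | ⟨k, hk, rfl⟩)
      exacts [⟨n, n.lt_succ_self, rfl⟩, ⟨k, hk.trans n.lt_succ_self, rfl⟩]
    · rintro ⟨k, hk, rfl⟩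
      rcases Nat.lt_succ_iff_lt_or_eq.1 hk with h | rfl
      exacts [.inr ⟨k, h, rfl⟩, .inl rfl]

theorem omega_transitive {k l : ZFSet.{u}} (hk : k ∈ ZFSet.omega) (hl : l ∈ k) :
    l ∈ ZFSet.omega := by
  obtain ⟨n, rfl⟩ := mem_omega_iff.1 hk
  obtain ⟨m, -, rfl⟩ := mem_natSet.1 hl
  exact mem_omega_iff.2 ⟨m, rfl⟩

theorem mem_trans_of_mem_omega {k l j : ZFSet.{u}} (hk : k ∈ ZFSet.omega) (hl : l ∈ k)
    (hj : j ∈ l) : j ∈ k := by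
  obtain ⟨n, rfl⟩ := mem_omega_iff.1 hk
  obtain ⟨m, hm, rfl⟩ := mem_natSet.1 hl
  obtain ⟨i, hi, rfl⟩ := mem_natSet.1 hj
  exact mem_natSet.2 ⟨i, hi.trans hm, rfl⟩

theorem eq_of_notMem_omega {k l : ZFSet.{u}} (hk : k ∈ ZFSet.omega) (hl : l ∈ ZFSet.omega)
    (h : k ∉ l) (h' : l ∉ k) : k = l := by
  obtain ⟨n, rfl⟩ := mem_omega_iff.1 hk
  obtain ⟨m, rfl⟩ := mem_omega_iff.1 hl
  rcases lt_trichotomy n m with hlt | rfl | hlt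
  exacts [absurd (mem_natSet.2 ⟨n, hlt, rfl⟩) h, rfl, absurd (mem_natSet.2 ⟨m, hlt, rfl⟩) h']

/-! ## The leftmost branch of the tree of possible values of a name -/

/-- `p ⊩ h(k) = m`. -/
def ForcesValue (P : PosetData.{u}) (h p k m : ZFSet.{u}) : Prop :=
  ForcesMem P (check P (ZFSet.pair k m)) h p

/-- Every value `h(l)`, `l < j`, which is decided by `p` is decided by `q` in the same way. -/
def DecidesSame (P : PosetData.{u}) (h p q j : ZFSet.{u}) : Prop :=
  ∀ l ∈ j, ∀ m ∈ ZFSet.omega, ForcesValue P h p l m → ForcesValue P h q l m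

/-- `a ∈ P₀` is a reduction of `p`, which decides `h` below `k`, and `a` forces that the decided
sequence is lexicographically least among those decided by a condition in the quotient. -/
def DecidesLeast (P₀ P : PosetData.{u}) (h k a p : ZFSet.{u}) : Prop :=
  IsReduction P₀ P a p ∧ (∀ j ∈ k, ∃ m ∈ ZFSet.omega, ForcesValue P h p j m) ∧
    ∀ j ∈ k, ∀ b ∈ P₀.carrier, P₀.Le b a → ∀ q ∈ P.carrier, IsReduction P₀ P b q →
      DecidesSame P h p q j → ∀ m ∈ ZFSet.omega, ∀ m' ∈ ZFSet.omega,
        ForcesValue P h p j m → ForcesValue P h q j m' → m' ∉ m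

/-- A `P₀`-name for the lexicographically least branch through the tree of all finite sequences
which some condition in the quotient forces to be an initial segment of `h`. -/
def leastBranchName (P₀ P : PosetData.{u}) (h : ZFSet.{u}) : ZFSet.{u} :=
  ZFSet.sep (fun z => ∃ k ∈ ZFSet.omega, ∃ m ∈ ZFSet.omega, ∃ a ∈ P₀.carrier, ∃ p ∈ P.carrier,
    z = ZFSet.pair (check P₀ (ZFSet.pair k m)) a ∧ DecidesLeast P₀ P h (insert k k) a p ∧
      ForcesValue P h p k m) (check P₀ (ZFSet.prod ZFSet.omega ZFSet.omega))

theorem pair_mem_leastBranchName {P₀ P : PosetData.{u}} {h ρ a : ZFSet.{u}} :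
    ZFSet.pair ρ a ∈ leastBranchName P₀ P h ↔ ∃ k ∈ ZFSet.omega, ∃ m ∈ ZFSet.omega, ∃ p,
      ρ = check P₀ (ZFSet.pair k m) ∧ DecidesLeast P₀ P h (insert k k) a p ∧
        ForcesValue P h p k m := by
  rw [leastBranchName, ZFSet.mem_sep]
  constructor
  · rintro ⟨-, k, hk, m, hm, a', -, p, -, e, h1, h2⟩
    obtain ⟨rfl, rfl⟩ := ZFSet.pair_inj.1 e
    exact ⟨k, hk, m, hm, p, rfl, h1, h2⟩
  · rintro ⟨k, hk, m, hm, p, rfl, h1, h2⟩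
    exact ⟨mem_check.2 ⟨_, ZFSet.pair_mem_prod.2 ⟨hk, hm⟩, a, h1.1.1, rfl⟩,
      k, hk, m, hm, a, h1.1.1, p, h1.1.2.1, rfl, h1, h2⟩

theorem isName_leastBranchName {P₀ P : PosetData.{u}} {h : ZFSet.{u}} :
    IsName P₀ (leastBranchName P₀ P h) := by
  refine ⟨_, fun z hz => ?_, fun σ a hσ => ?_⟩
  · obtain ⟨-, k, -, m, -, a, ha, p, -, rfl, -⟩ := ZFSet.mem_sep.1 hz
    exact ⟨_, a, rfl, ha⟩
  · obtain ⟨k, -, m, -, p, rfl, -⟩ := pair_mem_leastBranchName.1 hσ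
    exact isName_check _

/-- Below a common extension of `a` and `b` each of `p`, `q` competes against the other. If they
agree before `j`, the two minimality clauses say that neither value at `j` is smaller than the
other. -/
theorem DecidesLeast.agree {P₀ P : PosetData.{u}} (hP₀ : P₀.IsPoset) {h k k' a b p q : ZFSet.{u}}
    (hk : k ∈ ZFSet.omega) (hk' : k' ∈ ZFSet.omega) (H : DecidesLeast P₀ P h k a p)
    (H' : DecidesLeast P₀ P h k' b q) (hab : P₀.Compat a b) {j m : ZFSet.{u}} (hj : j ∈ k)
    (hj' : j ∈ k') (hm : m ∈ ZFSet.omega) : ForcesValue P h p j m ↔ ForcesValue P h q j m := by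
  obtain ⟨r, hr, hra, hrb⟩ := hab
  induction j using ZFSet.inductionOn generalizing m with
  | h j ih =>
    have ih' : ∀ l ∈ j, ∀ m ∈ ZFSet.omega, ForcesValue P h p l m ↔ ForcesValue P h q l m :=
      fun l hl m hm => ih l hl (mem_trans_of_mem_omega hk hj hl)
        (mem_trans_of_mem_omega hk' hj' hl) hm
    have key : ∀ {m m'}, m ∈ ZFSet.omega → m' ∈ ZFSet.omega → ForcesValue P h p j m →
        ForcesValue P h q j m' → m = m' := by
      intro m m' hm hm' h1 h2
      refine eq_of_notMem_omega hm hm' ?_ ?_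
      · exact H'.2.2 j hj' r hr hrb p H.1.2.1 (H.1.mono hP₀ hra)
          (fun l hl m hm => (ih' l hl m hm).2) m' hm' m hm h2 h1
      · exact H.2.2 j hj r hr hra q H'.1.2.1 (H'.1.mono hP₀ hrb)
          (fun l hl m hm => (ih' l hl m hm).1) m hm m' hm' h1 h2
    constructor
    · intro h1
      obtain ⟨m', hm', h2⟩ := H'.2.1 j hj'
      rwa [key hm hm' h1 h2]
    · intro h2
      obtain ⟨m', hm', h1⟩ := H.2.1 j hj
      rwa [← key hm' hm h1 h2]

section Model

variable {M : Set ZFSet.{u}} [hM : Fact (IsTransitiveModelZFC M)] {P₀ P : PosetData.{u}}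
  [hPc₀ : Fact (P₀.carrier ∈ M)] [hPr₀ : Fact (P₀.rel ∈ M)]

/-- The poset `Q` is kept arbitrary over `P₀`: the case `Q = P₀` shows that the branch is a real,
and the case of the larger poset is used to read off its values there. -/
theorem forcesMem_leastBranchName (hP₀ : P₀.IsPoset) {Q : PosetData.{u}} (hQ : Q.IsPoset)
    (hP₀Q : CompleteSuborderOver M P₀ Q) {h x r : ZFSet.{u}} (hr : r ∈ Q.carrier)
    (hx : ForcesMem Q (check Q x) (leastBranchName P₀ P h) r) :
    ∃ s, Q.Le s r ∧ ∃ k ∈ ZFSet.omega, ∃ m ∈ ZFSet.omega, x = ZFSet.pair k m ∧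
      ∃ a p, Q.Le s a ∧ DecidesLeast P₀ P h (insert k k) a p ∧ ForcesValue P h p k m := by
  obtain ⟨s, hs, ρ, a, hρ, hsa, e⟩ := hx r (hQ.refl r hr)
  obtain ⟨k, hk, m, hm, p, rfl, H, hv⟩ := pair_mem_leastBranchName.1 hρ
  have := eq_of_forcesEq_check hQ (hQ.mem_left hs)
    (forcesEq_trans hQ e (forcesEq_check_check hP₀ hQ hP₀Q _ s))
  exact ⟨s, hs, k, hk, m, hm, this, a, p, hsa, H, hv⟩

variable [hPc : Fact (P.carrier ∈ M)] [hPr : Fact (P.rel ∈ M)]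

/-- Induction on `k`: strengthen the reduction so that the next value is the least one still
possible. Minimality at earlier places survives because it was required for all stronger reductions.
-/
theorem exists_decidesLeast (hP₀ : P₀.IsPoset) (hP : P.IsPoset)
    (hP₀P : CompleteSuborderOver M P₀ P) {h : ZFSet.{u}} (hh : IsRealName M P h) {k a : ZFSet.{u}}
    (hk : k ∈ ZFSet.omega) (ha : a ∈ P₀.carrier) :
    ∃ b ∈ P₀.carrier, P₀.Le b a ∧ ∃ p, DecidesLeast P₀ P h k b p := by
  obtain ⟨n, rfl⟩ := mem_omega_iff.1 hk
  induction n with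
  | zero =>
    -- With nothing to decide, `a` can serve as a reduction of itself.
    have haP := hP₀P.1.1 ha
    refine ⟨a, ha, hP₀.refl a ha, a, ⟨ha, haP, fun r hr hra => ?_⟩, ?_, ?_⟩
    · exact ⟨r, hP₀P.1.1 hr, hP.refl r (hP₀P.1.1 hr), hP₀P.le hP₀ hra⟩
    · exact fun j hj => absurd hj (ZFSet.notMem_empty j)
    · exact fun j hj => absurd hj (ZFSet.notMem_empty j)
  | succ n ih =>
    have hn : natSet n ∈ ZFSet.omega := mem_omega_iff.2 ⟨n, rfl⟩
    obtain ⟨a₁, ha₁, ha₁a, p, H⟩ := ih hn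
    -- The values at `n` open to competitors of `p` below `a₁`. There is one: extend `p` together
    -- with `a₁`, decide `h(n)`, and reduce the result back below `a₁`.
    let S : Set ZFSet.{u} := {m | m ∈ ZFSet.omega ∧ ∃ b ∈ P₀.carrier, P₀.Le b a₁ ∧
      ∃ q ∈ P.carrier, IsReduction P₀ P b q ∧ DecidesSame P h p q (natSet n) ∧
        ForcesValue P h q (natSet n) m}
    have hS : S.Nonempty := by
      obtain ⟨p₁, hp₁, hp₁a, hp₁p⟩ := H.1.2.2 a₁ ha₁ (hP₀.refl a₁ ha₁)
      obtain ⟨q, hq, m, hm, hv⟩ := real_name_total hP hh hp₁ hn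
      have hqP := hP.mem_left hq
      obtain ⟨b, hb, hba, hred⟩ := exists_reduction_le (M := M) hP₀ hP hP₀P ha₁
        ⟨q, hqP, hP.trans _ _ _ hq hp₁a, hP.refl q hqP⟩
      exact ⟨m, hm, b, hb, hba, q, hqP, hred,
        fun l _ m _ hl => forcesMem_mono hP (hP.trans _ _ _ hq hp₁p) hl, hv⟩
    obtain ⟨m, ⟨hm, b, hb, hba, q, hq, hred, hsame, hv⟩, hmin⟩ :=
      ZFSet.mem_wf.has_min S hS
    have huniq : ∀ {q k m m'}, q ∈ P.carrier → k ∈ ZFSet.omega → m ∈ ZFSet.omega →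
        m' ∈ ZFSet.omega → ForcesValue P h q k m → ForcesValue P h q k m' → m = m' :=
      fun hq hk hm hm' h1 h2 => real_name_unique hP hh hq hk hm hm' h1 h2
    refine ⟨b, hb, hP₀.trans _ _ _ hba ha₁a, q, hred, fun j hj => ?_, ?_⟩
    · rcases ZFSet.mem_insert_iff.1 hj with rfl | hj
      · exact ⟨m, hm, hv⟩
      · obtain ⟨m', hm', h'⟩ := H.2.1 j hj
        exact ⟨m', hm', hsame j hj m' hm' h'⟩
    · intro j hj c hc hcb q' hq' hred' hsame' m₁ hm₁ m₂ hm₂ h1 h2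
      rcases ZFSet.mem_insert_iff.1 hj with rfl | hj
      · rw [huniq hq hn hm₁ hm h1 hv]
        exact hmin m₂ ⟨hm₂, c, hc, hP₀.trans _ _ _ hcb hba, q', hq', hred',
          fun l hl m hm hl' => hsame' l hl m hm (hsame l hl m hm hl'), h2⟩
      · obtain ⟨m₀, hm₀, h0⟩ := H.2.1 j hj
        rw [huniq hq (omega_transitive hn hj) hm₁ hm₀ h1 (hsame j hj m₀ hm₀ h0)]
        exact H.2.2 j hj c hc (hP₀.trans _ _ _ hcb hba) q' hq' hred' (fun l hl m hm hl' =>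
          hsame' l hl m hm (hsame l (mem_trans_of_mem_omega hn hj hl) m hm hl')) m₀ hm₀ m₂ hm₂ h0 h2

theorem Df.decidesLeast (hP : P.IsPoset) {n : ℕ} {h : ZFSet.{u}} (hh : h ∈ M)
    {t s r : (Fin n → ZFSet.{u}) → ZFSet.{u}} (ht : Tm M t) (hs : Tm M s) (hr : Tm M r) :
    Df M fun v => DecidesLeast P₀ P h (t v) (s v) (r v) := by
  have hω : Fact (ZFSet.omega.{u} ∈ M) := ⟨omega_mem_model⟩
  have hv : ∀ {m : ℕ} {t s r : (Fin m → ZFSet.{u}) → ZFSet.{u}} [Tm M t] [Tm M s] [Tm M r],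
      Df M fun v => ForcesValue P h (t v) (s v) (r v) := fun {m t s r} ht hs hr =>
    Df.forcesMem hP hh (t := fun v => check P (ZFSet.pair (s v) (r v))) inferInstance ht
  have hd : Df M fun v : Fin 3 → ZFSet.{u} => DecidesLeast P₀ P h (v 0) (v 1) (v 2) := by
    unfold DecidesLeast DecidesSame
    infer_instance
  exact Df.bind (S := fun x v => DecidesLeast P₀ P h x (s v) (r v)) ht
    (Df.bind (S := fun y (w : Fin (n + 1) → ZFSet.{u}) =>
      DecidesLeast P₀ P h (w 0) y (r fun i => w i.succ)) hs.lift
    (Df.bind (S := fun z (w : Fin (n + 2) → ZFSet.{u}) => DecidesLeast P₀ P h (w 1) (w 0) z)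
      hr.lift.lift (Df.substVar hd ![2, 1, 0])))

theorem leastBranchName_mem_model (hP : P.IsPoset) {h : ZFSet.{u}} (hh : h ∈ M) :
    leastBranchName P₀ P h ∈ M := by
  have hω : Fact (ZFSet.omega.{u} ∈ M) := ⟨omega_mem_model⟩
  have hv : ∀ {m : ℕ} {t s r : (Fin m → ZFSet.{u}) → ZFSet.{u}} [Tm M t] [Tm M s] [Tm M r],
      Df M fun v => ForcesValue P h (t v) (s v) (r v) := fun {m t s r} ht hs hr =>
    Df.forcesMem hP hh (t := fun v => check P (ZFSet.pair (s v) (r v))) inferInstance ht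
  have hd : ∀ {m : ℕ} {t s r : (Fin m → ZFSet.{u}) → ZFSet.{u}} [Tm M t] [Tm M s] [Tm M r],
      Df M fun v => DecidesLeast P₀ P h (t v) (s v) (r v) := fun {m t s r} ht hs hr =>
    Df.decidesLeast hP hh ht hs hr
  unfold leastBranchName
  exact Tm.mem₀ inferInstance

/-- Totality is the density of `DecidesLeast` at length `k + 1`; uniqueness of values is the
agreement of compatible leftmost decisions. -/
theorem isRealName_leastBranchName (hP₀ : P₀.IsPoset) (hP : P.IsPoset)
    (hP₀P : CompleteSuborderOver M P₀ P) {h : ZFSet.{u}} (hh : IsRealName M P h) :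
    IsRealName M P₀ (leastBranchName P₀ P h) := by
  have hself : CompleteSuborderOver M P₀ P₀ :=
    ⟨⟨fun _ h => h, fun _ _ _ _ => Iff.rfl⟩, fun _ _ h => h⟩
  refine isRealName_intro hP₀ (leastBranchName_mem_model hP hh.1) isName_leastBranchName ?_ ?_ ?_
  · intro τ p hτ q hq
    obtain ⟨r, hr, ρ, a, hρ, -, e⟩ := hτ q hq
    obtain ⟨k, hk, m, hm, _, rfl, -, -⟩ := pair_mem_leastBranchName.1 hρ
    exact ⟨r, hr, k, hk, m, hm, e⟩
  · intro p hp k hk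
    obtain ⟨b, hb, hbp, q, H⟩ := exists_decidesLeast hP₀ hP hP₀P hh (ZFSet.omega_succ hk) hp
    obtain ⟨m, hm, hv⟩ := H.2.1 k (ZFSet.mem_insert k k)
    exact ⟨b, hbp, m, hm, forcesMem_of_pair_mem hP₀
      (pair_mem_leastBranchName.2 ⟨k, hk, m, hm, q, rfl, H, hv⟩) (hP₀.refl b hb)⟩
  · intro p hp k hk m hm m' hm' h1 h2
    obtain ⟨s, hs, k₁, hk₁, m₁, hm₁, e, a, q, hsa, H, hv⟩ :=
      forcesMem_leastBranchName hP₀ hP₀ hself hp h1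
    obtain ⟨rfl, rfl⟩ := ZFSet.pair_inj.1 e
    have hsP := hP₀.mem_left hs
    obtain ⟨s', hs', k₂, hk₂, m₂, hm₂, e, a', q', hsa', H', hv'⟩ :=
      forcesMem_leastBranchName hP₀ hP₀ hself hsP (forcesMem_mono hP₀ hs h2)
    obtain ⟨rfl, rfl⟩ := ZFSet.pair_inj.1 e
    have hag := DecidesLeast.agree hP₀ (ZFSet.omega_succ hk) (ZFSet.omega_succ hk) H H'
      ⟨s', hP₀.mem_left hs', hP₀.trans _ _ _ hs' hsa, hsa'⟩ (ZFSet.mem_insert k k)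
      (ZFSet.mem_insert k k) hm
    exact real_name_unique hP hh H'.1.2.1 hk hm hm' (hag.1 hv) hv'

/-- If `Q₀` forces that the least branch through the tree of possible values of `h` does not
dominate `C`, then `Q` forces that `h` does not dominate `C`. -/
theorem exists_le_forces_initial_segment {Q₀ Q : PosetData.{u}} (hP₀ : P₀.IsPoset) (hP : P.IsPoset)
    (hQ₀ : Q₀.IsPoset) (hQ : Q.IsPoset) (hP₀P : CompleteSuborderOver M P₀ P)
    (hP₀Q₀ : CompleteSuborderOver M P₀ Q₀) (hPQ : CompleteSuborderOver M P Q)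
    (hQ₀Q : Q₀.IsSuborder Q) (hred : ∀ a p, IsReduction P₀ P a p → IsReduction Q₀ Q a p)
    {h : ZFSet.{u}} (hh : IsRealName M P h) {t : List ℕ} {q : ZFSet.{u}} (hq : q ∈ Q₀.carrier)
    (ht : ∀ x ∈ finSeqSet.{u} t, ForcesMem Q₀ (check Q₀ x) (leastBranchName P₀ P h) q) :
    ∃ r, Q.Le r q ∧ ∀ x ∈ finSeqSet.{u} t, ForcesMem Q (check Q x) h r := by
  let k : ZFSet.{u} := natSet t.length
  have hk : k ∈ ZFSet.omega := mem_omega_iff.2 ⟨_, rfl⟩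
  have hkM : Fact (k ∈ M) := ⟨mem_model_of_mem_omega hk⟩
  have hdf : Df M fun v : Fin 1 → ZFSet.{u} =>
      ∃ p, p ∈ P.carrier ∧ DecidesLeast P₀ P h k (v 0) p := by
    have : ∀ {m : ℕ} {t s : (Fin m → ZFSet.{u}) → ZFSet.{u}} [Tm M t] [Tm M s],
        Df M fun v => DecidesLeast P₀ P h k (t v) (s v) := fun {m t s} ht hs =>
      Df.decidesLeast (t := fun _ => k) hP hh.1 inferInstance ht hs
    infer_instance
  -- One `p` decides the leftmost branch up to the length of `t`, so it will serve for all entries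
  -- of `t` simultaneously.
  obtain ⟨b, hb, ⟨p, hp, H⟩, s, hs, hsb, hsq⟩ := predense_of_dense hP₀ hP₀Q₀ _ (fun a ha => by
    obtain ⟨b, hb, hba, p, H⟩ := exists_decidesLeast hP₀ hP hP₀P hh hk ha
    exact ⟨b, hb, hba, (⟨p, H.1.2.1, H⟩ : ∃ p, p ∈ P.carrier ∧ DecidesLeast P₀ P h k b p)⟩) hq
  have hle : ∀ {a b}, Q₀.Le a b → Q.Le a b := fun {a b} hab =>
    (hQ₀Q.2 a (hQ₀.mem_left hab) b (hQ₀.mem_right hab)).1 hab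
  -- The lifted reduction makes `s`, which lies in `Q₀` only, compatible with `p` in `Q`.
  obtain ⟨-, -, hbp⟩ := hred b p H.1
  obtain ⟨r, hr, hrs, hrp⟩ := hbp s hs hsb
  refine ⟨r, hQ.trans _ _ _ hrs (hle hsq), fun x hx => ?_⟩
  obtain ⟨s', hs', j, hj, m, hm, e, a, p', hsa, H', hv⟩ :=
    forcesMem_leastBranchName hP₀ hQ₀ hP₀Q₀ hs (forcesMem_mono hQ₀ hsq (ht x hx))
  have hjk : j ∈ k := by
    obtain ⟨i, rfl⟩ := ZFSet.mem_range.1 hx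
    rw [← (ZFSet.pair_inj.1 e).1]
    exact mem_natSet.2 ⟨i, i.2, rfl⟩
  -- The condition `a` that put the entry `x` into the branch is met together with `b` below `s'`,
  -- so its decision and that of `p` agree at `j`.
  have hcompat : P₀.Compat b a := compat_of_compat hP₀ hP₀Q₀ hb H'.1.1
    ⟨s', hQ₀.mem_left hs', hQ₀.trans _ _ _ hs' hsb, hsa⟩
  have hpv := (DecidesLeast.agree hP₀ hk (ZFSet.omega_succ hj) H H' hcompat hjk
    (ZFSet.mem_insert j j) hm).2 hv
  have hxM : x ∈ M := by
    have : Fact (j ∈ M) := ⟨mem_model_of_mem_omega hj⟩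
    have : Fact (m ∈ M) := ⟨mem_model_of_mem_omega hm⟩
    rw [e]
    exact Tm.mem₀ inferInstance
  rw [ForcesValue, ← e] at hpv
  exact forcesMem_congr_left hQ (forcesEq_check_check hP hQ hPQ x r) (forcesMem_mono hQ hrp
    (forcesMem_transfer hP hQ hPQ (check_mem_model hxM) hh.1 (isName_check x) hh.2.1 hp hpv))

end Model

/-! ## Direct limits -/

section DirectLimit

variable {I : PosetData.{u}} {P : {i // i ∈ I.carrier} → PosetData.{u}}

theorem mem_dirLim_carrier {x : ZFSet.{u}} :
    x ∈ (dirLim I P).carrier ↔ ∃ i, x ∈ (P i).carrier :=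
  ZFSet.mem_iUnion

theorem dirLim_le_iff {a b : ZFSet.{u}} : (dirLim I P).Le a b ↔ ∃ i, (P i).Le a b :=
  ZFSet.mem_iUnion

theorem PosetData.Compat.dirLim {i : {i // i ∈ I.carrier}} {a b : ZFSet.{u}}
    (h : (P i).Compat a b) : (dirLim I P).Compat a b := by
  obtain ⟨r, hr, hra, hrb⟩ := h
  exact ⟨r, mem_dirLim_carrier.2 ⟨i, hr⟩, dirLim_le_iff.2 ⟨i, hra⟩, dirLim_le_iff.2 ⟨i, hrb⟩⟩

theorem PosetData.CompleteSuborder.over {P Q : PosetData.{u}} (h : CompleteSuborder P Q)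
    (M : Set ZFSet.{u}) : CompleteSuborderOver M P Q :=
  ⟨h.1, fun A _ => h.2 A trivial⟩

theorem PosetData.IsDirectedPoset.exists_ge (hdir : I.IsDirectedPoset)
    (i j : {i // i ∈ I.carrier}) : ∃ k : {i // i ∈ I.carrier}, I.Le i.1 k.1 ∧ I.Le j.1 k.1 := by
  obtain ⟨k, hk, h⟩ := hdir.2 i.1 i.2 j.1 j.2
  exact ⟨⟨k, hk⟩, h⟩

theorem PosetData.IsDirectedSystem.le (hP : IsDirectedSystem I P) {i j : {i // i ∈ I.carrier}}
    (hij : I.Le i.1 j.1) {a b : ZFSet.{u}} (h : (P i).Le a b) : (P j).Le a b :=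
  (hP.complete i j hij).le (hP.poset i) h

theorem PosetData.IsDirectedSystem.exists_ge_compat (hdir : I.IsDirectedPoset) (hP : IsDirectedSystem I P)
    (i : {i // i ∈ I.carrier}) {a b : ZFSet.{u}} (h : (dirLim I P).Compat a b) :
    ∃ j : {i // i ∈ I.carrier}, I.Le i.1 j.1 ∧ (P j).Compat a b := by
  obtain ⟨r, -, hra, hrb⟩ := h
  obtain ⟨j₁, hra⟩ := dirLim_le_iff.1 hra
  obtain ⟨j₂, hrb⟩ := dirLim_le_iff.1 hrb
  obtain ⟨j, h₁, h₂⟩ := hdir.exists_ge j₁ j₂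
  obtain ⟨k, hik, hjk⟩ := hdir.exists_ge i j
  have hra := hP.le (hdir.1.trans _ _ _ h₁ hjk) hra
  exact ⟨k, hik, r, (hP.poset k).mem_left hra, hra, hP.le (hdir.1.trans _ _ _ h₂ hjk) hrb⟩

theorem PosetData.IsDirectedSystem.exists_ge_mem (hdir : I.IsDirectedPoset) (hP : IsDirectedSystem I P)
    (i : {i // i ∈ I.carrier}) {a : ZFSet.{u}} (h : a ∈ (dirLim I P).carrier) :
    ∃ j : {i // i ∈ I.carrier}, I.Le i.1 j.1 ∧ a ∈ (P j).carrier := by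
  obtain ⟨j, hj⟩ := mem_dirLim_carrier.1 h
  obtain ⟨k, hik, hjk⟩ := hdir.exists_ge i j
  exact ⟨k, hik, (hP.complete j k hjk).1.1 hj⟩

theorem PosetData.IsDirectedSystem.isPoset_dirLim (hdir : I.IsDirectedPoset) (hP : IsDirectedSystem I P) :
    (dirLim I P).IsPoset where
  rel_subset x hx := by
    obtain ⟨i, hi⟩ := ZFSet.mem_iUnion.1 hx
    obtain ⟨a, ha, b, hb, rfl⟩ := ZFSet.mem_prod.1 ((hP.poset i).rel_subset hi)
    exact ZFSet.pair_mem_prod.2 ⟨mem_dirLim_carrier.2 ⟨i, ha⟩, mem_dirLim_carrier.2 ⟨i, hb⟩⟩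
  refl p hp := by
    obtain ⟨i, hi⟩ := mem_dirLim_carrier.1 hp
    exact dirLim_le_iff.2 ⟨i, (hP.poset i).refl p hi⟩
  trans p q r hpq hqr := by
    obtain ⟨i, hpq⟩ := dirLim_le_iff.1 hpq
    obtain ⟨j, hqr⟩ := dirLim_le_iff.1 hqr
    obtain ⟨k, hik, hjk⟩ := hdir.exists_ge i j
    exact dirLim_le_iff.2 ⟨k, (hP.poset k).trans p q r (hP.le hik hpq) (hP.le hjk hqr)⟩

/-- Each instance of compatibility in the limit, and each of its conditions, already appears at a
stage `j ≥ i`, where `P_i ⋖ P_j` applies. -/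
theorem PosetData.IsDirectedSystem.completeSuborder_dirLim (hdir : I.IsDirectedPoset)
    (hP : IsDirectedSystem I P) (i : {i // i ∈ I.carrier}) :
    CompleteSuborder (P i) (dirLim I P) := by
  refine ⟨⟨fun x hx => mem_dirLim_carrier.2 ⟨i, hx⟩, fun p hp q hq =>
    ⟨fun h => dirLim_le_iff.2 ⟨i, h⟩, fun h => ?_⟩⟩, fun A _ hA =>
    ⟨fun x hx => mem_dirLim_carrier.2 ⟨i, hA.1 hx⟩, fun a ha b hb hab h => ?_, fun p hp => ?_⟩⟩
  · obtain ⟨j, h⟩ := dirLim_le_iff.1 h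
    obtain ⟨k, hik, hjk⟩ := hdir.exists_ge i j
    exact ((hP.complete i k hik).1.2 p hp q hq).2 (hP.le hjk h)
  · obtain ⟨j, hij, h⟩ := hP.exists_ge_compat hdir i h
    exact ((hP.complete i j hij).2 A trivial hA).2.1 a ha b hb hab h
  · obtain ⟨j, hij, hj⟩ := hP.exists_ge_mem hdir i hp
    obtain ⟨a, ha, h⟩ := ((hP.complete i j hij).2 A trivial hA).2.2 p hj
    exact ⟨a, ha, h.dirLim⟩

/-! ### The limit inside the model, and lifting of reductions and antichains -/

theorem mem_seqSet {x : ZFSet.{u}} :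
    x ∈ seqSet I P ↔ ∃ i : {i // i ∈ I.carrier}, ZFSet.pair i.1 (P i).toSet = x :=
  ZFSet.mem_range

variable {M : Set ZFSet.{u}} [hM : Fact (IsTransitiveModelZFC M)]

theorem fst_mem_model {x y : ZFSet.{u}} (h : ZFSet.pair x y ∈ M) : x ∈ M :=
  mem_model (mem_model (x := {x}) h (by simp [ZFSet.pair])) (ZFSet.mem_singleton.2 rfl)

theorem snd_mem_model {x y : ZFSet.{u}} (h : ZFSet.pair x y ∈ M) : y ∈ M :=
  mem_model (mem_model (x := {x, y}) h (by simp [ZFSet.pair])) (by simp)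

set_option synthInstance.maxHeartbeats 400000 in
set_option synthInstance.maxSize 2000 in
theorem dirLim_toSet_mem_model (hS : seqSet I P ∈ M) : (dirLim I P).toSet ∈ M := by
  have : Fact (seqSet I P ∈ M) := ⟨hS⟩
  -- Two unions open the pair `⟨i, P_i⟩`, two more open `⟨carrier, order⟩`, and the fifth reaches
  -- the elements.
  let V := ZFSet.sUnion (ZFSet.sUnion (ZFSet.sUnion (ZFSet.sUnion (ZFSet.sUnion (seqSet I P)))))
  have hP : ∀ i, (P i).toSet ∈ M := fun i => snd_mem_model (mem_model hS (mem_seqSet.2 ⟨i, rfl⟩))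
  have mem_V : ∀ i x y, y ∈ ({(P i).carrier, (P i).rel} : ZFSet.{u}) → x ∈ y → x ∈ V := by
    intro i x y hy hx
    have h₁ : ZFSet.pair i.1 (P i).toSet ∈ seqSet I P := mem_seqSet.2 ⟨i, rfl⟩
    have h₂ : (P i).toSet ∈ ZFSet.sUnion (ZFSet.sUnion (seqSet I P)) := right_mem_sUnion_sUnion h₁
    refine ZFSet.mem_sUnion.2 ⟨y, ZFSet.mem_sUnion.2 ⟨_, ZFSet.mem_sUnion.2 ⟨_, h₂, ?_⟩, hy⟩, hx⟩
    simp [toSet, ZFSet.pair]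
  have hc : (dirLim I P).carrier = ZFSet.sep (fun x => ∃ z, z ∈ seqSet I P ∧ ∃ i, i ∈ M ∧
      ∃ C, C ∈ M ∧ ∃ R, R ∈ M ∧ z = ZFSet.pair i (ZFSet.pair C R) ∧ x ∈ C) V := by
    ext x
    rw [mem_dirLim_carrier, ZFSet.mem_sep]
    constructor
    · rintro ⟨i, hi⟩
      have h := mem_model hS (mem_seqSet.2 ⟨i, rfl⟩)
      exact ⟨mem_V i x _ (by simp) hi, _, mem_seqSet.2 ⟨i, rfl⟩, i.1, fst_mem_model h,
        _, fst_mem_model (hP i), _, snd_mem_model (hP i), rfl, hi⟩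
    · rintro ⟨-, z, hz, j, -, C, -, R, -, rfl, hx⟩
      obtain ⟨i, hi⟩ := mem_seqSet.1 hz
      obtain ⟨-, e⟩ := ZFSet.pair_inj.1 hi
      obtain ⟨rfl, -⟩ := ZFSet.pair_inj.1 e
      exact ⟨i, hx⟩
  have hr : (dirLim I P).rel = ZFSet.sep (fun x => ∃ z, z ∈ seqSet I P ∧ ∃ i, i ∈ M ∧
      ∃ C, C ∈ M ∧ ∃ R, R ∈ M ∧ z = ZFSet.pair i (ZFSet.pair C R) ∧ x ∈ R) V := by
    ext x
    rw [show x ∈ (dirLim I P).rel ↔ ∃ i, x ∈ (P i).rel from ZFSet.mem_iUnion, ZFSet.mem_sep]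
    constructor
    · rintro ⟨i, hi⟩
      have h := mem_model hS (mem_seqSet.2 ⟨i, rfl⟩)
      exact ⟨mem_V i x _ (by simp) hi, _, mem_seqSet.2 ⟨i, rfl⟩, i.1, fst_mem_model h,
        _, fst_mem_model (hP i), _, snd_mem_model (hP i), rfl, hi⟩
    · rintro ⟨-, z, hz, j, -, C, -, R, -, rfl, hx⟩
      obtain ⟨i, hi⟩ := mem_seqSet.1 hz
      obtain ⟨-, e⟩ := ZFSet.pair_inj.1 hi
      obtain ⟨-, rfl⟩ := ZFSet.pair_inj.1 e
      exact ⟨i, hx⟩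
  rw [toSet, hc, hr]
  dsimp only [V]
  exact Tm.mem₀ inferInstance

theorem PosetData.carrier_mem_model {P : PosetData.{u}} (h : P.toSet ∈ M) :
    Fact (P.carrier ∈ M) :=
  ⟨fst_mem_model h⟩

theorem PosetData.rel_mem_model {P : PosetData.{u}} (h : P.toSet ∈ M) : Fact (P.rel ∈ M) :=
  ⟨snd_mem_model h⟩

/-- Place `q` in some `P_j` with `j ≥ i`. Compatibility with `q` in the limit reflects to `P_j`,
correctness of the square for `i, j` moves the reduction to `Q_i, Q_j`, and compatibility in `Q_j`
persists to the limit. -/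
theorem isReduction_dirLim {Q : {i // i ∈ I.carrier} → PosetData.{u}}
    (hdir : I.IsDirectedPoset) (hP : IsDirectedSystem I P) (hPM : ∀ i, (P i).toSet ∈ M)
    (hcorrect : ∀ i j, I.Le i.1 j.1 → CorrectOver M (P i) (P j) (Q i) (Q j))
    {i : {i // i ∈ I.carrier}} {p q : ZFSet.{u}} (h : IsReduction (P i) (dirLim I P) p q) :
    IsReduction (Q i) (dirLim I Q) p q := by
  obtain ⟨hp, hq, hred⟩ := h
  obtain ⟨j, hij, hqj⟩ := hP.exists_ge_mem hdir i hq
  have := carrier_mem_model (hPM j)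
  have := rel_mem_model (hPM j)
  have h : IsReduction (P i) (P j) p q := ⟨hp, hqj, fun r hr hrp => by
    obtain ⟨k, hjk, hk⟩ := hP.exists_ge_compat hdir j (hred r hr hrp)
    exact compat_of_compat (hP.poset j) ((hP.complete j k hjk).over M)
      ((hP.complete i j hij).1.1 hr) hqj hk⟩
  obtain ⟨hpQ, hqQ, hredQ⟩ := (hcorrect i j hij).reduction p q h
  exact ⟨hpQ, mem_dirLim_carrier.2 ⟨j, hqQ⟩, fun r hr hrp => (hredQ r hr hrp).dirLim⟩

/-- Incompatibility is checked at a single stage. Maximality is not, because `A` need not be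
contained in any one `P_i`; reductions to `P_i` replace its members there. -/
theorem completeSuborderOver_dirLim {Q : {i // i ∈ I.carrier} → PosetData.{u}}
    (hdir : I.IsDirectedPoset) (hP : IsDirectedSystem I P) (hPM : ∀ i, (P i).toSet ∈ M)
    (hlim : (dirLim I P).toSet ∈ M) (hQ : IsDirectedSystem I Q)
    (hPQ : ∀ i, CompleteSuborderOver M (P i) (Q i))
    (hred : ∀ i p q, IsReduction (P i) (dirLim I P) p q → IsReduction (Q i) (dirLim I Q) p q) :
    CompleteSuborderOver M (dirLim I P) (dirLim I Q) := by
  have hcar : (dirLim I P).carrier ⊆ (dirLim I Q).carrier := fun x hx => by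
    obtain ⟨i, hi⟩ := mem_dirLim_carrier.1 hx
    exact mem_dirLim_carrier.2 ⟨i, (hPQ i).1.1 hi⟩
  have hlimP := hP.isPoset_dirLim hdir
  have hlimQ := hQ.isPoset_dirLim hdir
  have common : ∀ {p q}, p ∈ (dirLim I P).carrier → q ∈ (dirLim I P).carrier →
      ∃ i, p ∈ (P i).carrier ∧ q ∈ (P i).carrier := fun {p q} hp hq => by
    obtain ⟨i, hi⟩ := mem_dirLim_carrier.1 hp
    obtain ⟨j, hij, hj⟩ := hP.exists_ge_mem hdir i hq
    exact ⟨j, (hP.complete i j hij).1.1 hi, hj⟩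
  refine ⟨⟨hcar, fun p hp q hq => ?_⟩, fun A hAM hA => ⟨fun a ha => hcar (hA.1 ha), ?_, ?_⟩⟩
  · obtain ⟨i, hpi, hqi⟩ := common hp hq
    rw [← (hP.completeSuborder_dirLim hdir i).1.2 p hpi q hqi, (hPQ i).1.2 p hpi q hqi,
      (hQ.completeSuborder_dirLim hdir i).1.2 p ((hPQ i).1.1 hpi) q ((hPQ i).1.1 hqi)]
  · intro a ha b hb hab h
    obtain ⟨i, hai, hbi⟩ := common (hA.1 ha) (hA.1 hb)
    obtain ⟨j, hij, h⟩ := hQ.exists_ge_compat hdir i h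
    have := carrier_mem_model (hPM j)
    have := rel_mem_model (hPM j)
    exact hA.2.1 a ha b hb hab (compat_of_compat (hP.poset j) (hPQ j)
      ((hP.complete i j hij).1.1 hai) ((hP.complete i j hij).1.1 hbi) h).dirLim
  · intro q hq
    obtain ⟨i, hqi⟩ := mem_dirLim_carrier.1 hq
    have := carrier_mem_model (hPM i)
    have := rel_mem_model (hPM i)
    have := carrier_mem_model hlim
    have := rel_mem_model hlim
    have : Fact (A ∈ M) := ⟨hAM⟩
    -- Reductions of conditions `a'` below members of `A`, rather than of the members themselves,
    -- are dense: a given `b` has a common extension `a'` with some `a ∈ A`, which reduces to a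
    -- condition below `b`.
    obtain ⟨b, hb, ⟨a, ha, a', ha', haa, hba⟩, r, hr, hrb, hrq⟩ :=
      predense_of_dense (hP.poset i) (hPQ i) (fun b => ∃ a, a ∈ A ∧ ∃ a', a' ∈ (dirLim I P).carrier ∧
        (dirLim I P).Le a' a ∧ IsReduction (P i) (dirLim I P) b a') (fun b hb => by
        have hPi := (hP.completeSuborder_dirLim hdir i).over M
        obtain ⟨a, ha, a', ha', haa, hab⟩ := hA.2.2 b (hPi.1.1 hb)
        obtain ⟨c, hc, hcb, hred⟩ := exists_reduction_le (hP.poset i) hlimP hPi hb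
          ⟨a', ha', hab, hlimP.refl a' ha'⟩
        exact ⟨c, hc, hcb, a, ha, a', ha', haa, hred⟩) hqi
    -- Since `r ≤ b` in `Q_i`, the lifted reduction makes `r`, and with it `q`, compatible with
    -- `a'`.
    obtain ⟨s, hs, hsr, hsa⟩ := (hred i b a' hba).2.2 r hr hrb
    refine ⟨a, ha, s, hs, hlimQ.trans _ _ _ hsa ?_, hlimQ.trans _ _ _ hsr (dirLim_le_iff.2 ⟨i, hrq⟩)⟩
    obtain ⟨j, hj⟩ := dirLim_le_iff.1 haa
    exact dirLim_le_iff.2 ⟨j, (hPQ j).le (hP.poset j) hj⟩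

end DirectLimit

end ForcingLimit

end

open ForcingLimit
theorem theorem3p19 (M N : Set ZFSet.{u})
    (hM : IsTransitiveModelZFC M) (hN : IsTransitiveModelZFC N) (hMN : M ⊆ N)
    (R : ℕ → Set ((ℕ → ℕ) × (ℕ → ℕ))) (hR : IsRelSequence R)
    (U : ZFSet.{u}) (hU : U ∈ M) (hUR : IsCode U R)
    (c : ℕ → ℕ) (hcN : realSet.{u} c ∈ N) (hcM : UnboundedOver M R c)
    (I : PosetData.{u}) (hI : I.toSet ∈ M) (hdir : I.IsDirectedPoset)
    (P Q : {i // i ∈ I.carrier} → PosetData.{u})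
    (hPM : PosetData.seqSet I P ∈ M) (hP : PosetData.IsDirectedSystem I P)
    (hQN : PosetData.seqSet I Q ∈ N) (hQ : PosetData.IsDirectedSystem I Q)
    (hstar : ∀ i, StarProperty M N U c (P i) (Q i))
    (hcorrect : ∀ i j, I.Le i.1 j.1 → PosetData.CorrectOver M (P i) (P j) (Q i) (Q j)) :
    StarProperty M N U c (PosetData.dirLim I P) (PosetData.dirLim I Q) ∧
      ∀ i, PosetData.CorrectOver M (P i) (PosetData.dirLim I P)
        (Q i) (PosetData.dirLim I Q) := by
  have : Fact (IsTransitiveModelZFC M) := ⟨hM⟩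
  have : Fact (IsTransitiveModelZFC N) := ⟨hN⟩
  have hlimP := hP.isPoset_dirLim hdir
  have hlimQ := hQ.isPoset_dirLim hdir
  have hPlim := dirLim_toSet_mem_model hPM
  have hQlim := dirLim_toSet_mem_model hQN
  have hPiM : ∀ i, (P i).toSet ∈ M := fun i => (hstar i).mem_left
  have hred : ∀ i p q, PosetData.IsReduction (P i) (PosetData.dirLim I P) p q →
      PosetData.IsReduction (Q i) (PosetData.dirLim I Q) p q := fun i p q h =>
    isReduction_dirLim hdir hP hPiM hcorrect h
  have hPQ : PosetData.CompleteSuborderOver M (PosetData.dirLim I P) (PosetData.dirLim I Q) :=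
    completeSuborderOver_dirLim hdir hP hPiM hPlim hQ (fun i => (hstar i).complete) hred
  refine ⟨⟨hlimP, hlimQ, hPlim, hQlim, hPQ, fun h hh => ?_⟩, fun i => ⟨hP.poset i, hlimP, hQ.poset i,
    hlimQ, hPiM i, hPlim, hP.completeSuborder_dirLim hdir i, (hstar i).complete, hPQ,
    hQ.completeSuborder_dirLim hdir i, hred i⟩⟩
  have hUpair : ∀ x ∈ U, ∃ n s t, x = ZFSet.pair n (ZFSet.pair s t) := fun x hx => by
    obtain ⟨n, s, t, e⟩ := hUR.1 x hx
    exact ⟨_, _, _, e⟩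
  have := PosetData.carrier_mem_model hPlim
  have := PosetData.rel_mem_model hPlim
  have := PosetData.carrier_mem_model hQlim
  refine (forcedBy_notDominatedF_iff hlimQ hcN ⟨hMN hh.1, hh.2.1.mono hPQ.1.1⟩ (hMN hU) hUpair).2
    fun n hn q hq => ?_
  obtain ⟨i, hqi⟩ := mem_dirLim_carrier.1 hq
  have := PosetData.carrier_mem_model (hPiM i)
  have := PosetData.rel_mem_model (hPiM i)
  have := PosetData.carrier_mem_model (hstar i).mem_right
  have hPi := (hP.completeSuborder_dirLim hdir i).over M
  -- The stage `i` is dictated by `q`; the hypothesis for `P_i, Q_i` is applied to the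
  -- leftmost-branch name computed over that stage.
  have hg := isRealName_leastBranchName (hP.poset i) hlimP hPi hh
  obtain ⟨r, hrq, s, t, hst, hs, ht⟩ := (forcedBy_notDominatedF_iff (hQ.poset i) hcN
    ⟨hMN hg.1, hg.2.1.mono (hstar i).complete.1.1⟩ (hMN hU) hUpair).1
    ((hstar i).unbounded _ hg) n hn q hqi
  -- Entries of `U` consist of finite sequences, so `t` has a length, up to which the branch must be
  -- followed.
  obtain ⟨_, _, t', e⟩ := hUR.1 _ hst
  obtain rfl := (ZFSet.pair_inj.1 (ZFSet.pair_inj.1 e).2).2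
  obtain ⟨r', hr', H⟩ := exists_le_forces_initial_segment (hP.poset i) hlimP (hQ.poset i) hlimQ hPi
    (hstar i).complete hPQ (hQ.completeSuborder_dirLim hdir i).1 (hred i) hh
    ((hQ.poset i).mem_left hrq) ht
  exact ⟨r', hlimQ.trans _ _ _ hr' (dirLim_le_iff.2 ⟨i, hrq⟩), s, _, hst, hs, H⟩
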